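/- Let $z^*>0$, let $\tilde f:\mathbb R\to[0,+\infty)$ be strictly convex with $\tilde f(0)=0$, and let $f$ be the truncated convex potential $f(z)=\tilde f(z)$ for $z\le z^*$, $f(z)=\tilde f(z^*)$ for $z>z^*$. Let $\sigma>0$ and $m_n=e^{-\sigma n}$. For $N\ge 1$, $z\in\mathbb R$ and $u:\{0,\dots,N\}\to\mathbb R$ put $$F_N(u)=\sum_{i=1}^N f(u_i-u_{i-1})+\sum_{i,j=0}^N m_{|i-j|}(u_i-u_j)^2,\qquad \mathcal A(N;z)=\{u: u_0=0,\ u_N=Nz\},$$ and for $\theta\in[0,1]$ let $$\mathcal V(N;\theta)=\{u:\ \#\{i: u_i-u_{i-1}>z^*\}\le\theta N,\ \ \#\{i: u_i-u_{i-1}<z^*\}\le(1-\theta)N\}.$$ Let $$\widehat Q_\sigma f(z)=\lim_{N\to+\infty}\frac1N\inf\{F_N(u):u\in\mathcal A(N;z)\},\qquad \widehat Q_\sigma f(\theta,z)=\liminf_{N\to+\infty,\ \theta N\in\mathbb N}\frac1N\inf\{F_N(u):u\in\mathcal A(N;z)\cap\mathcal V(N;\theta)\}$$ for $z\in\mathbb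 R$ and $\theta\in\mathbb Q\cap[0,1]$ (with $\inf\emptyset=+\infty$). For irrational $\theta\in(0,1)$ let $\widehat Q_\sigma f(\theta,z)$ be the extension by continuity, $\liminf_{q\to\theta,\ q\in\mathbb Q}\widehat Q_\sigma f(q,z)$. With $a_\sigma=2\sum_{n\ge1}e^{-\sigma n}n^2$ set $Q_\sigma f(z)=\widehat Q_\sigma f(z)-a_\sigma z^2$ and $Q_\sigma f(\theta,z)=\widehat Q_\sigma f(\theta,z)-a_\sigma z^2$. A number $\theta\in[0,1]$ is called a locking state if the set $\{z\in\mathbb R: Q_\sigma f(\theta,z)=Q_\sigma f(z)\}$ contains a nonempty open interval. Then the limit defining $\widehat Q_\sigma f(z)$ exists and is finite for every $z\in\mathbb R$, and the set of locking states is exactly $$\Big\{\frac1N: N\in\mathbb N,\ N\ge 1\Big\}\cup\{0\}.$$ -/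

import Mathlib

open Filter Topology

namespace KernelRelaxation

noncomputable section

/-- The set of test functions with affine boundary data `u 0 = 0`, `u N = N z`. A lattice function on
`{0, …, N}` is represented by a sequence `ℕ → ℝ`; only its values at `0, …, N` are ever used. -/
def admissible (N : ℕ) (z : ℝ) : Set (ℕ → ℝ) :=
  {u | u 0 = 0 ∧ u N = N * z}

/-- The discrete energy on `{0, …, N}`: the nearest-neighbour potential `f` on the `N` bonds, plus the
quadratic long-range term with kernel `m`, summed over ordered pairs of nodes. -/
def energy (f : ℝ → ℝ) (m : ℕ → ℝ) (N : ℕ) (u : ℕ → ℝ) : ℝ :=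
  ∑ i ∈ Finset.range N, f (u (i + 1) - u i)
    + ∑ i ∈ Finset.range (N + 1), ∑ j ∈ Finset.range (N + 1),
        m ((i : ℤ) - (j : ℤ)).natAbs * (u i - u j) ^ 2

/-- The normalized minimum value `(1/N) inf {F(u) : u ∈ A(N;z)}`. -/
def meanMin (f : ℝ → ℝ) (m : ℕ → ℝ) (N : ℕ) (z : ℝ) : EReal :=
  ⨅ u ∈ admissible N z, ((energy f m N u / N : ℝ) : EReal)

/-- The relaxation of `f` with kernel `m`: the limit of the normalized minimum values. It is written
as a lower limit so that it is always defined. -/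
def relaxation (f : ℝ → ℝ) (m : ℕ → ℝ) (z : ℝ) : EReal :=
  liminf (fun N : ℕ => meanMin f m N z) atTop

/-- The coefficient `2 ∑_{n ≥ 1} m_n n²` (the term `n = 0` vanishes). -/
def kernelCoeff (m : ℕ → ℝ) : ℝ := 2 * ∑' n : ℕ, m n * (n : ℝ) ^ 2

/-- The `m`-transform of `f`. -/
def transform (f : ℝ → ℝ) (m : ℕ → ℝ) (z : ℝ) : EReal :=
  relaxation f m z - ((kernelCoeff m * z ^ 2 : ℝ) : EReal)

/-- Test functions with volume fraction `θ` of bonds in the phase `[zs, +∞)`, in closed form: at most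
`θ N` bonds are `> zs` and at most `(1 - θ) N` bonds are `< zs`. -/
def phaseConstraint (zs : ℝ) (N : ℕ) (θ : ℝ) : Set (ℕ → ℝ) :=
  {u | (((Finset.range N).filter fun i => zs < u (i + 1) - u i).card : ℝ) ≤ θ * N ∧
       (((Finset.range N).filter fun i => u (i + 1) - u i < zs).card : ℝ) ≤ (1 - θ) * N}

/-- The normalized minimum value with prescribed volume fraction; it is `+∞` if no test function
exists. -/
def constrainedMeanMin (f : ℝ → ℝ) (m : ℕ → ℝ) (zs : ℝ) (N : ℕ) (θ z : ℝ) : EReal :=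
  ⨅ u ∈ admissible N z ∩ phaseConstraint zs N θ, ((energy f m N u / N : ℝ) : EReal)

/-- The phase-constrained relaxation for a rational volume fraction `q`: the lower limit along those
`N` for which `q N` is a natural number. -/
def constrainedRelaxationRat (f : ℝ → ℝ) (m : ℕ → ℝ) (zs : ℝ) (q : ℚ) (z : ℝ) : EReal :=
  liminf (fun N : ℕ => constrainedMeanMin f m zs N (q : ℝ) z)
    (atTop ⊓ 𝓟 {N : ℕ | ∃ n : ℕ, q * (N : ℚ) = (n : ℚ)})

open Classical in
/-- The phase-constrained relaxation for a real volume fraction, extended by continuity from the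
rational to the irrational values of `θ` (the lower limit over rationals tending to `θ`). -/
def constrainedRelaxation (f : ℝ → ℝ) (m : ℕ → ℝ) (zs : ℝ) (θ z : ℝ) : EReal :=
  if h : ∃ q : ℚ, (q : ℝ) = θ then constrainedRelaxationRat f m zs h.choose z
  else liminf (fun q : ℚ => constrainedRelaxationRat f m zs q z)
    (comap (fun q : ℚ => (q : ℝ)) (𝓝 θ))

/-- The phase-constrained `m`-transform. -/
def constrainedTransform (f : ℝ → ℝ) (m : ℕ → ℝ) (zs : ℝ) (θ z : ℝ) : EReal :=
  constrainedRelaxation f m zs θ z - ((kernelCoeff m * z ^ 2 : ℝ) : EReal)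

/-- `θ ∈ [0, 1]` is a locking state if the set of `z` at which the constrained and the unconstrained
transforms agree contains a nonempty open interval. -/
def IsLockingState (f : ℝ → ℝ) (m : ℕ → ℝ) (zs : ℝ) (θ : ℝ) : Prop :=
  θ ∈ Set.Icc (0 : ℝ) 1 ∧
    ∃ α β : ℝ, α < β ∧
      Set.Ioo α β ⊆ {z : ℝ | constrainedTransform f m zs θ z = transform f m z}

/-- The truncation of `ft` at `zs`: equal to `ft` up to `zs`, constant beyond. -/
def truncated (ft : ℝ → ℝ) (zs : ℝ) (z : ℝ) : ℝ :=
  if z ≤ zs then ft z else ft zs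

/-- The exponential kernel `m_n = e^{-σ n}`. -/
def expKernel (σ : ℝ) (n : ℕ) : ℝ := Real.exp (-(σ * n))

end

end KernelRelaxation

/-! The inverse of the geometric kernel `ρ ^ |i - j|` is local. Up to a bounded boundary error, the
long-range energy is therefore the Legendre dual of a nearest-neighbour quadratic form in a stress
field `p`, with compliance `α` and gradient stiffness `β` (`longRange_bounds`). A lower bound of the
energy comes from any bounded `p`, and an upper bound from the displacement in equilibrium with `p`.

Write `p = l/2 - q`, where `l` is a load and `q` vanishes at the broken bonds (slope at least `zs`,
cost `c₀ = ft zs`). With `ψ` the Legendre transform of `ft` on `[0, zs]`, the dual problem splits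
into independent concave problems on the intervals between consecutive broken bonds. Each has a
value `opt l ℓ` depending only on the load and on the length. Hence, up to a bounded error, the
energy is at least `l N z - α l² N / 4` plus the sum of `c₀ + opt l ℓ` over these intervals
(`F_lower_bound`). Periodic configurations built on the maximizers attain this, and a subgradient of
the convex function `U` shows that there is no duality gap (`exists_multiplier`, `tendsto_meanMin`).

Locking rests on strict convexity of `opt l ℓ` in `ℓ`, obtained by comparing a maximizer with its
shift through maxima and minima (`two_mul_opt_lt`). The cost per unit length `(c₀ + opt l ℓ) / ℓ` is
thus minimal at a single length, or at two consecutive ones when `c₀` equals a threshold. The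
thresholds increase strictly with the load (`threshold_strictMonoOn`), so each length `n + 1` is the
unique optimum for an open interval of loads. The mean slope is continuous and strictly increasing
in the load, so this gives an open interval of `z` on which `1 / (n + 1)` is optimal
(`isLockingState_one_div`). For `z < 0` the unbroken uniform state is optimal, which gives `0`.

A fraction strictly between `1 / (n + 2)` and `1 / (n + 1)` forces, at each `z > 0` where it is
optimal, blocks of both lengths to be optimal. The load is then the one threshold load, and this
load determines `z` (`not_isLockingState_of_lt`). At negative `z`, prescribed broken bonds cost an
extra `θ c₀`. -/

namespace KernelRelaxation

noncomputable section

/-! ### The long-range quadratic form -/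

/-- The polarized long-range form with kernel `ρ ^ |i - j|` on the nodes `0, …, N`. -/
def longRange (ρ : ℝ) (N : ℕ) (u w : ℕ → ℝ) : ℝ :=
  ∑ i ∈ Finset.range (N + 1), ∑ j ∈ Finset.range (N + 1),
    ρ ^ ((i : ℤ) - (j : ℤ)).natAbs * ((u i - u j) * (w i - w j))

/-- Half of the total stress carried by the long-range interactions across the bond `k`. -/
def cutStress (ρ : ℝ) (N : ℕ) (w : ℕ → ℝ) (k : ℕ) : ℝ :=
  ∑ i ∈ Finset.range (k + 1), ∑ m ∈ Finset.range (N - k),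
    ρ ^ (k - i) * (ρ ^ (m + 1) * (w (k + 1 + m) - w i))

lemma longRange_succ (ρ : ℝ) (N : ℕ) (u w : ℕ → ℝ) :
    longRange ρ (N + 1) u w = longRange ρ N u w
      + 2 * ∑ i ∈ Finset.range (N + 1),
          (ρ ^ (N + 1 - i) * (w (N + 1) - w i)) * (u (N + 1) - u i) := by
  unfold longRange
  rw [Finset.sum_range_succ]
  simp_rw [Finset.sum_range_succ _ (N + 1)]
  rw [Finset.sum_add_distrib]
  have h1 : ∀ i ∈ Finset.range (N + 1),
      ρ ^ ((i : ℤ) - ((N + 1 : ℕ) : ℤ)).natAbs * ((u i - u (N + 1)) * (w i - w (N + 1)))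
        = (ρ ^ (N + 1 - i) * (w (N + 1) - w i)) * (u (N + 1) - u i) := by
    intro i hi
    have hi := Finset.mem_range.1 hi
    have : ((i : ℤ) - ((N + 1 : ℕ) : ℤ)).natAbs = N + 1 - i := by omega
    rw [this]; ring
  have h2 : ∀ i ∈ Finset.range (N + 1),
      ρ ^ (((N + 1 : ℕ) : ℤ) - (i : ℤ)).natAbs * ((u (N + 1) - u i) * (w (N + 1) - w i))
        = (ρ ^ (N + 1 - i) * (w (N + 1) - w i)) * (u (N + 1) - u i) := by
    intro i hi
    have hi := Finset.mem_range.1 hi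
    have : (((N + 1 : ℕ) : ℤ) - (i : ℤ)).natAbs = N + 1 - i := by omega
    rw [this]; ring
  rw [Finset.sum_congr rfl h1, Finset.sum_congr rfl h2]
  ring

lemma sum_bond_mul_partial_sum (c u : ℕ → ℝ) (n : ℕ) :
    ∑ k ∈ Finset.range n, (u (k + 1) - u k) * ∑ i ∈ Finset.range (k + 1), c i
      = ∑ i ∈ Finset.range n, c i * (u n - u i) := by
  induction n with
  | zero => simp
  | succ n ih =>
    rw [Finset.sum_range_succ, ih, Finset.sum_range_succ, Finset.sum_range_succ]
    have : ∑ i ∈ Finset.range n, c i * (u (n + 1) - u i)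
        = ∑ i ∈ Finset.range n, c i * (u n - u i)
          + (u (n + 1) - u n) * ∑ i ∈ Finset.range n, c i := by
      rw [Finset.mul_sum, ← Finset.sum_add_distrib]
      exact Finset.sum_congr rfl fun i _ => by ring
    rw [this]; ring

/-- The difference `u j - u i` is the sum of the increments between `i` and `j`, so each pair
distributes its stress over all the bonds that it spans. -/
lemma longRange_eq_cutStress (ρ : ℝ) (N : ℕ) (u w : ℕ → ℝ) :
    longRange ρ N u w
      = 2 * ∑ k ∈ Finset.range N, (u (k + 1) - u k) * cutStress ρ N w k := by
  induction N with
  | zero => simp [longRange]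
  | succ N ih =>
    rw [longRange_succ, ih, ← sum_bond_mul_partial_sum]
    have h : ∀ k ∈ Finset.range (N + 1), (u (k + 1) - u k) * cutStress ρ (N + 1) w k
        = (u (k + 1) - u k) * cutStress ρ N w k
          + (u (k + 1) - u k) * ∑ i ∈ Finset.range (k + 1),
              ρ ^ (N + 1 - i) * (w (N + 1) - w i) := by
      intro k hk
      have hk := Finset.mem_range.1 hk
      rw [← mul_add]
      congr 1
      unfold cutStress
      rw [← Finset.sum_add_distrib]
      refine Finset.sum_congr rfl fun i hi => ?_
      have hi := Finset.mem_range.1 hi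
      rw [show N + 1 - k = (N - k) + 1 by omega, Finset.sum_range_succ,
        show k + 1 + (N - k) = N + 1 by omega,
        show N + 1 - i = (k - i) + (N - k + 1) by omega, pow_add]
      ring
    have h' : cutStress ρ N w N = 0 := by simp [cutStress]
    rw [Finset.sum_congr rfl h, Finset.sum_add_distrib,
      Finset.sum_range_succ (fun k => (u (k + 1) - u k) * cutStress ρ N w k), h']
    ring

/-- Stiffness of the gradient term in the local (dual) form of the long-range energy. -/
def gradStiff (ρ : ℝ) : ℝ := (1 - ρ) / (2 * (1 + ρ))

/-- Compliance of the long-range energy at constant slope. -/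
def compliance (ρ : ℝ) : ℝ := gradStiff ρ * (1 - ρ) ^ 2 / ρ

lemma gradStiff_pos {ρ : ℝ} (h0 : 0 < ρ) (h1 : ρ < 1) : 0 < gradStiff ρ := by
  unfold gradStiff
  have : 0 < 1 - ρ := by linarith
  positivity

lemma compliance_pos {ρ : ℝ} (h0 : 0 < ρ) (h1 : ρ < 1) : 0 < compliance ρ := by
  unfold compliance
  have := gradStiff_pos h0 h1
  have : 0 < 1 - ρ := by linarith
  positivity

/-- The slope in equilibrium with the stress field `p`, at the middle of three consecutive bonds. -/
def stressSlope (ρ x y z : ℝ) : ℝ := compliance ρ * y + gradStiff ρ * (2 * y - x - z)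

/-- The displacement whose slopes are the `stressSlope`s of the stress `g (k + 1) - g k`. -/
def stressDisp (ρ : ℝ) (g : ℕ → ℝ) (i : ℕ) : ℝ :=
  stressSlope ρ (g i) (g (i + 1)) (g (i + 2))

lemma stressSlope_eq {ρ : ℝ} (h0 : 0 < ρ) (x y z : ℝ) :
    stressSlope ρ x y z = gradStiff ρ / ρ * ((1 + ρ ^ 2) * y - ρ * x - ρ * z) := by
  unfold stressSlope compliance
  field_simp
  ring

lemma left_sum_one {ρ : ℝ} (h1 : ρ < 1) (k : ℕ) :
    ∑ i ∈ Finset.range (k + 1), ρ ^ (k - i) = (1 - ρ ^ (k + 1)) / (1 - ρ) := by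
  have : 1 - ρ ≠ 0 := by linarith
  induction k with
  | zero => simp; field_simp
  | succ k ih =>
    rw [Finset.sum_range_succ]
    have : ∀ i ∈ Finset.range (k + 1), ρ ^ (k + 1 - i) = ρ * ρ ^ (k - i) := by
      intro i hi
      have := Finset.mem_range.1 hi
      rw [show k + 1 - i = (k - i) + 1 by omega, pow_succ]; ring
    rw [Finset.sum_congr rfl this, ← Finset.mul_sum, ih]
    simp
    field_simp
    ring

/-- By `stressSlope_eq`, `stressDisp` applies to `g` a multiple of `(1 - ρT)(1 - ρT⁻¹)`, with `T`
the unit shift. One factor inverts the one-sided geometric sum, which telescopes to end terms. -/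
lemma left_sum_disp {ρ : ℝ} (h0 : 0 < ρ) (g : ℕ → ℝ) (k : ℕ) :
    ∑ i ∈ Finset.range (k + 1), ρ ^ (k - i) * stressDisp ρ g i
      = gradStiff ρ / ρ
        * ((g (k + 1) - ρ * g (k + 2)) - ρ ^ (k + 1) * (g 0 - ρ * g 1)) := by
  induction k with
  | zero =>
    rw [zero_add, Finset.sum_range_one, stressDisp, stressSlope_eq h0]
    simp only [zero_add, Nat.sub_self, pow_zero, pow_one]
    ring
  | succ k ih =>
    rw [Finset.sum_range_succ]
    have : ∀ i ∈ Finset.range (k + 1), ρ ^ (k + 1 - i) * stressDisp ρ g i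
        = ρ * (ρ ^ (k - i) * stressDisp ρ g i) := by
      intro i hi
      have := Finset.mem_range.1 hi
      rw [show k + 1 - i = (k - i) + 1 by omega, pow_succ]; ring
    rw [Finset.sum_congr rfl this, ← Finset.mul_sum, ih, stressDisp, stressSlope_eq h0]
    simp
    ring

lemma right_sum_one {ρ : ℝ} (h1 : ρ < 1) (n : ℕ) :
    ∑ m ∈ Finset.range n, ρ ^ m = (1 - ρ ^ n) / (1 - ρ) := by
  have : 1 - ρ ≠ 0 := by linarith
  have : ρ - 1 ≠ 0 := by linarith
  rw [geom_sum_eq (by linarith)]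
  field_simp
  ring

lemma right_sum_disp {ρ : ℝ} (h0 : 0 < ρ) (g : ℕ → ℝ) (k n : ℕ) :
    ∑ m ∈ Finset.range n, ρ ^ m * stressDisp ρ g (k + m)
      = gradStiff ρ / ρ
        * ((g (k + 1) - ρ * g k) - ρ ^ n * (g (k + n + 1) - ρ * g (k + n))) := by
  induction n with
  | zero => simp
  | succ n ih =>
    rw [Finset.sum_range_succ, ih, stressDisp, stressSlope_eq h0]
    simp only [add_assoc, Nat.reduceAdd]
    ring

/-- For nodes on opposite sides of a bond the kernel is a product of a left and a right factor, so
the cut stress reduces to the four one-sided sums above. -/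
lemma two_cutStress {ρ : ℝ} (h0 : 0 < ρ) (h1 : ρ < 1) (g : ℕ → ℝ) (k n : ℕ) :
    2 * cutStress ρ (k + n) (stressDisp ρ g) k = (g (k + 2) - g (k + 1))
      - (1 / (1 + ρ)) *
        (ρ ^ (k + 1) * ((g (k + 2) - g 0) - ρ * (g (k + 1) - g 1))
          + ρ ^ n * ((g (k + n + 2) - g (k + 1)) - ρ * (g (k + n + 1) - g (k + 2)))
          - ρ ^ (k + n + 1) * ((g (k + n + 2) - g 0) - ρ * (g (k + n + 1) - g 1))) := by
  have hne : 1 - ρ ≠ 0 := by linarith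
  have hne' : 1 + ρ ≠ 0 := by linarith
  have : cutStress ρ (k + n) (stressDisp ρ g) k
      = ρ * ((∑ i ∈ Finset.range (k + 1), ρ ^ (k - i))
          * (∑ m ∈ Finset.range n, ρ ^ m * stressDisp ρ g (k + 1 + m))
        - (∑ i ∈ Finset.range (k + 1), ρ ^ (k - i) * stressDisp ρ g i)
          * (∑ m ∈ Finset.range n, ρ ^ m)) := by
    unfold cutStress
    rw [show k + n - k = n by omega, Finset.sum_mul_sum, Finset.sum_mul_sum,
      ← Finset.sum_sub_distrib, Finset.mul_sum]
    refine Finset.sum_congr rfl fun i _ => ?_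
    rw [← Finset.sum_sub_distrib, Finset.mul_sum]
    refine Finset.sum_congr rfl fun m _ => ?_
    ring
  rw [this, left_sum_one h1, left_sum_disp h0, right_sum_one h1, right_sum_disp h0]
  unfold gradStiff
  rw [show k + 1 + 1 = k + 2 by ring, show k + 1 + n + 1 = k + n + 2 by ring,
    show k + 1 + n = k + n + 1 by ring]
  rw [show k + n + 1 = (k + 1) + n by ring, pow_add]
  field_simp
  ring

lemma abs_sub_le_of_increments {g : ℕ → ℝ} {P : ℝ} (hg : ∀ k, |g (k + 1) - g k| ≤ P)
    (a n : ℕ) : |g (a + n) - g a| ≤ n * P := by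
  induction n with
  | zero => simp
  | succ n ih =>
    have := hg (a + n)
    have h3 := abs_add_le (g (a + n + 1) - g (a + n)) (g (a + n) - g a)
    rw [show g (a + n + 1) - g (a + n) + (g (a + n) - g a) = g (a + (n + 1)) - g a by
      rw [← add_assoc]; ring] at h3
    push_cast
    linarith

/-- The stress of the displacement `stressDisp ρ g` is `g (k + 2) - g (k + 1)`, up to an error
concentrated at the ends of the chain. -/
lemma cutStress_error {ρ : ℝ} (h0 : 0 < ρ) (h1 : ρ < 1) {g : ℕ → ℝ} {P : ℝ}
    (hg : ∀ k, |g (k + 1) - g k| ≤ P) (k n : ℕ) :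
    |2 * cutStress ρ (k + n) (stressDisp ρ g) k - (g (k + 2) - g (k + 1))|
      ≤ 4 * P * ((k + 2) * ρ ^ (k + 1) + (n + 1) * ρ ^ n) := by
  have hP : 0 ≤ P := (abs_nonneg _).trans (hg 0)
  rw [two_cutStress h0 h1]
  have key : ∀ a b c d : ℝ, |a| ≤ c → |b| ≤ d → |a - ρ * b| ≤ c + d := by
    intro a b c d ha hb
    have hb' : |ρ * b| ≤ d := by
      rw [abs_mul, abs_of_pos h0]
      nlinarith [abs_nonneg b]
    exact (abs_sub _ _).trans (add_le_add ha hb')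
  have hs : ∀ a n : ℕ, |g (a + n) - g a| ≤ n * P := abs_sub_le_of_increments hg
  have s1 : |g (k + 2) - g 0| ≤ (k + 2 : ℕ) * P := by simpa using hs 0 (k + 2)
  have s2 : |g (k + 1) - g 1| ≤ k * P := by simpa [add_comm] using hs 1 k
  have s3 : |g (k + n + 2) - g (k + 1)| ≤ (n + 1 : ℕ) * P := by
    have := hs (k + 1) (n + 1)
    rwa [show k + 1 + (n + 1) = k + n + 2 by ring] at this
  have s4 : |g (k + n + 1) - g (k + 2)| ≤ (n + 1) * P := by
    rcases n with _ | n
    · rw [abs_sub_comm]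
      simpa using hg (k + 1)
    · have := hs (k + 2) n
      rw [show k + 2 + n = k + (n + 1) + 1 by ring] at this
      push_cast
      linarith
  have s5 : |g (k + n + 2) - g 0| ≤ (k + n + 2 : ℕ) * P := by simpa using hs 0 (k + n + 2)
  have s6 : |g (k + n + 1) - g 1| ≤ (k + n : ℕ) * P := by
    have := hs 1 (k + n)
    rwa [add_comm 1 (k + n)] at this
  have e1 := key _ _ _ _ s1 s2
  have e2 := key _ _ _ _ s3 s4
  have e3 := key _ _ _ _ s5 s6
  set A := (g (k + 2) - g 0) - ρ * (g (k + 1) - g 1)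
  set B := (g (k + n + 2) - g (k + 1)) - ρ * (g (k + n + 1) - g (k + 2))
  set C := (g (k + n + 2) - g 0) - ρ * (g (k + n + 1) - g 1)
  push_cast at e1 e2 e3
  have hk : 0 < ρ ^ (k + 1) := by positivity
  have hn : 0 < ρ ^ n := by positivity
  have hkn : 0 < ρ ^ (k + n + 1) := by positivity
  have i1 : ρ ^ (k + n + 1) ≤ ρ ^ (k + 1) := pow_le_pow_of_le_one h0.le h1.le (by omega)
  have i2 : ρ ^ (k + n + 1) ≤ ρ ^ n := pow_le_pow_of_le_one h0.le h1.le (by omega)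
  have f1 : |ρ ^ (k + 1) * A| ≤ ρ ^ (k + 1) * (2 * (k + 2) * P) := by
    rw [abs_mul, abs_of_pos hk]
    refine mul_le_mul_of_nonneg_left (e1.trans ?_) hk.le
    nlinarith
  have f2 : |ρ ^ n * B| ≤ ρ ^ n * (2 * (n + 1) * P) := by
    rw [abs_mul, abs_of_pos hn]
    exact mul_le_mul_of_nonneg_left (e2.trans (by nlinarith)) hn.le
  have f3 : |ρ ^ (k + n + 1) * C|
      ≤ ρ ^ (k + 1) * (2 * (k + 2) * P) + ρ ^ n * (2 * (n + 1) * P) := by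
    rw [abs_mul, abs_of_pos hkn]
    have : |C| ≤ 2 * (k + 2) * P + 2 * (n + 1) * P := e3.trans (by nlinarith)
    calc ρ ^ (k + n + 1) * |C|
        ≤ ρ ^ (k + n + 1) * (2 * (k + 2) * P + 2 * (n + 1) * P) :=
          mul_le_mul_of_nonneg_left this hkn.le
      _ = ρ ^ (k + n + 1) * (2 * (k + 2) * P) + ρ ^ (k + n + 1) * (2 * (n + 1) * P) := by ring
      _ ≤ _ := by gcongr
  have tot : |ρ ^ (k + 1) * A + ρ ^ n * B - ρ ^ (k + n + 1) * C|
      ≤ 4 * P * ((k + 2) * ρ ^ (k + 1) + (n + 1) * ρ ^ n) := by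
    refine (abs_sub _ _).trans ?_
    have := abs_add_le (ρ ^ (k + 1) * A) (ρ ^ n * B)
    linarith
  have hfr : 0 ≤ 1 / (1 + ρ) ∧ 1 / (1 + ρ) ≤ 1 := by
    refine ⟨by positivity, ?_⟩
    rw [div_le_one (by linarith)]; linarith
  set X := ρ ^ (k + 1) * A + ρ ^ n * B - ρ ^ (k + n + 1) * C
  rw [show g (k + 2) - g (k + 1) - 1 / (1 + ρ) * X - (g (k + 2) - g (k + 1))
    = -(1 / (1 + ρ) * X) by ring, abs_neg, abs_mul, abs_of_nonneg hfr.1]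
  nlinarith [abs_nonneg X]

lemma exists_boundary_bound {ρ : ℝ} (h0 : 0 < ρ) (h1 : ρ < 1) :
    ∃ K : ℝ, 0 ≤ K ∧ ∀ (N : ℕ) (g : ℕ → ℝ) (P : ℝ), (∀ k, |g (k + 1) - g k| ≤ P) →
      ∑ k ∈ Finset.range N,
        |2 * cutStress ρ N (stressDisp ρ g) k - (g (k + 2) - g (k + 1))| ≤ K * P := by
  have hs : Summable fun k : ℕ => ((k : ℝ) + 2) * ρ ^ (k + 1) := by
    have a := summable_pow_mul_geometric_of_norm_lt_one (R := ℝ) 1 (r := ρ)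
      (by rw [Real.norm_eq_abs, abs_of_pos h0]; exact h1)
    have b := summable_geometric_of_lt_one h0.le h1
    have c := (a.mul_left ρ).add (b.mul_left (2 * ρ))
    refine c.congr fun k => ?_
    simp [pow_succ]; ring
  have hpos : ∀ k : ℕ, 0 ≤ ((k : ℝ) + 2) * ρ ^ (k + 1) := fun k => by positivity
  refine ⟨8 * ∑' k : ℕ, ((k : ℝ) + 2) * ρ ^ (k + 1),
    mul_nonneg (by norm_num) (tsum_nonneg hpos), ?_⟩
  intro N g P hg
  have hP : 0 ≤ P := (abs_nonneg _).trans (hg 0)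
  have hsum : ∑ k ∈ Finset.range N, ((k : ℝ) + 2) * ρ ^ (k + 1)
      ≤ ∑' k : ℕ, ((k : ℝ) + 2) * ρ ^ (k + 1) := hs.sum_le_tsum _ fun k _ => hpos k
  -- The errors at the right end are those at the left end read backwards; hence `8 = 2 * 4`.
  have hrefl := Finset.sum_range_reflect (fun k : ℕ => ((k : ℝ) + 2) * ρ ^ (k + 1)) N
  have hle : ∀ k ∈ Finset.range N,
      |2 * cutStress ρ N (stressDisp ρ g) k - (g (k + 2) - g (k + 1))|
        ≤ 4 * P * (((k : ℝ) + 2) * ρ ^ (k + 1)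
          + (((N - 1 - k : ℕ) : ℝ) + 2) * ρ ^ (N - 1 - k + 1)) := by
    intro k hk
    have hk := Finset.mem_range.1 hk
    have := cutStress_error h0 h1 hg k (N - k)
    rw [show k + (N - k) = N by omega] at this
    rw [show N - 1 - k + 1 = N - k by omega]
    have e : ((N - 1 - k : ℕ) : ℝ) + 2 = ((N - k : ℕ) : ℝ) + 1 := by
      rw [show N - k = (N - 1 - k) + 1 by omega]; push_cast; ring
    rw [e]
    exact this
  refine (Finset.sum_le_sum hle).trans ?_
  rw [← Finset.mul_sum, Finset.sum_add_distrib, hrefl]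
  nlinarith

/-- Keep only nearest neighbours, each pair being counted in both orders. This coercivity absorbs
the boundary errors in `longRange_bounds`. -/
lemma two_mul_sum_sq_le_longRange {ρ : ℝ} (h0 : 0 < ρ) (N : ℕ) (u : ℕ → ℝ) :
    2 * ρ * ∑ k ∈ Finset.range N, (u (k + 1) - u k) ^ 2 ≤ longRange ρ N u u := by
  induction N with
  | zero => simp [longRange]
  | succ N ih =>
    rw [longRange_succ, Finset.sum_range_succ, Finset.sum_range_succ]
    have : 0 ≤ ∑ i ∈ Finset.range N,
        (ρ ^ (N + 1 - i) * (u (N + 1) - u i)) * (u (N + 1) - u i) :=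
      Finset.sum_nonneg fun i _ => by
        rw [mul_assoc]; exact mul_nonneg (by positivity) (mul_self_nonneg _)
    rw [show N + 1 - N = 1 by omega]
    nlinarith

lemma longRange_sub (ρ : ℝ) (N : ℕ) (u w : ℕ → ℝ) :
    longRange ρ N (u - w) (u - w)
      = longRange ρ N u u - 2 * longRange ρ N u w + longRange ρ N w w := by
  unfold longRange
  rw [Finset.mul_sum, ← Finset.sum_sub_distrib, ← Finset.sum_add_distrib]
  refine Finset.sum_congr rfl fun i _ => ?_
  rw [Finset.mul_sum, ← Finset.sum_sub_distrib, ← Finset.sum_add_distrib]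
  refine Finset.sum_congr rfl fun j _ => ?_
  simp only [Pi.sub_apply]
  ring

/-- The local (dual) form of the long-range energy, evaluated on a stress field. -/
def dualForm (ρ : ℝ) (N : ℕ) (p : ℕ → ℝ) : ℝ :=
  compliance ρ * ∑ k ∈ Finset.range N, p (k + 1) ^ 2
    + gradStiff ρ * ∑ k ∈ Finset.range (N + 1), (p (k + 1) - p k) ^ 2

lemma sum_stressSlope_mul (ρ : ℝ) (N : ℕ) (p : ℕ → ℝ) :
    ∑ k ∈ Finset.range N, stressSlope ρ (p k) (p (k + 1)) (p (k + 2)) * p (k + 1)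
      = dualForm ρ N p
        + gradStiff ρ * (p 0 * p 1 - p 0 ^ 2 + p N * p (N + 1) - p (N + 1) ^ 2) := by
  unfold dualForm
  induction N with
  | zero => simp; ring
  | succ N ih =>
    rw [Finset.sum_range_succ, ih, Finset.sum_range_succ (fun k => p (k + 1) ^ 2) N,
      Finset.sum_range_succ (fun k => (p (k + 1) - p k) ^ 2) (N + 1)]
    unfold stressSlope
    simp only [add_assoc, Nat.reduceAdd]
    ring

lemma abs_stressSlope_le {ρ : ℝ} (h0 : 0 < ρ) (h1 : ρ < 1) {P x y z : ℝ}
    (hx : |x| ≤ P) (hy : |y| ≤ P) (hz : |z| ≤ P) :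
    |stressSlope ρ x y z| ≤ (compliance ρ + 4 * gradStiff ρ) * P := by
  have ha := compliance_pos h0 h1
  have hb := gradStiff_pos h0 h1
  rw [abs_le] at *
  unfold stressSlope
  constructor <;> nlinarith

/-- The displacement in equilibrium with the stress field `p`. -/
def dispOf (ρ : ℝ) (p : ℕ → ℝ) : ℕ → ℝ := stressDisp ρ fun k => ∑ i ∈ Finset.range k, p i

lemma dispOf_succ_sub (ρ : ℝ) (p : ℕ → ℝ) (k : ℕ) :
    dispOf ρ p (k + 1) - dispOf ρ p k = stressSlope ρ (p k) (p (k + 1)) (p (k + 2)) := by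
  simp only [dispOf, stressDisp, stressSlope, Finset.sum_range_succ, add_assoc, Nat.reduceAdd]
  ring

/-- Lower and upper bounds of the long-range energy through stress fields. -/
theorem longRange_bounds {ρ : ℝ} (h0 : 0 < ρ) (h1 : ρ < 1) :
    ∃ K : ℝ, 0 ≤ K ∧ ∀ (N : ℕ) (p : ℕ → ℝ) (P : ℝ), (∀ k, |p k| ≤ P) →
      (∀ u : ℕ → ℝ, 2 * ∑ k ∈ Finset.range N, p (k + 1) * (u (k + 1) - u k)
          - dualForm ρ N p - K * P ^ 2 ≤ longRange ρ N u u) ∧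
      longRange ρ N (dispOf ρ p) (dispOf ρ p)
        ≤ ∑ k ∈ Finset.range N, p (k + 1) * stressSlope ρ (p k) (p (k + 1)) (p (k + 2))
          + K * P ^ 2 := by
  obtain ⟨K, hK, hKb⟩ := exists_boundary_bound h0 h1
  have ha := compliance_pos h0 h1
  have hb := gradStiff_pos h0 h1
  refine ⟨K ^ 2 / (2 * ρ) + (compliance ρ + 4 * gradStiff ρ) * K + 2 * gradStiff ρ,
    by positivity, ?_⟩
  intro N p P hp
  have hP : 0 ≤ P := (abs_nonneg _).trans (hp 0)
  set g : ℕ → ℝ := fun k => ∑ i ∈ Finset.range k, p i with hgdef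
  have hg1 : ∀ k, g (k + 1) - g k = p k := fun k => by simp [hgdef, Finset.sum_range_succ]
  have hg : ∀ k, |g (k + 1) - g k| ≤ P := fun k => by rw [hg1]; exact hp k
  have hE := hKb N g P hg
  set w := dispOf ρ p with hw
  have hwg : stressDisp ρ g = w := rfl
  set e : ℕ → ℝ := fun k => 2 * cutStress ρ N w k - p (k + 1) with he
  have hE' : ∑ k ∈ Finset.range N, |e k| ≤ K * P := by
    refine le_of_eq_of_le (Finset.sum_congr rfl fun k _ => ?_) hE
    rw [hwg, hg1 (k + 1)]
  set t : ℕ → ℝ := fun k => stressSlope ρ (p k) (p (k + 1)) (p (k + 2)) with ht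
  have hwt : ∀ k, w (k + 1) - w k = t k := dispOf_succ_sub ρ p
  have hT : ∀ k, |t k| ≤ (compliance ρ + 4 * gradStiff ρ) * P := fun k =>
    abs_stressSlope_le h0 h1 (hp _) (hp _) (hp _)
  have hbil : ∀ u : ℕ → ℝ, longRange ρ N u w
      = ∑ k ∈ Finset.range N, (u (k + 1) - u k) * (p (k + 1) + e k) := by
    intro u
    rw [longRange_eq_cutStress, Finset.mul_sum]
    refine Finset.sum_congr rfl fun k _ => ?_
    simp only [he]; ring
  have hte : |∑ k ∈ Finset.range N, t k * e k|
      ≤ (compliance ρ + 4 * gradStiff ρ) * K * P ^ 2 := by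
    refine (Finset.abs_sum_le_sum_abs _ _).trans ?_
    have : ∀ k ∈ Finset.range N, |t k * e k|
        ≤ (compliance ρ + 4 * gradStiff ρ) * P * |e k| := by
      intro k _
      rw [abs_mul]
      exact mul_le_mul_of_nonneg_right (hT k) (abs_nonneg _)
    refine (Finset.sum_le_sum this).trans ?_
    rw [← Finset.mul_sum]
    have : 0 ≤ (compliance ρ + 4 * gradStiff ρ) * P := by positivity
    nlinarith
  have hww : longRange ρ N w w = ∑ k ∈ Finset.range N, p (k + 1) * t k
      + ∑ k ∈ Finset.range N, t k * e k := by
    rw [hbil, ← Finset.sum_add_distrib]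
    refine Finset.sum_congr rfl fun k _ => ?_
    rw [hwt]; ring
  have hpt : ∑ k ∈ Finset.range N, p (k + 1) * t k ≤ dualForm ρ N p + 2 * gradStiff ρ * P ^ 2 := by
    have := sum_stressSlope_mul ρ N p
    rw [Finset.sum_congr rfl fun k _ => mul_comm (p (k + 1)) (t k), this]
    have a1 := abs_le.1 (hp 0)
    have a2 := abs_le.1 (hp 1)
    have a3 := abs_le.1 (hp N)
    have a4 := abs_le.1 (hp (N + 1))
    have b1 : p 0 * p 1 - p 0 ^ 2 ≤ P ^ 2 := by nlinarith [sq_nonneg (p 0 - p 1 / 2)]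
    have b2 : p N * p (N + 1) - p (N + 1) ^ 2 ≤ P ^ 2 := by
      nlinarith [sq_nonneg (p (N + 1) - p N / 2)]
    nlinarith
  have hsq : ∑ k ∈ Finset.range N, e k ^ 2 ≤ K ^ 2 * P ^ 2 := by
    have h := Finset.sum_sq_le_sq_sum_of_nonneg (s := Finset.range N) (f := fun k => |e k|)
      (fun k _ => abs_nonneg _)
    simp only [sq_abs] at h
    refine h.trans ?_
    have : 0 ≤ ∑ k ∈ Finset.range N, |e k| := Finset.sum_nonneg fun k _ => abs_nonneg _
    nlinarith
  refine ⟨fun u => ?_, ?_⟩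
  -- Nonnegativity of the form at `u - w` would not suffice: the boundary error `e` is paired with
  -- increments of an arbitrary `u`. Coercivity and Young's inequality leave only the sum of `e k ^
  -- 2`.
  · have h := two_mul_sum_sq_le_longRange h0 N (u - w)
    rw [longRange_sub, hbil u, hww] at h
    have hexp : ∑ k ∈ Finset.range N, (u (k + 1) - u k) * (p (k + 1) + e k)
        = ∑ k ∈ Finset.range N, p (k + 1) * (u (k + 1) - u k)
          + ∑ k ∈ Finset.range N, ((u - w) (k + 1) - (u - w) k) * e k
          + ∑ k ∈ Finset.range N, t k * e k := by
      rw [← Finset.sum_add_distrib, ← Finset.sum_add_distrib]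
      refine Finset.sum_congr rfl fun k _ => ?_
      rw [← hwt]; simp only [Pi.sub_apply]; ring
    rw [hexp] at h
    have hy : -(1 / (2 * ρ)) * ∑ k ∈ Finset.range N, e k ^ 2
        ≤ 2 * ρ * ∑ k ∈ Finset.range N, ((u - w) (k + 1) - (u - w) k) ^ 2
          + 2 * ∑ k ∈ Finset.range N, ((u - w) (k + 1) - (u - w) k) * e k := by
      rw [Finset.mul_sum, Finset.mul_sum, Finset.mul_sum, ← Finset.sum_add_distrib]
      refine Finset.sum_le_sum fun k _ => ?_
      set d := (u - w) (k + 1) - (u - w) k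
      have : 2 * ρ * d ^ 2 + 2 * (d * e k) + 1 / (2 * ρ) * e k ^ 2
          = 1 / (2 * ρ) * (2 * ρ * d + e k) ^ 2 := by
        field_simp; ring
      have : 0 ≤ 1 / (2 * ρ) * (2 * ρ * d + e k) ^ 2 := by positivity
      linarith
    have hy2 : 1 / (2 * ρ) * ∑ k ∈ Finset.range N, e k ^ 2 ≤ K ^ 2 / (2 * ρ) * P ^ 2 := by
      have : 0 ≤ 1 / (2 * ρ) := by positivity
      calc _ ≤ 1 / (2 * ρ) * (K ^ 2 * P ^ 2) := mul_le_mul_of_nonneg_left hsq this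
        _ = _ := by ring
    have := (abs_le.1 hte).2
    have := (abs_le.1 hte).1
    linarith
  · rw [hww]
    have := (abs_le.1 hte).2
    have : 0 ≤ (K ^ 2 / (2 * ρ) + 2 * gradStiff ρ) * P ^ 2 := by positivity
    linarith

lemma energy_expKernel (f : ℝ → ℝ) (σ : ℝ) (N : ℕ) (u : ℕ → ℝ) :
    energy f (expKernel σ) N u
      = ∑ i ∈ Finset.range N, f (u (i + 1) - u i) + longRange (Real.exp (-σ)) N u u := by
  unfold energy longRange
  congr 1
  refine Finset.sum_congr rfl fun i _ => Finset.sum_congr rfl fun j _ => ?_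
  rw [expKernel, ← Real.exp_nat_mul]
  congr 2
  · ring
  · ring

/-! ### One-dimensional convex duality -/

lemma exists_subgradient {f : ℝ → ℝ} (hf : ConvexOn ℝ Set.univ f) (x : ℝ) :
    ∃ t : ℝ, ∀ y, f x + t * (y - x) ≤ f y := by
  refine ⟨derivWithin f (Set.Ioi x) x, fun y => ?_⟩
  rcases lt_trichotomy x y with h | h | h
  · have := hf.rightDeriv_le_slope_of_mem_interior (by simp) (Set.mem_univ y) h
    rw [slope_def_field, le_div_iff₀ (by linarith)] at this
    linarith
  · subst h; simp
  · have h1 := hf.slope_le_leftDeriv_of_mem_interior (Set.mem_univ y) (by simp) h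
    have h2 := hf.leftDeriv_le_rightDeriv_of_mem_interior (x := x) (by simp)
    have h3 := h1.trans h2
    rw [slope_def_field, div_le_iff₀ (by linarith)] at h3
    linarith

/-- The Legendre transform of the restriction of `ft` to `[0, zs]`. -/
def phaseConj (ft : ℝ → ℝ) (zs y : ℝ) : ℝ := sSup ((fun s => y * s - ft s) '' Set.Icc 0 zs)

variable {ft : ℝ → ℝ} {zs : ℝ}

lemma continuous_of_convex (hc : StrictConvexOn ℝ Set.univ ft) : Continuous ft :=
  continuousOn_univ.1 (hc.convexOn.continuousOn isOpen_univ)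

lemma phaseConj_isCompact (hc : StrictConvexOn ℝ Set.univ ft) (zs y : ℝ) :
    IsCompact ((fun s => y * s - ft s) '' Set.Icc 0 zs) :=
  isCompact_Icc.image (by have := continuous_of_convex hc; fun_prop)

lemma le_phaseConj (hc : StrictConvexOn ℝ Set.univ ft) {s : ℝ} (hs : s ∈ Set.Icc 0 zs)
    (y : ℝ) : y * s - ft s ≤ phaseConj ft zs y :=
  le_csSup (phaseConj_isCompact hc zs y).bddAbove ⟨s, hs, rfl⟩

lemma exists_phaseConj_eq (hc : StrictConvexOn ℝ Set.univ ft) (hzs : 0 < zs) (y : ℝ) :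
    ∃ s ∈ Set.Icc 0 zs, phaseConj ft zs y = y * s - ft s := by
  obtain ⟨s, hs, h⟩ := (phaseConj_isCompact hc zs y).sSup_mem
    ((Set.nonempty_Icc.2 hzs.le).image _)
  exact ⟨s, hs, h.symm⟩

lemma phaseConj_convex (hc : StrictConvexOn ℝ Set.univ ft) (hzs : 0 < zs) :
    ConvexOn ℝ Set.univ (phaseConj ft zs) := by
  refine ⟨convex_univ, fun x _ y _ a b ha hb hab => ?_⟩
  obtain ⟨s, hs, h⟩ := exists_phaseConj_eq hc hzs (a • x + b • y)
  rw [h]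
  have h1 := mul_le_mul_of_nonneg_left (le_phaseConj hc hs x) ha
  have h2 := mul_le_mul_of_nonneg_left (le_phaseConj hc hs y) hb
  have : ft s = a * ft s + b * ft s := by rw [← add_mul, hab, one_mul]
  simp only [smul_eq_mul]
  linarith

lemma phaseConj_mono (hc : StrictConvexOn ℝ Set.univ ft) (hzs : 0 < zs) :
    Monotone (phaseConj ft zs) := by
  intro x y hxy
  obtain ⟨s, hs, h⟩ := exists_phaseConj_eq hc hzs x
  rw [h]
  refine le_trans ?_ (le_phaseConj hc hs y)
  nlinarith [hs.1]

lemma phaseConj_nonneg (hc : StrictConvexOn ℝ Set.univ ft) (hzs : 0 < zs) (h0 : ft 0 = 0)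
    (y : ℝ) : 0 ≤ phaseConj ft zs y := by
  have := le_phaseConj hc (Set.left_mem_Icc.2 hzs.le) y
  simpa [h0] using this

lemma phaseConj_of_nonpos (hc : StrictConvexOn ℝ Set.univ ft) (hzs : 0 < zs) (h0 : ft 0 = 0)
    (hn : ∀ x, 0 ≤ ft x) {y : ℝ} (hy : y ≤ 0) : phaseConj ft zs y = 0 := by
  refine le_antisymm ?_ (phaseConj_nonneg hc hzs h0 y)
  obtain ⟨s, hs, h⟩ := exists_phaseConj_eq hc hzs y
  rw [h]
  nlinarith [hs.1, hn s]

lemma phaseConj_add_le (hc : StrictConvexOn ℝ Set.univ ft) (hzs : 0 < zs) {x y : ℝ}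
    (hxy : x ≤ y) : phaseConj ft zs y ≤ phaseConj ft zs x + zs * (y - x) := by
  obtain ⟨s, hs, h⟩ := exists_phaseConj_eq hc hzs y
  have := le_phaseConj hc hs x
  rw [h]
  nlinarith [hs.1, hs.2]

/-- Equality in Young's inequality at a subgradient of the Legendre transform. -/
lemma subgradient_phaseConj (hc : StrictConvexOn ℝ Set.univ ft) (hzs : 0 < zs) {y t : ℝ}
    (ht : ∀ x, phaseConj ft zs y + t * (x - y) ≤ phaseConj ft zs x) :
    t ∈ Set.Icc 0 zs ∧ phaseConj ft zs y = y * t - ft t := by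
  have hmem : t ∈ Set.Icc 0 zs := by
    constructor
    · have h1 := ht (y - 1)
      have h2 := phaseConj_mono hc hzs (show y - 1 ≤ y by linarith)
      linarith
    · have h1 := ht (y + 1)
      have h2 := phaseConj_add_le hc hzs (show y ≤ y + 1 by linarith)
      linarith
  refine ⟨hmem, le_antisymm ?_ (le_phaseConj hc hmem y)⟩
  -- Biconjugation: if `y'` is a supporting slope of `ft` at `t`, then `t` maximizes `y' * s - ft
  -- s`, and the subgradient inequality at `y'` carries this over to `y`.
  obtain ⟨y', hy'⟩ := exists_subgradient hc.convexOn t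
  obtain ⟨s, hs, h⟩ := exists_phaseConj_eq hc hzs y'
  have h1 := hy' s
  have h2 := ht y'
  rw [h] at h2
  linarith

/-- Both subgradients maximize `y * s - ft s` on `[0, zs]`, and strict convexity makes the maximizer
unique. This is differentiability of the transform, in the form needed to compare optimality
conditions. -/
lemma subgradient_phaseConj_unique (hc : StrictConvexOn ℝ Set.univ ft) (hzs : 0 < zs)
    {y t t' : ℝ}
    (ht : ∀ x, phaseConj ft zs y + t * (x - y) ≤ phaseConj ft zs x)
    (ht' : ∀ x, phaseConj ft zs y + t' * (x - y) ≤ phaseConj ft zs x) : t = t' := by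
  obtain ⟨hm, he⟩ := subgradient_phaseConj hc hzs ht
  obtain ⟨hm', he'⟩ := subgradient_phaseConj hc hzs ht'
  by_contra hne
  have h := hc.2 (Set.mem_univ t) (Set.mem_univ t') hne (half_pos one_pos) (half_pos one_pos)
    (add_halves 1)
  have h2 := le_phaseConj hc (s := (1 / 2 : ℝ) • t + (1 / 2 : ℝ) • t') (zs := zs)
    ⟨by simp only [smul_eq_mul]; linarith [hm.1, hm'.1],
      by simp only [smul_eq_mul]; linarith [hm.2, hm'.2]⟩ y
  simp only [smul_eq_mul] at h h2
  linarith

lemma ft_strictMono (hc : StrictConvexOn ℝ Set.univ ft) (h0 : ft 0 = 0)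
    (hn : ∀ x, 0 ≤ ft x) {x y : ℝ} (hx : 0 ≤ x) (hxy : x < y) : ft x < ft y := by
  rcases hx.eq_or_lt with rfl | hx
  · have h := hc.2 (Set.mem_univ 0) (Set.mem_univ y) hxy.ne (half_pos one_pos) (half_pos one_pos)
      (add_halves 1)
    have := hn ((1 / 2 : ℝ) • 0 + (1 / 2 : ℝ) • y)
    simp only [smul_eq_mul, h0] at *
    linarith
  · have h := hc.2 (Set.mem_univ 0) (Set.mem_univ y) (hx.trans hxy).ne
      (div_pos (sub_pos.2 hxy) (hx.trans hxy)) (div_pos hx (hx.trans hxy))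
      (by rw [← add_div, sub_add_cancel, div_self (hx.trans hxy).ne'])
    have hy : 0 < y := hx.trans hxy
    have e : ((y - x) / y) • (0 : ℝ) + (x / y) • y = x := by
      simp only [smul_eq_mul, mul_zero, zero_add]; field_simp
    rw [e] at h
    simp only [smul_eq_mul, h0, mul_zero, zero_add] at h
    refine h.trans_le ?_
    have : x / y ≤ 1 := (div_le_one hy).2 hxy.le
    nlinarith [hn y]

/-! ### Optimal stress fields between two broken bonds -/

/-- Data of the concave maximization problem for the stress field between two broken bonds. -/
structure FieldProblem where
  /-- compliance -/
  α : ℝ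
  /-- gradient stiffness -/
  β : ℝ
  /-- bound of the slopes of `ψ` -/
  zs : ℝ
  /-- complementary energy of an intact bond -/
  ψ : ℝ → ℝ
  α_pos : 0 < α
  β_pos : 0 < β
  convex : ConvexOn ℝ Set.univ ψ
  mono : Monotone ψ
  of_nonpos : ∀ y ≤ 0, ψ y = 0
  le_mul : ∀ y, 0 ≤ y → ψ y ≤ zs * y
  subgrad_unique : ∀ y t t' : ℝ, (∀ x, ψ y + t * (x - y) ≤ ψ x) →
    (∀ x, ψ y + t' * (x - y) ≤ ψ x) → t = t'

lemma nonneg_of_forall_small {A c : ℝ} (h : ∀ ε : ℝ, 0 < ε → ε < 1 → -(c * ε) ≤ A) : 0 ≤ A := by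
  have ht : Tendsto (fun ε : ℝ => -(c * ε)) (𝓝[>] 0) (𝓝 (-(c * 0))) :=
    ((continuous_const.mul continuous_id).neg.tendsto 0).mono_left nhdsWithin_le_nhds
  rw [mul_zero, neg_zero] at ht
  refine le_of_tendsto ht ?_
  filter_upwards [Ioo_mem_nhdsGT (zero_lt_one (α := ℝ))] with ε hε
  exact h ε hε.1 hε.2

/-- Shift of a field by one site. -/
def shiftRight (q : ℕ → ℝ) : ℕ → ℝ
  | 0 => 0
  | k + 1 => q k

/-- The fields with values in `[0, c]` that vanish outside `(0, ℓ)`. -/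
def fields (c : ℝ) (ℓ : ℕ) : Set (ℕ → ℝ) :=
  Set.univ.pi fun k => if 0 < k ∧ k < ℓ then Set.Icc 0 c else {0}

lemma mem_fields {c : ℝ} (hc : 0 ≤ c) {ℓ : ℕ} {q : ℕ → ℝ} :
    q ∈ fields c ℓ ↔ q 0 = 0 ∧ (∀ k, ℓ ≤ k → q k = 0) ∧ ∀ k, q k ∈ Set.Icc 0 c := by
  unfold fields
  rw [Set.mem_univ_pi]
  constructor
  · intro h
    refine ⟨by simpa using h 0, fun k hk => by simpa [hk.not_gt] using h k, fun k => ?_⟩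
    have := h k
    split_ifs at this
    · exact this
    · rw [Set.mem_singleton_iff.1 this]; exact ⟨le_rfl, hc⟩
  · rintro ⟨h0, hl, hI⟩ k
    split_ifs with hk
    · exact hI k
    · rw [not_and_or, not_lt, not_lt] at hk
      rcases hk with hk | hk
      · rw [Nat.le_zero.1 hk]; exact h0
      · exact hl k hk

lemma isCompact_fields (c : ℝ) (ℓ : ℕ) : IsCompact (fields c ℓ) := by
  refine isCompact_univ_pi fun k => ?_
  split_ifs
  · exact isCompact_Icc
  · exact isCompact_singleton

namespace FieldProblem

variable (D : FieldProblem)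

/-- Energy density of a field. -/
def density (l x y : ℝ) : ℝ := D.α * l * x - D.α * x ^ 2 - D.ψ (2 * x) - D.β * (y - x) ^ 2

/-- Energy of a field on the first `L` sites. -/
def energy (l : ℝ) (L : ℕ) (q : ℕ → ℝ) : ℝ :=
  ∑ k ∈ Finset.range L, D.density l (q k) (q (k + 1))

lemma ψ_zero : D.ψ 0 = 0 := D.of_nonpos 0 le_rfl

lemma ψ_nonneg (y : ℝ) : 0 ≤ D.ψ y := by
  rw [← D.of_nonpos (min y 0) (min_le_right _ _)]
  exact D.mono (min_le_left _ _)

lemma density_zero (l : ℝ) : D.density l 0 0 = 0 := by simp [density, D.ψ_zero]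

lemma continuous_ψ : Continuous D.ψ :=
  continuousOn_univ.1 (D.convex.continuousOn isOpen_univ)

lemma continuous_energy (l : ℝ) (L : ℕ) : Continuous (D.energy l L) := by
  have := D.continuous_ψ
  unfold energy density
  fun_prop

lemma exists_profile {l : ℝ} (hl : 0 ≤ l) (ℓ : ℕ) :
    ∃ q ∈ fields (l / 2) ℓ, ∀ q' ∈ fields (l / 2) ℓ, D.energy l ℓ q' ≤ D.energy l ℓ q := by
  obtain ⟨q, hq, h⟩ := (isCompact_fields (l / 2) ℓ).exists_isMaxOn
    ⟨0, (mem_fields (by positivity)).2 ⟨rfl, fun _ _ => rfl, fun _ => ⟨le_rfl, by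
      simpa using div_nonneg hl zero_le_two⟩⟩⟩ (D.continuous_energy l ℓ).continuousOn
  exact ⟨q, hq, fun q' hq' => h hq'⟩

open Classical in
/-- The optimal field on `(0, ℓ)` under the load `l`. -/
def profile (l : ℝ) (ℓ : ℕ) : ℕ → ℝ :=
  if h : 0 ≤ l then (D.exists_profile h ℓ).choose else 0

/-- The optimal energy of a field on `(0, ℓ)` under the load `l`. -/
def opt (l : ℝ) (ℓ : ℕ) : ℝ := D.energy l ℓ (D.profile l ℓ)

/-- The sum of the optimal field. -/
def total (l : ℝ) (ℓ : ℕ) : ℝ := ∑ k ∈ Finset.range ℓ, D.profile l ℓ k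

variable {D} {l : ℝ}

lemma profile_mem (hl : 0 ≤ l) (ℓ : ℕ) : D.profile l ℓ ∈ fields (l / 2) ℓ := by
  unfold profile
  rw [dif_pos hl]
  exact (D.exists_profile hl ℓ).choose_spec.1

lemma profile_zero (hl : 0 ≤ l) (ℓ : ℕ) : D.profile l ℓ 0 = 0 :=
  ((mem_fields (by positivity)).1 (profile_mem hl ℓ)).1

lemma profile_of_le (hl : 0 ≤ l) {ℓ k : ℕ} (hk : ℓ ≤ k) : D.profile l ℓ k = 0 :=
  ((mem_fields (by positivity)).1 (profile_mem hl ℓ)).2.1 k hk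

lemma profile_nonneg (hl : 0 ≤ l) (ℓ k : ℕ) : 0 ≤ D.profile l ℓ k :=
  (((mem_fields (by positivity)).1 (profile_mem hl ℓ)).2.2 k).1

lemma profile_le (hl : 0 ≤ l) (ℓ k : ℕ) : D.profile l ℓ k ≤ l / 2 :=
  (((mem_fields (by positivity)).1 (profile_mem hl ℓ)).2.2 k).2

/-- Clamping is a contraction, so the gradient term improves; `α l x - α x²` peaks at `l / 2`, and
`ψ` is monotone and vanishes on the negatives. Thus the box in `fields` serves only compactness, and
`energy_le_opt` allows free variations. -/
lemma density_clamp (hl : 0 ≤ l) (x y : ℝ) :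
    D.density l x y ≤ D.density l (max 0 (min x (l / 2))) (max 0 (min y (l / 2))) := by
  unfold density
  have hα := D.α_pos
  have h1 : (max 0 (min y (l / 2)) - max 0 (min x (l / 2))) ^ 2 ≤ (y - x) ^ 2 := by
    rw [sq_le_sq]
    rw [max_comm 0, max_comm 0]
    refine (abs_max_sub_max_le_abs _ _ _).trans
      ((abs_min_sub_min_le_max y (l / 2) x (l / 2)).trans ?_)
    simp
  have h2 : D.α * l * x - D.α * x ^ 2 - D.ψ (2 * x)
      ≤ D.α * l * max 0 (min x (l / 2)) - D.α * (max 0 (min x (l / 2))) ^ 2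
        - D.ψ (2 * max 0 (min x (l / 2))) := by
    rcases le_total x 0 with hx | hx
    · rw [max_eq_left ((min_le_left _ _).trans hx), mul_zero, mul_zero, D.ψ_zero,
        D.of_nonpos _ (by linarith)]
      have : D.α * l * x ≤ 0 := mul_nonpos_of_nonneg_of_nonpos (by positivity) hx
      nlinarith [sq_nonneg x]
    · rcases le_total x (l / 2) with hx' | hx'
      · rw [min_eq_left hx', max_eq_right hx]
      · rw [min_eq_right hx', max_eq_right (by positivity)]
        have := D.mono (show 2 * (l / 2) ≤ 2 * x by linarith)
        nlinarith [sq_nonneg (x - l / 2)]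
  have := mul_le_mul_of_nonneg_left h1 D.β_pos.le
  linarith

lemma energy_le_opt (hl : 0 ≤ l) {ℓ : ℕ} {q : ℕ → ℝ} (h0 : q 0 = 0)
    (hq : ∀ k, ℓ ≤ k → q k = 0) : D.energy l ℓ q ≤ D.opt l ℓ := by
  have hmem : (fun k => max 0 (min (q k) (l / 2))) ∈ fields (l / 2) ℓ := by
    rw [mem_fields (by positivity)]
    have hl2 : 0 ≤ l / 2 := by positivity
    refine ⟨by simp [h0, hl2], fun k hk => by simp [hq k hk, hl2], fun k =>
      ⟨le_max_left _ _, max_le hl2 (min_le_right _ _)⟩⟩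
  have h1 : D.energy l ℓ q ≤ D.energy l ℓ (fun k => max 0 (min (q k) (l / 2))) :=
    Finset.sum_le_sum fun k _ => density_clamp hl _ _
  refine h1.trans ?_
  unfold opt profile
  rw [dif_pos hl]
  exact (D.exists_profile hl ℓ).choose_spec.2 _ hmem

lemma energy_eq_of_support {ℓ L : ℕ} (hL : ℓ ≤ L) {q : ℕ → ℝ} (hq : ∀ k, ℓ ≤ k → q k = 0) :
    D.energy l L q = D.energy l ℓ q := by
  unfold energy
  refine (Finset.sum_subset (Finset.range_mono hL) fun k _ hk => ?_).symm
  rw [Finset.mem_range, not_lt] at hk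
  rw [hq k hk, hq (k + 1) (by omega), D.density_zero]

lemma energy_shiftRight {L : ℕ} {q : ℕ → ℝ} (h0 : q 0 = 0) :
    D.energy l (L + 1) (shiftRight q) = D.energy l L q := by
  unfold energy
  rw [Finset.sum_range_succ']
  simp only [shiftRight]
  rw [h0, D.density_zero, add_zero]

lemma density_concave {ε : ℝ} (h0 : 0 ≤ ε) (h1 : ε ≤ 1) (x y x' y' : ℝ) :
    (1 - ε) * D.density l x y + ε * D.density l x' y' + D.α * (ε * (1 - ε)) * (x' - x) ^ 2
      ≤ D.density l ((1 - ε) * x + ε * x') ((1 - ε) * y + ε * y') := by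
  unfold density
  have hψ := D.convex.2 (Set.mem_univ (2 * x)) (Set.mem_univ (2 * x')) (sub_nonneg.2 h1) h0
    (by ring)
  simp only [smul_eq_mul] at hψ
  rw [show (1 - ε) * (2 * x) + ε * (2 * x') = 2 * ((1 - ε) * x + ε * x') by ring] at hψ
  have h2 : 0 ≤ D.β * (ε * (1 - ε)) * ((y' - x') - (y - x)) ^ 2 :=
    mul_nonneg (mul_nonneg D.β_pos.le (mul_nonneg h0 (sub_nonneg.2 h1))) (sq_nonneg _)
  nlinarith

/-- Quadratic growth of the energy gap away from the optimal field. -/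
lemma energy_add_le_opt (hl : 0 ≤ l) {ℓ : ℕ} {q : ℕ → ℝ} (h0 : q 0 = 0)
    (hq : ∀ k, ℓ ≤ k → q k = 0) :
    D.energy l ℓ q + D.α * ∑ k ∈ Finset.range ℓ, (q k - D.profile l ℓ k) ^ 2 ≤ D.opt l ℓ := by
  set x := D.profile l ℓ with hx
  set S := ∑ k ∈ Finset.range ℓ, (q k - x k) ^ 2
  rw [← sub_nonneg]
  refine nonneg_of_forall_small (c := D.α * S) fun ε hε hε1 => ?_
  -- Test optimality on the segment from the maximizer towards `q`. After division by `ε`, strong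
  -- concavity gives the claim up to `α S ε`.
  have h := energy_le_opt (D := D) hl (ℓ := ℓ) (q := fun k => (1 - ε) * x k + ε * q k)
    (by simp [h0, hx, profile_zero hl])
    (fun k hk => by simp [hq k hk, hx, profile_of_le hl hk])
  have h2 : (1 - ε) * D.energy l ℓ x + ε * D.energy l ℓ q + D.α * (ε * (1 - ε)) * S
      ≤ D.energy l ℓ (fun k => (1 - ε) * x k + ε * q k) := by
    unfold energy
    rw [Finset.mul_sum, Finset.mul_sum, Finset.mul_sum, ← Finset.sum_add_distrib,
      ← Finset.sum_add_distrib]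
    exact Finset.sum_le_sum fun k _ => density_concave hε.le hε1.le _ _ _ _
  have h3 := h2.trans h
  have h4 : D.energy l ℓ x = D.opt l ℓ := rfl
  rw [h4] at h3
  have h5 : 0 ≤ ε * (D.opt l ℓ - D.energy l ℓ q - D.α * (1 - ε) * S) := by linarith
  have h6 := nonneg_of_mul_nonneg_right h5 hε
  linarith

lemma eq_profile_of_opt_le (hl : 0 ≤ l) {ℓ : ℕ} {q : ℕ → ℝ} (h0 : q 0 = 0)
    (hq : ∀ k, ℓ ≤ k → q k = 0) (h : D.opt l ℓ ≤ D.energy l ℓ q) : q = D.profile l ℓ := by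
  have h1 := energy_add_le_opt hl h0 hq (D := D)
  have h2 : 0 ≤ ∑ k ∈ Finset.range ℓ, (q k - D.profile l ℓ k) ^ 2 :=
    Finset.sum_nonneg fun _ _ => sq_nonneg _
  have h3 : ∑ k ∈ Finset.range ℓ, (q k - D.profile l ℓ k) ^ 2 = 0 := by
    nlinarith [D.α_pos]
  rw [Finset.sum_eq_zero_iff_of_nonneg fun _ _ => sq_nonneg _] at h3
  funext k
  rcases lt_or_ge k ℓ with hk | hk
  · exact sub_eq_zero.1 (pow_eq_zero_iff (two_ne_zero) |>.1 (h3 k (Finset.mem_range.2 hk)))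
  · rw [hq k hk, profile_of_le hl hk]

/-- The single-site terms are only permuted, and the coupling `-β (y - x)²` is supermodular. -/
lemma density_lattice (x y x' y' : ℝ) :
    D.density l x y + D.density l x' y'
      ≤ D.density l (max x x') (max y y') + D.density l (min x x') (min y y') := by
  unfold density
  have hβ := D.β_pos
  rcases le_total x x' with hx | hx <;> rcases le_total y y' with hy | hy <;>
    simp only [hx, hy, max_eq_left, max_eq_right, min_eq_left, min_eq_right]
  · linarith
  · nlinarith [mul_nonneg (mul_nonneg hβ.le (sub_nonneg.2 hx)) (sub_nonneg.2 hy)]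
  · nlinarith [mul_nonneg (mul_nonneg hβ.le (sub_nonneg.2 hx)) (sub_nonneg.2 hy)]
  · linarith

lemma density_lattice_lt {x y x' y' : ℝ} (hx : x' < x) (hy : y < y') :
    D.density l x y + D.density l x' y'
      < D.density l (max x x') (max y y') + D.density l (min x x') (min y y') := by
  unfold density
  rw [max_eq_left hx.le, max_eq_right hy.le, min_eq_right hx.le, min_eq_left hy.le]
  nlinarith [mul_pos (mul_pos D.β_pos (sub_pos.2 hx)) (sub_pos.2 hy)]

lemma energy_lattice (L : ℕ) (x y : ℕ → ℝ) :
    D.energy l L x + D.energy l L y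
      ≤ D.energy l L (fun k => max (x k) (y k)) + D.energy l L (fun k => min (x k) (y k)) := by
  unfold energy
  rw [← Finset.sum_add_distrib, ← Finset.sum_add_distrib]
  exact Finset.sum_le_sum fun k _ => density_lattice _ _ _ _

lemma energy_lattice_lt {L k : ℕ} (hk : k < L) {x y : ℕ → ℝ} (h1 : y k < x k)
    (h2 : x (k + 1) < y (k + 1)) :
    D.energy l L x + D.energy l L y
      < D.energy l L (fun k => max (x k) (y k)) + D.energy l L (fun k => min (x k) (y k)) := by
  unfold energy
  rw [← Finset.sum_add_distrib, ← Finset.sum_add_distrib]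
  exact Finset.sum_lt_sum (fun k _ => density_lattice _ _ _ _)
    ⟨k, Finset.mem_range.2 hk, density_lattice_lt h1 h2⟩

/-- First-order optimality condition. -/
lemma profile_subgrad (hl : 0 ≤ l) {ℓ k : ℕ} (hk : k + 1 < ℓ) (y : ℝ) :
    D.ψ (2 * D.profile l ℓ (k + 1))
      + (D.α * (l / 2 - D.profile l ℓ (k + 1))
          + D.β * (D.profile l ℓ k + D.profile l ℓ (k + 2) - 2 * D.profile l ℓ (k + 1)))
        * (y - 2 * D.profile l ℓ (k + 1)) ≤ D.ψ y := by
  set q := D.profile l ℓ with hq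
  set t := D.α * (l / 2 - q (k + 1)) + D.β * (q k + q (k + 2) - 2 * q (k + 1)) with ht
  -- Only the value at site `k + 1` is varied, so only the two densities touching it matter.
  have key : ∀ x : ℝ, D.density l (q k) x + D.density l x (q (k + 2))
      ≤ D.density l (q k) (q (k + 1)) + D.density l (q (k + 1)) (q (k + 2)) := by
    intro x
    have h := energy_le_opt (D := D) hl (ℓ := ℓ) (q := Function.update q (k + 1) x)
      (by rw [Function.update_of_ne (by omega)]; exact profile_zero hl ℓ)
      (fun j hj => by rw [Function.update_of_ne (by omega)]; exact profile_of_le hl hj)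
    obtain ⟨r, rfl⟩ : ∃ r, ℓ = (k + 2) + r := ⟨ℓ - (k + 2), by omega⟩
    have hsplit : ∀ g : ℕ → ℝ, ∑ i ∈ Finset.range (k + 2 + r), g i
        = ∑ i ∈ Finset.range k, g i + g k + g (k + 1)
          + ∑ i ∈ Finset.range r, g (k + 2 + i) := fun g => by
      rw [Finset.sum_range_add _ (k + 2) r, Finset.sum_range_succ, Finset.sum_range_succ]
    unfold opt energy at h
    rw [← hq, hsplit, hsplit] at h
    have e1 : ∀ i ∈ Finset.range k,
        D.density l (Function.update q (k + 1) x i) (Function.update q (k + 1) x (i + 1))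
          = D.density l (q i) (q (i + 1)) := by
      intro i hi
      have := Finset.mem_range.1 hi
      rw [Function.update_of_ne (by omega), Function.update_of_ne (by omega)]
    have e2 : ∀ i ∈ Finset.range r,
        D.density l (Function.update q (k + 1) x (k + 2 + i))
          (Function.update q (k + 1) x (k + 2 + i + 1))
          = D.density l (q (k + 2 + i)) (q (k + 2 + i + 1)) := by
      intro i _
      rw [Function.update_of_ne (by omega), Function.update_of_ne (by omega)]
    rw [Finset.sum_congr rfl e1, Finset.sum_congr rfl e2, Function.update_self,
      Function.update_of_ne (by omega), Function.update_of_ne (by omega)] at h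
    simp only [add_assoc, Nat.reduceAdd] at h ⊢
    linarith
  have key2 : ∀ d : ℝ, D.ψ (2 * q (k + 1)) + 2 * t * d - (D.α + 2 * D.β) * d ^ 2
      ≤ D.ψ (2 * (q (k + 1) + d)) := by
    intro d
    have := key (q (k + 1) + d)
    unfold density at this
    rw [ht]
    nlinarith
  rw [← sub_nonneg]
  set Y := y - 2 * q (k + 1) with hY
  -- `ψ` need not be differentiated: move a fraction `ε` of the way to `y`, bound `ψ` there by
  -- convexity, and let the quadratic remainder vanish.
  refine nonneg_of_forall_small (c := (D.α + 2 * D.β) * Y ^ 2 / 4) fun ε hε hε1 => ?_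
  have h1 := key2 (ε * Y / 2)
  have h2 := D.convex.2 (Set.mem_univ (2 * q (k + 1))) (Set.mem_univ y)
    (sub_nonneg.2 hε1.le) hε.le (by ring)
  simp only [smul_eq_mul] at h2
  rw [show (1 - ε) * (2 * q (k + 1)) + ε * y = 2 * (q (k + 1) + ε * Y / 2) by rw [hY]; ring] at h2
  have h3 : 0 ≤ ε * (D.ψ y - (D.ψ (2 * q (k + 1)) + t * Y)
      + (D.α + 2 * D.β) * Y ^ 2 / 4 * ε) := by nlinarith
  have := nonneg_of_mul_nonneg_right h3 hε
  linarith

/-- At an interior zero, optimality would give `ψ` a positive subgradient at `0`, where `0` is the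
only one. -/
lemma profile_pos (hl : 0 < l) {ℓ k : ℕ} (hk : k + 1 < ℓ) : 0 < D.profile l ℓ (k + 1) := by
  refine lt_of_le_of_ne (profile_nonneg hl.le _ _) fun h0 => ?_
  have h1 := profile_subgrad (D := D) hl.le hk
  rw [← h0] at h1
  have h2 := D.subgrad_unique _ _ 0 h1 (fun x => by
    rw [mul_zero, D.ψ_zero, zero_mul, add_zero]; exact D.ψ_nonneg x)
  have h3 := profile_nonneg (D := D) hl.le ℓ k
  have h4 := profile_nonneg (D := D) hl.le ℓ (k + 2)
  have h5 : 0 ≤ D.β * (D.profile l ℓ k + D.profile l ℓ (k + 2) - 2 * 0) :=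
    mul_nonneg D.β_pos.le (by linarith)
  have h6 : 0 < D.α * (l / 2 - 0) := mul_pos D.α_pos (by linarith)
  linarith

end FieldProblem

namespace FieldProblem

variable {D : FieldProblem} {l : ℝ}

/-! ### Dependence of the optimal energy on the length of the interval -/

lemma opt_one (hl : 0 ≤ l) : D.opt l 1 = 0 := by
  simp [opt, energy, profile_zero hl, profile_of_le hl le_rfl, D.density_zero]

lemma shiftRight_min (x : ℕ → ℝ) (h0 : x 0 = 0) :
    (fun k => min (x k) (shiftRight x k)) = shiftRight fun k => min (x (k + 1)) (x k) := by
  funext k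
  rcases k with _ | k
  · simp [shiftRight, h0]
  · rfl

/-- The maximum of an optimal field and its shift competes at length `ℓ + 2`; their minimum, shifted
back, competes at length `ℓ`. -/
lemma opt_add_opt_le_aux (hl : 0 ≤ l) (ℓ : ℕ) :
    (D.energy l (ℓ + 2) (D.profile l (ℓ + 1)) = D.opt l (ℓ + 1) ∧
      D.energy l (ℓ + 2) (shiftRight (D.profile l (ℓ + 1))) = D.opt l (ℓ + 1)) ∧
    (∀ k, ℓ + 2 ≤ k →
      max (D.profile l (ℓ + 1) k) (shiftRight (D.profile l (ℓ + 1)) k) = 0) ∧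
    D.energy l (ℓ + 2) (fun k => min (D.profile l (ℓ + 1) k)
      (shiftRight (D.profile l (ℓ + 1)) k)) ≤ D.opt l ℓ := by
  set x := D.profile l (ℓ + 1) with hx
  have h0 : x 0 = 0 := profile_zero hl _
  have hs : ∀ k, ℓ + 1 ≤ k → x k = 0 := fun k hk => profile_of_le hl hk
  have hn : ∀ k, 0 ≤ x k := profile_nonneg hl _
  refine ⟨⟨energy_eq_of_support (by omega) hs, energy_shiftRight h0⟩, fun k hk => ?_, ?_⟩
  · obtain ⟨j, rfl⟩ : ∃ j, k = j + 1 := ⟨k - 1, by omega⟩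
    rw [hs _ (by omega)]
    simp [shiftRight, hs j (by omega)]
  · have hz : ∀ k, ℓ ≤ k → min (x (k + 1)) (x k) = 0 := fun k hk => by
      rw [hs (k + 1) (by omega)]; exact min_eq_left (hn k)
    rw [shiftRight_min x h0, energy_shiftRight (by rw [h0]; exact min_eq_right (hn 1)),
      energy_eq_of_support (Nat.le_succ ℓ) hz]
    exact energy_le_opt hl (by rw [h0]; exact min_eq_right (hn 1)) hz

/-- The optimal energy is convex in the length. -/
lemma two_mul_opt_le (hl : 0 ≤ l) (ℓ : ℕ) :
    2 * D.opt l (ℓ + 1) ≤ D.opt l (ℓ + 2) + D.opt l ℓ := by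
  obtain ⟨⟨e1, e2⟩, hmax, hmin⟩ := opt_add_opt_le_aux (D := D) hl ℓ
  have h := energy_lattice (D := D) (l := l) (ℓ + 2) (D.profile l (ℓ + 1))
    (shiftRight (D.profile l (ℓ + 1)))
  have h2 := energy_le_opt (D := D) hl (ℓ := ℓ + 2) (q := fun k => max (D.profile l (ℓ + 1) k)
    (shiftRight (D.profile l (ℓ + 1)) k)) (by simp [shiftRight, profile_zero hl]) hmax
  linarith

/-- The optimal energy is strictly convex in the length. -/
lemma two_mul_opt_lt (hl : 0 < l) (ℓ : ℕ) :
    2 * D.opt l (ℓ + 1) < D.opt l (ℓ + 2) + D.opt l ℓ := by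
  by_contra hcon
  rw [not_lt] at hcon
  obtain ⟨⟨e1, e2⟩, hmax, hmin⟩ := opt_add_opt_le_aux (D := D) hl.le ℓ
  set x := D.profile l (ℓ + 1) with hx
  have h0 : x 0 = 0 := profile_zero hl.le _
  have h := energy_lattice (D := D) (l := l) (ℓ + 2) x (shiftRight x)
  -- In the equality case the maximum must be the unique optimal field.
  have hY : (fun k => max (x k) (shiftRight x k)) = D.profile l (ℓ + 2) :=
    eq_profile_of_opt_le hl.le (by simp [shiftRight, h0]) hmax (by linarith)
  have h2 := energy_le_opt (D := D) hl.le (ℓ := ℓ + 2) (q := fun k => max (x k) (shiftRight x k))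
    (by simp [shiftRight, h0]) hmax
  have hYk : ∀ k, D.profile l (ℓ + 2) (k + 1) = max (x (k + 1)) (x k) := fun k => by
    rw [← hY]; rfl
  rcases Nat.eq_zero_or_pos ℓ with rfl | hℓ
  · have h3 := profile_pos (D := D) hl (ℓ := 0 + 2) (k := 0) (by omega)
    rw [hYk, h0, show x (0 + 1) = 0 from profile_of_le hl.le le_rfl] at h3
    simp at h3
  have hex : ∃ k, x (k + 1) ≤ x k :=
    ⟨ℓ, by rw [show x (ℓ + 1) = 0 from profile_of_le hl.le le_rfl]
           exact profile_nonneg hl.le _ _⟩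
  have hx1 : 0 < x 1 := profile_pos hl (by omega)
  -- At the first place where `x` stops increasing, `x` and its shift exchange order: a strict
  -- crossing contradicts `energy_lattice_lt`.
  obtain ⟨m, hm, hmin'⟩ : ∃ m, x (m + 1) ≤ x m ∧ ∀ j < m, x j < x (j + 1) := by
    classical
    exact ⟨Nat.find hex, Nat.find_spec hex, fun j hj => not_le.1 (Nat.find_min hex hj)⟩
  have hmℓ : m ≤ ℓ := by
    by_contra hc
    have := hmin' ℓ (by omega)
    rw [show x (ℓ + 1) = 0 from profile_of_le hl.le le_rfl] at this
    exact absurd this (not_lt.2 (profile_nonneg hl.le _ _))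
  obtain ⟨k, rfl⟩ : ∃ k, m = k + 1 := by
    rcases m with _ | k
    · rw [h0] at hm; exact absurd hx1 (not_lt.2 hm)
    · exact ⟨k, rfl⟩
  have hlt := hmin' k (by omega)
  rcases hm.lt_or_eq with hm | hm
  · have := energy_lattice_lt (D := D) (l := l) (L := ℓ + 2) (k := k + 1) (by omega) (x := x)
      (y := shiftRight x) hlt hm
    linarith
  -- On a plateau, `x` and the maximum share a central value, hence the subgradient of `ψ`. Yet the
  -- neighbours of the maximum have a strictly larger sum, since `x k < x (k + 1)`.
  · have s1 := profile_subgrad (D := D) hl.le (ℓ := ℓ + 1) (k := k) (by omega)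
    have s2 := profile_subgrad (D := D) hl.le (ℓ := ℓ + 2) (k := k + 1) (by omega)
    rw [← hx] at s1
    rw [hYk (k + 1), hYk k, show k + 1 + 2 = (k + 2) + 1 by ring, hYk (k + 2),
      show x (k + 1 + 1) = x (k + 1) from hm, max_self, max_eq_left hlt.le] at s2
    rw [show k + 2 = k + 1 + 1 by ring, hm] at s1
    have h3 := D.subgrad_unique _ _ _ s1 s2
    have h4 := mul_pos D.β_pos (sub_pos.2 (hlt.trans_le (le_max_right (x (k + 2 + 1)) (x (k + 1)))))
    linarith

/-- The optimal energy lies above its secants. -/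
lemma opt_ge_secant (hl : 0 ≤ l) (n m : ℕ) :
    D.opt l n + ((m : ℝ) - n) * (D.opt l (n + 1) - D.opt l n) ≤ D.opt l m := by
  have hmono : Monotone fun k => D.opt l (k + 1) - D.opt l k :=
    monotone_nat_of_le_succ fun k => by have := two_mul_opt_le (D := D) hl k; linarith
  rcases le_total n m with h | h
  · obtain ⟨d, rfl⟩ := Nat.exists_eq_add_of_le h
    clear h
    induction d with
    | zero => simp
    | succ d ih =>
      have := hmono (show n ≤ n + d by omega)
      simp only at this
      rw [show n + (d + 1) = n + d + 1 from rfl]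
      push_cast at ih ⊢
      linarith
  · obtain ⟨d, rfl⟩ := Nat.exists_eq_add_of_le h
    clear h
    suffices H : ∀ e : ℕ, ∀ k : ℕ, k + e = m + d →
        D.opt l (m + d) - e * (D.opt l (m + d + 1) - D.opt l (m + d)) ≤ D.opt l k by
      have := H d m rfl
      push_cast
      linarith
    intro e
    induction e with
    | zero => intro k hk; rw [← hk]; simp
    | succ e ih =>
      intro k hk
      have h1 := ih (k + 1) (by omega)
      have h2 := hmono (show k ≤ m + d by omega)
      simp only at h2
      push_cast
      linarith

/-! ### Comparison of optimal fields -/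

/-- The maximum competes on the longer interval, so the lattice inequality makes the minimum optimal
on the shorter one; uniqueness identifies it. -/
lemma profile_le_profile_succ (hl : 0 ≤ l) (ℓ k : ℕ) :
    D.profile l ℓ k ≤ D.profile l (ℓ + 1) k := by
  set x := D.profile l ℓ with hx
  set y := D.profile l (ℓ + 1) with hy
  have x0 : x 0 = 0 := profile_zero hl _
  have y0 : y 0 = 0 := profile_zero hl _
  have xs : ∀ k, ℓ ≤ k → x k = 0 := fun k hk => profile_of_le hl hk
  have ys : ∀ k, ℓ + 1 ≤ k → y k = 0 := fun k hk => profile_of_le hl hk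
  have hzs : ∀ k, ℓ ≤ k → min (x k) (y k) = 0 := fun k hk => by
    rw [xs k hk]; exact min_eq_left (profile_nonneg hl _ _)
  have h := energy_lattice (D := D) (l := l) (ℓ + 1) x y
  rw [energy_eq_of_support (Nat.le_succ ℓ) xs, energy_eq_of_support (Nat.le_succ ℓ) hzs] at h
  have h1 := energy_le_opt (D := D) hl (ℓ := ℓ + 1) (q := fun k => max (x k) (y k))
    (by simp [x0, y0]) (fun k hk => by simp [xs k (by omega), ys k hk])
  have h2 : (fun k => min (x k) (y k)) = x := eq_profile_of_opt_le hl (by simp [x0, y0]) hzs (by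
    have a : D.energy l ℓ x = D.opt l ℓ := rfl
    have b : D.energy l (ℓ + 1) y = D.opt l (ℓ + 1) := rfl
    linarith)
  have h3 := congrFun h2 k
  exact min_eq_left_iff.1 h3

lemma profile_le_profile_succ_succ (hl : 0 ≤ l) (ℓ k : ℕ) :
    D.profile l ℓ k ≤ D.profile l (ℓ + 1) (k + 1) := by
  set x := D.profile l ℓ with hx
  set y := D.profile l (ℓ + 1) with hy
  have x0 : x 0 = 0 := profile_zero hl _
  have y0 : y 0 = 0 := profile_zero hl _
  have xs : ∀ k, ℓ ≤ k → x k = 0 := fun k hk => profile_of_le hl hk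
  have ys : ∀ k, ℓ + 1 ≤ k → y k = 0 := fun k hk => profile_of_le hl hk
  have hzs : ∀ k, ℓ ≤ k → min (x k) (y (k + 1)) = 0 := fun k hk => by
    rw [xs k hk]; exact min_eq_left (profile_nonneg hl _ _)
  have hz0 : min (x 0) (y (0 + 1)) = 0 := by rw [x0]; exact min_eq_left (profile_nonneg hl _ _)
  have hsh : (fun k => min (shiftRight x k) (y k)) = shiftRight fun k => min (x k) (y (k + 1)) := by
    funext k
    rcases k with _ | k
    · simp [shiftRight, y0]
    · rfl
  have h := energy_lattice (D := D) (l := l) (ℓ + 1) (shiftRight x) y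
  rw [energy_shiftRight x0, hsh, energy_shiftRight hz0] at h
  have h1 := energy_le_opt (D := D) hl (ℓ := ℓ + 1) (q := fun k => max (shiftRight x k) (y k))
    (by simp [shiftRight, y0]) (fun k hk => by
      obtain ⟨j, rfl⟩ : ∃ j, k = j + 1 := ⟨k - 1, by omega⟩
      simp [shiftRight, xs j (by omega), ys _ hk])
  have h2 : (fun k => min (x k) (y (k + 1))) = x := eq_profile_of_opt_le hl hz0 hzs (by
    have a : D.energy l ℓ x = D.opt l ℓ := rfl
    have b : D.energy l (ℓ + 1) y = D.opt l (ℓ + 1) := rfl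
    linarith)
  exact min_eq_left_iff.1 (congrFun h2 k)

/-- The longer field at `k + 1` dominates both `x k` and `x (k + 1)`. With weights `k` and `m - k`,
each `x j` is collected `m + 1` times in total. -/
lemma mul_total_le (hl : 0 ≤ l) (m : ℕ) :
    ((m : ℝ) + 1) * D.total l (m + 1) ≤ m * D.total l (m + 2) := by
  unfold total
  set x := D.profile l (m + 1) with hx
  set y := D.profile l (m + 2) with hy
  have x0 : x 0 = 0 := profile_zero hl _
  have y0 : y 0 = 0 := profile_zero hl _
  rw [Finset.sum_range_succ' _ (m + 1), y0, add_zero, Finset.mul_sum, Finset.mul_sum]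
  have htel := Finset.sum_range_sub (fun k : ℕ => ((m : ℝ) + 1 - k) * x k) (m + 1)
  rw [show ((m : ℝ) + 1 - ((m + 1 : ℕ) : ℝ)) = 0 by push_cast; ring, x0] at htel
  have hle : ∀ k ∈ Finset.range (m + 1), ((m : ℝ) + 1) * x k
      + (((m : ℝ) + 1 - ((k + 1 : ℕ) : ℝ)) * x (k + 1) - ((m : ℝ) + 1 - k) * x k)
        ≤ m * y (k + 1) := by
    intro k hk
    have hk : (k : ℝ) ≤ m := by exact_mod_cast Nat.lt_succ_iff.1 (Finset.mem_range.1 hk)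
    have h1 : x (k + 1) ≤ y (k + 1) := profile_le_profile_succ hl _ _
    have h2 : x k ≤ y (k + 1) := profile_le_profile_succ_succ hl _ _
    have h3 := mul_le_mul_of_nonneg_left h1 (sub_nonneg.2 hk)
    have h4 := mul_le_mul_of_nonneg_left h2 (Nat.cast_nonneg (α := ℝ) k)
    push_cast
    linarith
  have := Finset.sum_le_sum hle
  rw [Finset.sum_add_distrib, htel] at this
  linarith

lemma total_pos (hl : 0 < l) (m : ℕ) : 0 < D.total l (m + 2) := by
  unfold total
  exact Finset.sum_pos' (fun k _ => profile_nonneg hl.le _ _)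
    ⟨1, Finset.mem_range.2 (by omega), profile_pos hl (by omega)⟩

/-- Combine `mul_total_le` with `m (m + 2) < (m + 1)²`. This is the sign of the derivative of the
threshold in the load. -/
lemma total_comparison (hl : 0 < l) (m : ℕ) :
    ((m : ℝ) + 2) * D.total l (m + 1) < ((m : ℝ) + 1) * D.total l (m + 2) := by
  have h1 := mul_total_le (D := D) hl.le m
  have h2 := total_pos (D := D) hl m
  have hm : (0 : ℝ) ≤ m := Nat.cast_nonneg m
  have h3 : ((m : ℝ) + 1) * (((m : ℝ) + 2) * D.total l (m + 1))
      < ((m : ℝ) + 1) * (((m : ℝ) + 1) * D.total l (m + 2)) := by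
    nlinarith
  exact lt_of_mul_lt_mul_left h3 (by positivity)

/-! ### Dependence of the optimal energy on the load -/

lemma energy_load (l l' : ℝ) (L : ℕ) (q : ℕ → ℝ) :
    D.energy l' L q = D.energy l L q + D.α * (l' - l) * ∑ k ∈ Finset.range L, q k := by
  unfold energy density
  rw [Finset.mul_sum, ← Finset.sum_add_distrib]
  exact Finset.sum_congr rfl fun k _ => by ring

lemma opt_load (hl : 0 ≤ l) {l' : ℝ} (hl' : 0 ≤ l') (ℓ : ℕ) :
    D.opt l ℓ + D.α * (l' - l) * D.total l ℓ
      + D.α * ∑ k ∈ Finset.range ℓ, (D.profile l ℓ k - D.profile l' ℓ k) ^ 2 ≤ D.opt l' ℓ := by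
  have h := energy_add_le_opt (D := D) hl' (profile_zero hl ℓ)
    (fun k hk => profile_of_le hl hk) (q := D.profile l ℓ)
  rw [energy_load l l'] at h
  exact h

lemma opt_load' (hl : 0 ≤ l) {l' : ℝ} (hl' : 0 ≤ l') (ℓ : ℕ) :
    D.opt l ℓ + D.α * (l' - l) * D.total l ℓ ≤ D.opt l' ℓ := by
  have h := opt_load (D := D) hl hl' ℓ
  have : 0 ≤ D.α * ∑ k ∈ Finset.range ℓ, (D.profile l ℓ k - D.profile l' ℓ k) ^ 2 :=
    mul_nonneg D.α_pos.le (Finset.sum_nonneg fun _ _ => sq_nonneg _)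
  linarith

/-- Add the two quadratic growth inequalities and apply Cauchy–Schwarz over the `m` interior sites.
The constant `m` instead of `m + 1` is what makes `meanSlope_lt` strict. -/
lemma total_sub_bounds (hl : 0 ≤ l) {l' : ℝ} (hll : l ≤ l') (m : ℕ) :
    0 ≤ D.total l' (m + 1) - D.total l (m + 1) ∧
      2 * (D.total l' (m + 1) - D.total l (m + 1)) ≤ m * (l' - l) := by
  have hl' := hl.trans hll
  have h1 := opt_load (D := D) hl hl' (m + 1)
  have h2 := opt_load (D := D) hl' hl (m + 1)
  set d := ∑ k ∈ Finset.range (m + 1), (D.profile l (m + 1) k - D.profile l' (m + 1) k) ^ 2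
    with hd
  have hd' : ∑ k ∈ Finset.range (m + 1), (D.profile l' (m + 1) k - D.profile l (m + 1) k) ^ 2
      = d := Finset.sum_congr rfl fun k _ => by ring
  rw [hd'] at h2
  set Δ := D.total l' (m + 1) - D.total l (m + 1) with hΔ
  have hα := D.α_pos
  have h3 : 2 * d ≤ (l' - l) * Δ := by
    have : 0 ≤ D.α * ((l' - l) * Δ - 2 * d) := by rw [hΔ]; linarith
    linarith [nonneg_of_mul_nonneg_right this hα]
  have hd0 : 0 ≤ d := Finset.sum_nonneg fun _ _ => sq_nonneg _
  have hcs : Δ ^ 2 ≤ m * d := by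
    have e1 : Δ = ∑ k ∈ Finset.range m,
        (D.profile l' (m + 1) (k + 1) - D.profile l (m + 1) (k + 1)) := by
      rw [hΔ]
      unfold total
      rw [Finset.sum_range_succ', Finset.sum_range_succ', profile_zero hl, profile_zero hl',
        Finset.sum_sub_distrib]
      ring
    have e2 : d = ∑ k ∈ Finset.range m,
        (D.profile l' (m + 1) (k + 1) - D.profile l (m + 1) (k + 1)) ^ 2 := by
      rw [← hd', Finset.sum_range_succ', profile_zero hl, profile_zero hl']
      ring
    rw [e1, e2]
    have := sq_sum_le_card_mul_sum_sq (s := Finset.range m)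
      (f := fun k => D.profile l' (m + 1) (k + 1) - D.profile l (m + 1) (k + 1))
    simpa using this
  rcases hll.eq_or_lt with rfl | hlt
  · have : Δ = 0 := by rw [hΔ]; ring
    simp [this]
  have hpos : 0 < l' - l := sub_pos.2 hlt
  have hΔ0 : 0 ≤ Δ := nonneg_of_mul_nonneg_right (by linarith) hpos
  refine ⟨hΔ0, ?_⟩
  rcases hΔ0.eq_or_lt with h0 | h0
  · rw [← h0]; simp; positivity
  · have hm : (0 : ℝ) ≤ m := Nat.cast_nonneg m
    have : 0 ≤ Δ * (m * (l' - l) - 2 * Δ) := by nlinarith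
    linarith [nonneg_of_mul_nonneg_right this h0]

lemma abs_total_sub_le (hl : 0 ≤ l) {l' : ℝ} (hl' : 0 ≤ l') (ℓ : ℕ) :
    |D.total l' ℓ - D.total l ℓ| ≤ ℓ * |l' - l| := by
  rcases ℓ with _ | m
  · simp [total]
  rcases le_total l l' with h | h
  · obtain ⟨h1, h2⟩ := total_sub_bounds (D := D) hl h m
    rw [abs_of_nonneg h1, abs_of_nonneg (sub_nonneg.2 h)]
    push_cast
    nlinarith
  · obtain ⟨h1, h2⟩ := total_sub_bounds (D := D) hl' h m
    rw [abs_sub_comm, abs_sub_comm l', abs_of_nonneg h1, abs_of_nonneg (sub_nonneg.2 h)]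
    push_cast
    nlinarith

/-- Envelope theorem: `opt_load'` used in both directions bounds the remainder by `l' - l` times the
variation of `total`, which is Lipschitz in the load. -/
lemma hasDerivAt_opt (hl : 0 < l) (ℓ : ℕ) :
    HasDerivAt (fun l => D.opt l ℓ) (D.α * D.total l ℓ) l := by
  rw [hasDerivAt_iff_isLittleO]
  have hO : (fun l' => D.opt l' ℓ - D.opt l ℓ - (l' - l) • (D.α * D.total l ℓ))
      =O[𝓝 l] fun l' => (l' - l) ^ 2 := by
    refine Asymptotics.IsBigO.of_bound (D.α * ℓ) ?_
    filter_upwards [lt_mem_nhds hl] with l' hl'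
    have h1 := opt_load' (D := D) hl.le hl'.le ℓ
    have h2 := opt_load' (D := D) hl'.le hl.le ℓ
    have h3 := abs_total_sub_le (D := D) hl.le hl'.le ℓ
    rw [Real.norm_eq_abs, Real.norm_eq_abs, abs_of_nonneg (sq_nonneg (l' - l)), smul_eq_mul]
    have h4 : (l' - l) * (D.total l' ℓ - D.total l ℓ) ≤ ℓ * (l' - l) ^ 2 := by
      refine (le_abs_self _).trans ?_
      rw [abs_mul, ← sq_abs (l' - l)]
      nlinarith [abs_nonneg (l' - l)]
    rw [abs_of_nonneg (by linarith)]
    have := mul_le_mul_of_nonneg_left h4 D.α_pos.le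
    linarith
  refine hO.trans_isLittleO ?_
  have : (fun l' : ℝ => (l' - l) ^ 2) = fun l' => (l' - l) * (l' - l) := by
    funext; ring
  rw [this]
  have h0 : (fun l' : ℝ => l' - l) =o[𝓝 l] fun _ => (1 : ℝ) := by
    rw [Asymptotics.isLittleO_one_iff]
    have : Tendsto (fun l' : ℝ => l' - l) (𝓝 l) (𝓝 (l - l)) :=
      (continuous_id.sub continuous_const).tendsto l
    simpa using this
  have h := h0.mul_isBigO (Asymptotics.isBigO_refl (fun l' : ℝ => l' - l) (𝓝 l))
  simpa using h

lemma opt_nonneg (hl : 0 ≤ l) (ℓ : ℕ) : 0 ≤ D.opt l ℓ := by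
  have h := energy_le_opt (D := D) hl (ℓ := ℓ) (q := 0) rfl (fun _ _ => rfl)
  have : D.energy l ℓ 0 = 0 := by simp [energy, D.density_zero]
  linarith

lemma opt_le (hl : 0 ≤ l) (ℓ : ℕ) : D.opt l ℓ ≤ ℓ * (D.α * l ^ 2) := by
  unfold opt energy
  have : ∀ k ∈ Finset.range ℓ,
      D.density l (D.profile l ℓ k) (D.profile l ℓ (k + 1)) ≤ D.α * l ^ 2 := by
    intro k _
    unfold density
    have h1 := D.ψ_nonneg (2 * D.profile l ℓ k)
    have h2 := mul_nonneg D.β_pos.le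
      (sq_nonneg (D.profile l ℓ (k + 1) - D.profile l ℓ k))
    have h3 := profile_le (D := D) hl ℓ k
    have h4 : D.α * l * D.profile l ℓ k ≤ D.α * l * l := by
      have := mul_nonneg D.α_pos.le hl
      exact mul_le_mul_of_nonneg_left (by linarith) this
    have h5 := mul_nonneg D.α_pos.le (sq_nonneg (D.profile l ℓ k))
    nlinarith
  have := Finset.sum_le_sum this
  simpa using this

/-! ### The threshold function -/

variable (D) in
/-- Energy release at which intervals of length `n` and `n + 1` become equivalent. -/
def threshold (l : ℝ) (n : ℕ) : ℝ := n * D.opt l (n + 1) - (n + 1) * D.opt l n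

lemma threshold_lt_succ (hl : 0 < l) (n : ℕ) : D.threshold l n < D.threshold l (n + 1) := by
  have h := two_mul_opt_lt (D := D) hl n
  have hn : (0 : ℝ) ≤ n := Nat.cast_nonneg n
  unfold threshold
  push_cast
  rw [show n + 1 + 1 = n + 2 by ring]
  nlinarith

lemma hasDerivAt_threshold (hl : 0 < l) (n : ℕ) :
    HasDerivAt (fun l => D.threshold l n)
      (n * (D.α * D.total l (n + 1)) - (n + 1) * (D.α * D.total l n)) l :=
  ((hasDerivAt_opt hl (n + 1)).const_mul _).sub ((hasDerivAt_opt hl n).const_mul _)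

lemma threshold_strictMonoOn (n : ℕ) :
    StrictMonoOn (fun l => D.threshold l (n + 1)) (Set.Ioi 0) := by
  refine strictMonoOn_of_deriv_pos (convex_Ioi 0) (fun l hl =>
    (hasDerivAt_threshold hl _).continuousAt.continuousWithinAt) fun l hl => ?_
  rw [interior_Ioi] at hl
  rw [(hasDerivAt_threshold hl _).deriv]
  have h := mul_lt_mul_of_pos_left (total_comparison (D := D) hl n) D.α_pos
  push_cast
  rw [show n + 1 + 1 = n + 2 by ring]
  linarith

/-- Test with the field equal to `1` at the only interior site of an interval of length two. -/
lemma threshold_one_ge (hl : 2 ≤ l) :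
    D.α * l - (D.α + 2 * D.zs + 2 * D.β) ≤ D.threshold l 1 := by
  have hl0 : 0 ≤ l := by linarith
  unfold threshold
  rw [opt_one hl0]
  have h := energy_le_opt (D := D) hl0 (ℓ := 2) (q := fun k => if k = 1 then 1 else 0)
    (by simp) (fun k hk => by simp; omega)
  have h2 := D.le_mul 2 (by norm_num)
  simp only [energy, density, Finset.sum_range_succ, Finset.sum_range_zero] at h
  norm_num [D.ψ_zero] at h
  norm_num
  linarith

/-- Between consecutive thresholds there is an open interval of loads. -/
lemma exists_loads {c : ℝ} (hc : 0 < c) (n : ℕ) :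
    ∃ a b : ℝ, 0 < a ∧ a < b ∧ ∀ l ∈ Set.Ioo a b,
      D.threshold l n < c ∧ c < D.threshold l (n + 1) := by
  have hα := D.α_pos
  have hcont : ContinuousOn (fun l => D.threshold l (n + 1)) (Set.Ioi 0) := fun l hl =>
    (hasDerivAt_threshold hl _).continuousAt.continuousWithinAt
  -- small loads
  obtain ⟨a, ha, ha'⟩ : ∃ a : ℝ, 0 < a ∧ D.threshold a (n + 1) ≤ c := by
    set C : ℝ := ((n : ℝ) + 1) * ((n + 2) * D.α) with hC
    have hCpos : 0 < C := by positivity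
    refine ⟨Real.sqrt (c / C), Real.sqrt_pos.2 (by positivity), ?_⟩
    have h1 := opt_le (D := D) (Real.sqrt_nonneg (c / C)) (n + 2)
    have h2 := opt_nonneg (D := D) (Real.sqrt_nonneg (c / C)) (n + 1)
    rw [Real.sq_sqrt (by positivity)] at h1
    unfold threshold
    push_cast at h1 ⊢
    rw [show n + 1 + 1 = n + 2 by ring]
    have h3 : ((n : ℝ) + 1) * ((n + 2) * (D.α * (c / C))) = c := by
      rw [hC]; field_simp
    have hn : (0 : ℝ) ≤ n := Nat.cast_nonneg n
    nlinarith
  -- large loads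
  have hmono1 : ∀ l, 0 < l → ∀ k, D.threshold l 1 ≤ D.threshold l (k + 1) := fun l hl k =>
    (strictMono_nat_of_lt_succ (threshold_lt_succ (D := D) hl)).monotone (by omega)
  obtain ⟨b, hab, hb'⟩ : ∃ b : ℝ, a ≤ b ∧ c ≤ D.threshold b (n + 1) := by
    refine ⟨max (max a 2) ((c + (D.α + 2 * D.zs + 2 * D.β)) / D.α),
      (le_max_left a 2).trans (le_max_left _ _), ?_⟩
    set b := max (max a 2) ((c + (D.α + 2 * D.zs + 2 * D.β)) / D.α) with hb
    have hb2 : 2 ≤ b := (le_max_right a 2).trans (le_max_left _ _)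
    have h1 := threshold_one_ge (D := D) hb2
    have h2 : (c + (D.α + 2 * D.zs + 2 * D.β)) / D.α ≤ b := le_max_right _ _
    rw [div_le_iff₀ hα] at h2
    have := hmono1 b (by linarith) n
    linarith
  -- At `l₀` the upper threshold equals `c` and the lower one is strictly smaller. Slightly larger
  -- loads keep the latter by continuity and push the former above `c`.
  obtain ⟨l₀, hl₀, hτ⟩ := intermediate_value_Icc hab
    (hcont.mono fun x hx => lt_of_lt_of_le ha hx.1) ⟨ha', hb'⟩
  have hl₀pos : 0 < l₀ := ha.trans_le hl₀.1
  simp only at hτ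
  have hlt : D.threshold l₀ n < c := hτ ▸ threshold_lt_succ (D := D) hl₀pos n
  have hev : ∀ᶠ l in 𝓝 l₀, D.threshold l n < c :=
    (hasDerivAt_threshold hl₀pos n).continuousAt.eventually_lt continuousAt_const hlt
  obtain ⟨ε, hε, hball⟩ := Metric.eventually_nhds_iff.1 hev
  refine ⟨l₀, l₀ + ε, hl₀pos, by linarith, fun l hl => ⟨hball ?_, ?_⟩⟩
  · rw [Real.dist_eq, abs_of_pos (sub_pos.2 hl.1)]
    linarith [hl.2]
  · rw [← hτ]
    exact threshold_strictMonoOn n hl₀pos (hl₀pos.trans hl.1) hl.1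

end FieldProblem

/-! ### Lower bounds of the energy -/

/-- Concatenation of optimal fields between the sites of a broken set. -/
lemma FieldProblem.exists_field_of_broken {D : FieldProblem} {l A B : ℝ} (hl : 0 ≤ l)
    (h : ∀ ℓ : ℕ, 1 ≤ ℓ → A + B * ℓ ≤ D.opt l ℓ) (Br : Finset ℕ) :
    ∀ N : ℕ, (∀ k ∈ Br, 0 < k ∧ k ≤ N) →
      ∃ q : ℕ → ℝ, q 0 = 0 ∧ (∀ k, N < k → q k = 0) ∧ (∀ k ∈ Br, q k = 0) ∧
        (∀ k, q k ∈ Set.Icc 0 (l / 2)) ∧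
        A * (Br.card + 1) + B * (N + 1) ≤ D.energy l (N + 1) q := by
  induction Br using Finset.induction_on_max with
  | empty =>
    intro N _
    -- The sites `0` and `N + 1` act as broken ends, hence `N + 1` for the total length and `card +
    -- 1` for the number of intervals.
    refine ⟨D.profile l (N + 1), FieldProblem.profile_zero hl _,
      fun k hk => FieldProblem.profile_of_le hl hk, by simp,
      fun k => ⟨FieldProblem.profile_nonneg hl _ _, FieldProblem.profile_le hl _ _⟩, ?_⟩
    have := h (N + 1) (by omega)
    push_cast at this
    simpa [FieldProblem.opt] using this
  | insert m s hs ih =>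
    intro N hN
    obtain ⟨hm0, hmN⟩ := hN m (Finset.mem_insert_self _ _)
    obtain ⟨q', q0, qs, qB, qI, qE⟩ := ih (m - 1) fun k hk =>
      ⟨(hN k (Finset.mem_insert_of_mem hk)).1, by have := hs k hk; omega⟩
    rw [Nat.sub_add_cancel hm0] at qE
    obtain ⟨n, rfl⟩ := Nat.exists_eq_add_of_le hmN
    set x := D.profile l (n + 1) with hx
    have x0 : x 0 = 0 := FieldProblem.profile_zero hl _
    have hqm : q' m = 0 := qs m (by omega)
    refine ⟨fun k => if k ≤ m then q' k else x (k - m), by simp [q0], fun k hk => ?_,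
      fun k hk => ?_, fun k => ?_, ?_⟩
    · beta_reduce
      rw [if_neg (by omega)]
      exact FieldProblem.profile_of_le hl (by omega)
    · rcases Finset.mem_insert.1 hk with rfl | hk
      · simp [hqm]
      · beta_reduce
        rw [if_pos (hs k hk).le, qB k hk]
    · simp only
      split_ifs
      · exact qI k
      · exact ⟨FieldProblem.profile_nonneg hl _ _, FieldProblem.profile_le hl _ _⟩
    · have hE : D.energy l (m + n + 1) (fun k => if k ≤ m then q' k else x (k - m))
          = D.energy l m q' + D.energy l (n + 1) x := by
        unfold FieldProblem.energy
        rw [add_assoc, Finset.sum_range_add]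
        congr 1
        · refine Finset.sum_congr rfl fun k hk => ?_
          have := Finset.mem_range.1 hk
          beta_reduce
          rw [if_pos (by omega), if_pos (by omega)]
        · refine Finset.sum_congr rfl fun k _ => ?_
          beta_reduce
          rw [if_neg (show ¬ m + k + 1 ≤ m by omega), show m + k + 1 - m = k + 1 by omega]
          rcases k with _ | k
          · rw [if_pos (by omega), x0, ← hqm]; rfl
          · rw [if_neg (by omega), show m + (k + 1) - m = k + 1 by omega]
      rw [hE, Finset.card_insert_of_notMem fun hm => (hs m hm).false]
      have h1 : A + B * ((n + 1 : ℕ) : ℝ) ≤ D.energy l (n + 1) x := h (n + 1) (by omega)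
      rw [Nat.cast_sub hm0] at qE
      push_cast at qE h1 ⊢
      linarith

/-- The hypotheses on the convex potential and on the kernel. -/
structure Setting where
  /-- convex potential -/
  ft : ℝ → ℝ
  /-- truncation point -/
  zs : ℝ
  /-- decay rate of the kernel -/
  σ : ℝ
  zs_pos : 0 < zs
  σ_pos : 0 < σ
  nonneg : ∀ x, 0 ≤ ft x
  conv : StrictConvexOn ℝ Set.univ ft
  zero : ft 0 = 0

namespace Setting

variable (S : Setting)

/-- Ratio of the geometric kernel. -/
def ρ : ℝ := Real.exp (-S.σ)

lemma ρ_pos : 0 < S.ρ := Real.exp_pos _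

lemma ρ_lt_one : S.ρ < 1 := by
  unfold ρ
  rw [Real.exp_lt_one_iff]
  linarith [S.σ_pos]

/-- Truncated potential. -/
def f : ℝ → ℝ := truncated S.ft S.zs

/-- The energy of a chain. -/
def F (N : ℕ) (u : ℕ → ℝ) : ℝ := energy S.f (expKernel S.σ) N u

lemma F_eq (N : ℕ) (u : ℕ → ℝ) :
    S.F N u = ∑ i ∈ Finset.range N, S.f (u (i + 1) - u i) + longRange S.ρ N u u :=
  energy_expKernel _ _ _ _

/-- The energy of a broken bond. -/
def c₀ : ℝ := S.ft S.zs

lemma c₀_pos : 0 < S.c₀ := by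
  have := ft_strictMono S.conv S.zero S.nonneg le_rfl S.zs_pos
  rwa [S.zero] at this

lemma f_of_le {x : ℝ} (h : x ≤ S.zs) : S.f x = S.ft x := if_pos h

lemma f_of_ge {x : ℝ} (h : S.zs ≤ x) : S.f x = S.c₀ := by
  rcases h.eq_or_lt with rfl | h
  · exact if_pos le_rfl
  · exact if_neg h.not_ge

lemma f_nonneg (x : ℝ) : 0 ≤ S.f x := by
  rcases le_total x S.zs with h | h
  · rw [S.f_of_le h]; exact S.nonneg x
  · rw [S.f_of_ge h]; exact S.c₀_pos.le

/-- The associated problem for stress fields between broken bonds. -/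
def prob : FieldProblem where
  α := compliance S.ρ
  β := gradStiff S.ρ
  zs := S.zs
  ψ := phaseConj S.ft S.zs
  α_pos := compliance_pos S.ρ_pos S.ρ_lt_one
  β_pos := gradStiff_pos S.ρ_pos S.ρ_lt_one
  convex := phaseConj_convex S.conv S.zs_pos
  mono := phaseConj_mono S.conv S.zs_pos
  of_nonpos := fun _ hy => phaseConj_of_nonpos S.conv S.zs_pos S.zero S.nonneg hy
  le_mul := fun y hy => by
    have h := phaseConj_add_le S.conv S.zs_pos hy
    rw [phaseConj_of_nonpos S.conv S.zs_pos S.zero S.nonneg le_rfl] at h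
    linarith
  subgrad_unique := fun _ _ _ h h' => subgradient_phaseConj_unique S.conv S.zs_pos h h'

/-- On `[0, zs]` this is Young's inequality; at negative slopes the left side is nonpositive and the
right side nonnegative. -/
lemma neg_ψ_le {s q : ℝ} (hs : s ≤ S.zs) (hq : 0 ≤ q) :
    -S.prob.ψ (2 * q) ≤ S.f s - 2 * q * s := by
  rw [S.f_of_le hs]
  rcases le_total 0 s with h | h
  · have := le_phaseConj S.conv (s := s) ⟨h, hs⟩ (2 * q)
    change -phaseConj S.ft S.zs (2 * q) ≤ _
    linarith
  · have h1 := S.prob.ψ_nonneg (2 * q)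
    have h2 := S.nonneg s
    nlinarith

/-- A set of bonds that may be regarded as broken. -/
def IsBrokenSet (N : ℕ) (u : ℕ → ℝ) (Br : Finset ℕ) : Prop :=
  Br ⊆ Finset.range N ∧ (∀ k ∈ Br, S.zs ≤ u (k + 1) - u k) ∧
    ∀ k < N, k ∉ Br → u (k + 1) - u k ≤ S.zs

lemma exists_isBrokenSet (N : ℕ) (u : ℕ → ℝ) : ∃ Br, S.IsBrokenSet N u Br := by
  refine ⟨(Finset.range N).filter fun k => S.zs ≤ u (k + 1) - u k, Finset.filter_subset _ _,
    fun k hk => (Finset.mem_filter.1 hk).2, fun k hk hk' => ?_⟩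
  rw [Finset.mem_filter, not_and, not_le] at hk'
  exact (hk' (Finset.mem_range.2 hk)).le

/-- Lower bound of the energy in terms of an affine minorant of the optimal field energies. -/
theorem F_lower_bound {l : ℝ} (hl : 0 ≤ l) :
    ∃ C : ℝ, ∀ A B : ℝ, (∀ ℓ : ℕ, 1 ≤ ℓ → A + B * ℓ ≤ S.prob.opt l ℓ) →
      ∀ (N : ℕ) (u : ℕ → ℝ) (Br : Finset ℕ), S.IsBrokenSet N u Br →
        l * (u N - u 0) - S.prob.α * l ^ 2 / 4 * N + S.c₀ * Br.card
          + A * (Br.card + 1) + B * (N + 1) - C ≤ S.F N u := by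
  obtain ⟨K, hK, hb⟩ := longRange_bounds S.ρ_pos S.ρ_lt_one
  refine ⟨K * (l / 2) ^ 2, fun A B hAB N u Br hBr => ?_⟩
  obtain ⟨hsub, hge, hle⟩ := hBr
  -- Bond `k` carries the stress at site `k + 1`, so the broken set is shifted by one.
  obtain ⟨q, q0, qs, qB, qI, qE⟩ := FieldProblem.exists_field_of_broken hl hAB
    (Br.map ⟨Nat.succ, Nat.succ_injective⟩) N (by
      intro k hk
      obtain ⟨j, hj, rfl⟩ := Finset.mem_map.1 hk
      have := Finset.mem_range.1 (hsub hj)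
      exact ⟨Nat.succ_pos _, this⟩)
  rw [Finset.card_map] at qE
  have hqB : ∀ k ∈ Br, q (k + 1) = 0 := fun k hk =>
    qB _ (Finset.mem_map.2 ⟨k, hk, rfl⟩)
  have hp := (hb N (fun k => l / 2 - q k) (l / 2) fun k => by
    rw [abs_le]; constructor <;> linarith [(qI k).1, (qI k).2]).1 u
  rw [S.F_eq]
  have hpt : ∀ k ∈ Finset.range N, (if k ∈ Br then S.c₀ else 0) - S.prob.ψ (2 * q (k + 1))
      ≤ S.f (u (k + 1) - u k) - 2 * q (k + 1) * (u (k + 1) - u k) := by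
    intro k hk
    split_ifs with hkB
    · rw [hqB k hkB, S.f_of_ge (hge k hkB), mul_zero, S.prob.ψ_zero]
      simp
    · have := S.neg_ψ_le (hle k (Finset.mem_range.1 hk) hkB) (qI (k + 1)).1
      linarith
  have hsum := Finset.sum_le_sum hpt
  rw [Finset.sum_sub_distrib, Finset.sum_sub_distrib, Finset.sum_ite_mem,
    Finset.inter_eq_right.2 hsub, Finset.sum_const, nsmul_eq_mul] at hsum
  have htel : ∑ k ∈ Finset.range N, (u (k + 1) - u k) = u N - u 0 := Finset.sum_range_sub u N
  have h2p : 2 * ∑ k ∈ Finset.range N, (l / 2 - q (k + 1)) * (u (k + 1) - u k)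
      = l * (u N - u 0) - ∑ k ∈ Finset.range N, 2 * q (k + 1) * (u (k + 1) - u k) := by
    rw [← htel, Finset.mul_sum, Finset.mul_sum, ← Finset.sum_sub_distrib]
    exact Finset.sum_congr rfl fun k _ => by ring
  have hdual : dualForm S.ρ N (fun k => l / 2 - q k)
      = S.prob.α * l ^ 2 / 4 * N - ∑ k ∈ Finset.range N, S.prob.ψ (2 * q (k + 1))
        - S.prob.energy l (N + 1) q := by
    have e1 : S.prob.energy l (N + 1) q
        = ∑ k ∈ Finset.range N, (S.prob.α * l * q (k + 1) - S.prob.α * q (k + 1) ^ 2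
            - S.prob.ψ (2 * q (k + 1)))
          - S.prob.β * ∑ k ∈ Finset.range (N + 1), (q (k + 1) - q k) ^ 2 := by
      unfold FieldProblem.energy FieldProblem.density
      rw [Finset.sum_sub_distrib, Finset.sum_range_succ', q0, ← Finset.mul_sum]
      simp [S.prob.ψ_zero]
    have e2 : dualForm S.ρ N (fun k => l / 2 - q k)
        = S.prob.α * ∑ k ∈ Finset.range N, (l / 2 - q (k + 1)) ^ 2
          + S.prob.β * ∑ k ∈ Finset.range (N + 1), (q (k + 1) - q k) ^ 2 := by
      unfold dualForm
      congr 2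
      exact Finset.sum_congr rfl fun k _ => by ring
    have e3 : S.prob.α * ∑ k ∈ Finset.range N, (l / 2 - q (k + 1)) ^ 2
        = S.prob.α * l ^ 2 / 4 * N - ∑ k ∈ Finset.range N, S.prob.ψ (2 * q (k + 1))
          - ∑ k ∈ Finset.range N, (S.prob.α * l * q (k + 1) - S.prob.α * q (k + 1) ^ 2
            - S.prob.ψ (2 * q (k + 1))) := by
      have : S.prob.α * l ^ 2 / 4 * N = ∑ k ∈ Finset.range N, S.prob.α * l ^ 2 / 4 := by
        rw [Finset.sum_const, Finset.card_range, nsmul_eq_mul]; ring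
      rw [this, Finset.mul_sum, ← Finset.sum_sub_distrib, ← Finset.sum_sub_distrib]
      exact Finset.sum_congr rfl fun k _ => by ring
    linarith
  linarith

/-- Lower bound of the energy at a nonpositive mean slope. -/
theorem F_lower_bound_of_nonpos {z : ℝ} (hz : z ≤ 0) :
    ∃ C : ℝ, ∀ (N : ℕ) (u : ℕ → ℝ) (Br : Finset ℕ), u 0 = 0 → u N = N * z →
      S.IsBrokenSet N u Br →
        N * (S.ft z + z ^ 2 / S.prob.α) + S.c₀ * Br.card - C ≤ S.F N u := by
  obtain ⟨K, hK, hb⟩ := longRange_bounds S.ρ_pos S.ρ_lt_one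
  have hα := S.prob.α_pos
  obtain ⟨t, ht0, ht⟩ : ∃ t ≤ 0, ∀ y, S.ft z + t * (y - z) ≤ S.ft y := by
    rcases hz.eq_or_lt with rfl | hz
    · exact ⟨0, le_rfl, fun y => by simpa [S.zero] using S.nonneg y⟩
    · obtain ⟨t, ht⟩ := exists_subgradient S.conv.convexOn z
      refine ⟨t, ?_, ht⟩
      have h1 := ht 0
      have h2 := S.nonneg z
      rw [S.zero] at h1
      nlinarith
  refine ⟨K * |z / S.prob.α| ^ 2, fun N u Br hu0 huN hBr => ?_⟩
  obtain ⟨hsub, hge, hle⟩ := hBr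
  have hp := (hb N (fun _ => z / S.prob.α) _ fun _ => le_rfl).1 u
  rw [S.F_eq]
  -- Since `t ≤ 0`, the supporting line of `ft` at `z` is nonpositive at positive slopes, so a
  -- broken bond pays the full `c₀` above it.
  have hpt : ∀ k ∈ Finset.range N, (if k ∈ Br then S.c₀ else 0)
      + (S.ft z + t * (u (k + 1) - u k - z)) ≤ S.f (u (k + 1) - u k) := by
    intro k hk
    split_ifs with hkB
    · rw [S.f_of_ge (hge k hkB)]
      have h1 := ht 0
      rw [S.zero] at h1
      have h2 := hge k hkB
      have := S.zs_pos
      nlinarith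
    · rw [S.f_of_le (hle k (Finset.mem_range.1 hk) hkB), zero_add]
      exact ht _
  have hsum := Finset.sum_le_sum hpt
  have htel : ∑ k ∈ Finset.range N, (u (k + 1) - u k) = N * z := by
    rw [Finset.sum_range_sub u N, hu0, huN, sub_zero]
  rw [Finset.sum_add_distrib, Finset.sum_add_distrib, ← Finset.mul_sum, Finset.sum_sub_distrib,
    htel, Finset.sum_ite_mem, Finset.inter_eq_right.2 hsub, Finset.sum_const, Finset.sum_const,
    Finset.sum_const, Finset.card_range, nsmul_eq_mul, nsmul_eq_mul, nsmul_eq_mul] at hsum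
  have hd : dualForm S.ρ N (fun _ => z / S.prob.α) = N * (z ^ 2 / S.prob.α) := by
    unfold dualForm
    simp only [sub_self, Finset.sum_const, Finset.card_range, nsmul_eq_mul]
    change S.prob.α * _ + _ = _
    field_simp
    ring
  rw [← Finset.mul_sum, htel, hd] at hp
  have : 2 * (z / S.prob.α * (N * z)) = 2 * (N * (z ^ 2 / S.prob.α)) := by ring
  linarith

end Setting

/-! ### Upper bounds of the energy -/

lemma abs_sum_sub_sum_le {a b : ℕ → ℝ} {n j : ℕ} {Γ : ℝ}
    (hab : ∀ k < n, k ≠ j → a k = b k) (ha : ∀ k, |a k| ≤ Γ) (hb : ∀ k, |b k| ≤ Γ) :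
    |∑ k ∈ Finset.range n, a k - ∑ k ∈ Finset.range n, b k| ≤ 2 * Γ := by
  have hΓ : 0 ≤ Γ := (abs_nonneg _).trans (ha 0)
  rw [← Finset.sum_sub_distrib]
  refine (Finset.abs_sum_le_sum_abs _ _).trans ?_
  have : ∀ k ∈ Finset.range n, |a k - b k| ≤ if j = k then 2 * Γ else 0 := by
    intro k hk
    split_ifs with h
    · exact (abs_sub _ _).trans (by linarith [ha k, hb k])
    · rw [hab k (Finset.mem_range.1 hk) (Ne.symm h)]; simp
  refine (Finset.sum_le_sum this).trans ?_
  rw [Finset.sum_ite_eq]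
  split_ifs
  · exact le_rfl
  · positivity

/-- Local sums along a concatenation of two sequences. -/
lemma abs_sum_concat_le {g : ℝ → ℝ → ℝ → ℝ} {P Γ : ℝ}
    (hg : ∀ x y z, |x| ≤ P → |y| ≤ P → |z| ≤ P → |g x y z| ≤ Γ) {p₁ p₂ : ℕ → ℝ}
    (h₁ : ∀ k, |p₁ k| ≤ P) (h₂ : ∀ k, |p₂ k| ≤ P) (N₁ N₂ : ℕ) {p : ℕ → ℝ}
    (hp : p = fun k => if k ≤ N₁ then p₁ k else p₂ (k - N₁)) :
    |∑ k ∈ Finset.range (N₁ + N₂), g (p k) (p (k + 1)) (p (k + 2))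
      - (∑ k ∈ Finset.range N₁, g (p₁ k) (p₁ (k + 1)) (p₁ (k + 2))
        + ∑ k ∈ Finset.range N₂, g (p₂ k) (p₂ (k + 1)) (p₂ (k + 2)))| ≤ 4 * Γ := by
  have hpb : ∀ k, |p k| ≤ P := fun k => by
    rw [hp]; beta_reduce; split_ifs
    · exact h₁ k
    · exact h₂ _
  -- Only two windows of three sites feel the junction: the last one on the left and the first one
  -- on the right.
  have e1 := abs_sum_sub_sum_le (n := N₁) (j := N₁ - 1) (Γ := Γ)
    (a := fun k => g (p k) (p (k + 1)) (p (k + 2)))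
    (b := fun k => g (p₁ k) (p₁ (k + 1)) (p₁ (k + 2))) (fun k hk hkj => by
      rw [hp]; beta_reduce
      rw [if_pos (by omega), if_pos (by omega), if_pos (by omega)])
    (fun k => hg _ _ _ (hpb _) (hpb _) (hpb _)) (fun k => hg _ _ _ (h₁ _) (h₁ _) (h₁ _))
  have e2 := abs_sum_sub_sum_le (n := N₂) (j := 0) (Γ := Γ)
    (a := fun k => g (p (N₁ + k)) (p (N₁ + k + 1)) (p (N₁ + k + 2)))
    (b := fun k => g (p₂ k) (p₂ (k + 1)) (p₂ (k + 2))) (fun k hk hkj => by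
      rw [hp]; beta_reduce
      rw [if_neg (by omega), if_neg (by omega), if_neg (by omega),
        show N₁ + k - N₁ = k by omega, show N₁ + k + 1 - N₁ = k + 1 by omega,
        show N₁ + k + 2 - N₁ = k + 2 by omega])
    (fun k => hg _ _ _ (hpb _) (hpb _) (hpb _)) (fun k => hg _ _ _ (h₂ _) (h₂ _) (h₂ _))
  rw [Finset.sum_range_add]
  rw [abs_le] at *
  constructor <;> linarith [e1.1, e1.2, e2.1, e2.2]

lemma sum_range_succ_eq_of_periodic {φ : ℕ → ℝ} {n : ℕ} (h : φ n = φ 0) :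
    ∑ k ∈ Finset.range n, φ (k + 1) = ∑ k ∈ Finset.range n, φ k := by
  have h1 := Finset.sum_range_succ' φ n
  rw [Finset.sum_range_succ] at h1
  linarith

/-- Sums of periodic sequences grow linearly, up to a bounded error. -/
lemma exists_abs_sum_sub_le_of_periodic {φ : ℕ → ℝ} {n : ℕ} (hn : 0 < n)
    (h : ∀ k, φ (k + n) = φ k) :
    ∃ C : ℝ, ∀ N : ℕ,
      |∑ k ∈ Finset.range N, φ k - N * ((∑ k ∈ Finset.range n, φ k) / n)| ≤ C := by
  set A := (∑ k ∈ Finset.range n, φ k) / n with hA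
  set g : ℕ → ℝ := fun N => ∑ k ∈ Finset.range N, φ k - N * A with hg
  have hn' : (n : ℝ) ≠ 0 := by positivity
  have hper : Function.Periodic g n := by
    intro N
    have : ∀ N, ∑ k ∈ Finset.range (N + n), φ k
        = ∑ k ∈ Finset.range N, φ k + ∑ k ∈ Finset.range n, φ k := by
      intro N
      rw [add_comm N n, Finset.sum_range_add, add_comm]
      congr 1
      exact Finset.sum_congr rfl fun k _ => by rw [add_comm n k, h]
    simp only [hg]
    rw [this]
    push_cast
    have : (n : ℝ) * A = ∑ k ∈ Finset.range n, φ k := by rw [hA]; field_simp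
    linarith
  refine ⟨∑ r ∈ Finset.range n, |g r|, fun N => ?_⟩
  change |g N| ≤ _
  rw [← hper.map_mod_nat N]
  exact Finset.single_le_sum (f := fun r => |g r|) (fun _ _ => abs_nonneg _)
    (Finset.mem_range.2 (Nat.mod_lt _ hn))

lemma longRange_sub_const (ρ : ℝ) (N : ℕ) (u : ℕ → ℝ) (c : ℝ) :
    longRange ρ N (fun k => u k - c) (fun k => u k - c) = longRange ρ N u u := by
  unfold longRange
  exact Finset.sum_congr rfl fun i _ => Finset.sum_congr rfl fun j _ => by ring

namespace Setting

variable (S : Setting)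

/-- The energy of a bond under stress `y` in equilibrium with the neighbouring stresses. -/
def bondEnergy (x y z : ℝ) : ℝ := S.f (stressSlope S.ρ x y z) + y * stressSlope S.ρ x y z

/-- The mean slope `z` can be realized with mean energy `E`, by bounded stress fields. -/
def Attainable (z E : ℝ) : Prop :=
  ∃ P C : ℝ, ∀ N : ℕ, ∃ p : ℕ → ℝ, (∀ k, |p k| ≤ P) ∧
    |∑ k ∈ Finset.range N, stressSlope S.ρ (p k) (p (k + 1)) (p (k + 2)) - N * z| ≤ C ∧
    ∑ k ∈ Finset.range N, S.bondEnergy (p k) (p (k + 1)) (p (k + 2)) ≤ N * E + C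

lemma exists_f_bound (R : ℝ) : ∃ M : ℝ, ∀ x, |x| ≤ R → |S.f x| ≤ M := by
  obtain ⟨M, hM⟩ := (isCompact_Icc (a := -R) (b := R)).exists_bound_of_continuousOn
    (continuous_of_convex S.conv).continuousOn
  refine ⟨max M S.c₀, fun x hx => ?_⟩
  rcases le_total x S.zs with h | h
  · rw [S.f_of_le h]
    exact (hM x (abs_le.1 hx)).trans (le_max_left _ _)
  · rw [S.f_of_ge h, abs_of_pos S.c₀_pos]
    exact le_max_right _ _

lemma exists_bondEnergy_bound (P : ℝ) :
    ∃ Γ : ℝ, ∀ x y z, |x| ≤ P → |y| ≤ P → |z| ≤ P →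
      |stressSlope S.ρ x y z| ≤ Γ ∧ |S.bondEnergy x y z| ≤ Γ := by
  set T := (compliance S.ρ + 4 * gradStiff S.ρ) * P with hT
  obtain ⟨M, hM⟩ := S.exists_f_bound T
  refine ⟨max T (M + P * T), fun x y z hx hy hz => ?_⟩
  have h := abs_stressSlope_le S.ρ_pos S.ρ_lt_one hx hy hz
  refine ⟨h.trans (le_max_left _ _), le_trans ?_ (le_max_right _ _)⟩
  unfold bondEnergy
  refine (abs_add_le _ _).trans (add_le_add (hM _ h) ?_)
  rw [abs_mul]
  exact mul_le_mul hy h (abs_nonneg _) ((abs_nonneg _).trans hy)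

/-- The energy of the displacement in equilibrium with a bounded stress field. -/
lemma exists_F_le : ∃ K : ℝ, 0 ≤ K ∧ ∀ (P : ℝ) (p : ℕ → ℝ), (∀ k, |p k| ≤ P) → ∀ N : ℕ,
    S.F N (fun k => dispOf S.ρ p k - dispOf S.ρ p 0)
      ≤ ∑ k ∈ Finset.range N, S.bondEnergy (p k) (p (k + 1)) (p (k + 2)) + K * P ^ 2 := by
  obtain ⟨K, hK, hb⟩ := longRange_bounds S.ρ_pos S.ρ_lt_one
  refine ⟨K, hK, fun P p hp N => ?_⟩
  have h := (hb N p P hp).2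
  rw [S.F_eq, longRange_sub_const]
  have e : ∑ k ∈ Finset.range N, S.bondEnergy (p k) (p (k + 1)) (p (k + 2))
      = ∑ i ∈ Finset.range N, S.f (dispOf S.ρ p (i + 1) - dispOf S.ρ p 0
            - (dispOf S.ρ p i - dispOf S.ρ p 0))
        + ∑ k ∈ Finset.range N, p (k + 1) * stressSlope S.ρ (p k) (p (k + 1)) (p (k + 2)) := by
    rw [← Finset.sum_add_distrib]
    refine Finset.sum_congr rfl fun k _ => ?_
    rw [sub_sub_sub_cancel_right, dispOf_succ_sub, bondEnergy]
  linarith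

lemma dispOf_sub_zero (p : ℕ → ℝ) (N : ℕ) :
    dispOf S.ρ p N - dispOf S.ρ p 0
      = ∑ k ∈ Finset.range N, stressSlope S.ρ (p k) (p (k + 1)) (p (k + 2)) := by
  rw [← Finset.sum_range_sub]
  exact Finset.sum_congr rfl fun k _ => dispOf_succ_sub _ _ _

variable {S}

/-- Attainable energies bound the minimal energies with exact boundary conditions. -/
theorem Attainable.exists_le {z E : ℝ} (h : S.Attainable z E) :
    ∃ C : ℝ, ∀ N : ℕ, 1 ≤ N → ∃ u ∈ admissible N z, S.F N u ≤ N * E + C := by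
  obtain ⟨P, C, h⟩ := h
  have hβ := gradStiff_pos S.ρ_pos S.ρ_lt_one
  have hC : 0 ≤ C := by
    obtain ⟨p, -, h2, -⟩ := h 0
    exact (abs_nonneg _).trans h2
  set P' := P + C / gradStiff S.ρ with hP'
  obtain ⟨Γ, hΓ⟩ := S.exists_bondEnergy_bound P'
  obtain ⟨K, hK, hF⟩ := S.exists_F_le
  refine ⟨C + 2 * Γ + K * P' ^ 2, fun N hN => ?_⟩
  obtain ⟨p, hp, hs, hE⟩ := h N
  set x := (∑ k ∈ Finset.range N, stressSlope S.ρ (p k) (p (k + 1)) (p (k + 2)) - N * z)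
    / gradStiff S.ρ with hx
  have hxb : |x| ≤ C / gradStiff S.ρ := by
    rw [hx, abs_div, abs_of_pos hβ]
    exact div_le_div_of_nonneg_right hs hβ.le
  -- The value `p 0` enters only the slope of the first bond, with coefficient `-β`, so changing it
  -- restores the exact boundary value at bounded cost.
  set p' : ℕ → ℝ := Function.update p 0 (p 0 + x) with hp'
  have hp'0 : p' 0 = p 0 + x := Function.update_self ..
  have hp's : ∀ k, p' (k + 1) = p (k + 1) := fun k => Function.update_of_ne (by omega) ..
  have hPP : P ≤ P' := by rw [hP']; linarith [div_nonneg hC hβ.le]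
  have hp'b : ∀ k, |p' k| ≤ P' := by
    intro k
    rcases k with _ | k
    · rw [hp'0]; exact (abs_add_le _ _).trans (add_le_add (hp 0) hxb)
    · rw [hp's]; exact (hp _).trans hPP
  obtain ⟨n, rfl⟩ : ∃ n, N = n + 1 := ⟨N - 1, by omega⟩
  have hsum : ∑ k ∈ Finset.range (n + 1), stressSlope S.ρ (p' k) (p' (k + 1)) (p' (k + 2))
      = (n + 1 : ℕ) * z := by
    have e : ∑ k ∈ Finset.range (n + 1), stressSlope S.ρ (p' k) (p' (k + 1)) (p' (k + 2))
        = ∑ k ∈ Finset.range (n + 1), stressSlope S.ρ (p k) (p (k + 1)) (p (k + 2))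
          - gradStiff S.ρ * x := by
      rw [Finset.sum_range_succ', Finset.sum_range_succ', hp'0]
      simp only [hp's]
      unfold stressSlope
      ring
    rw [e, hx, mul_div_cancel₀ _ hβ.ne']
    ring
  refine ⟨fun k => dispOf S.ρ p' k - dispOf S.ρ p' 0, ⟨sub_self _, ?_⟩, ?_⟩
  · beta_reduce
    rw [S.dispOf_sub_zero, hsum]
  · have h1 := hF P' p' hp'b (n + 1)
    have h2 := abs_sum_sub_sum_le (n := n + 1) (j := 0) (Γ := Γ)
      (a := fun k => S.bondEnergy (p' k) (p' (k + 1)) (p' (k + 2)))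
      (b := fun k => S.bondEnergy (p k) (p (k + 1)) (p (k + 2))) (fun k hk hk0 => by
        obtain ⟨j, rfl⟩ := Nat.exists_eq_succ_of_ne_zero hk0
        simp only [hp's, Nat.succ_eq_add_one, add_assoc, Nat.reduceAdd])
      (fun k => (hΓ _ _ _ (hp'b _) (hp'b _) (hp'b _)).2)
      (fun k => (hΓ _ _ _ ((hp _).trans hPP) ((hp _).trans hPP) ((hp _).trans hPP)).2)
    have := (abs_le.1 h2).2
    linarith

lemma F_nonneg (S : Setting) (N : ℕ) (u : ℕ → ℝ) : 0 ≤ S.F N u := by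
  rw [S.F_eq]
  refine add_nonneg (Finset.sum_nonneg fun _ _ => S.f_nonneg _) ?_
  refine le_trans ?_ (two_mul_sum_sq_le_longRange S.ρ_pos N u)
  have := S.ρ_pos
  exact mul_nonneg (by positivity) (Finset.sum_nonneg fun _ _ => sq_nonneg _)

lemma le_of_forall_nat_mul {a b C : ℝ} (h : ∀ N : ℕ, 1 ≤ N → N * a ≤ N * b + C) : a ≤ b := by
  by_contra hlt
  rw [not_le] at hlt
  obtain ⟨n, hn⟩ := exists_nat_gt (C / (a - b))
  rw [div_lt_iff₀ (sub_pos.2 hlt)] at hn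
  have := h (n + 1) (by omega)
  push_cast at this
  linarith

lemma Attainable.nonneg {z E : ℝ} (h : S.Attainable z E) : 0 ≤ E := by
  obtain ⟨C, hC⟩ := h.exists_le
  refine le_of_forall_nat_mul (C := C) fun N hN => ?_
  obtain ⟨u, -, hu⟩ := hC N hN
  have := S.F_nonneg N u
  linarith

/-- Concatenate the two stress fields on fractions `a` and `b` of the chain; locality makes the
junction and the rounding cost only a constant. -/
lemma Attainable.convex {z₁ z₂ E₁ E₂ a b : ℝ} (h₁ : S.Attainable z₁ E₁)
    (h₂ : S.Attainable z₂ E₂) (ha : 0 ≤ a) (hb : 0 ≤ b) (hab : a + b = 1) :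
    S.Attainable (a * z₁ + b * z₂) (a * E₁ + b * E₂) := by
  obtain ⟨P₁, C₁, h₁⟩ := h₁
  obtain ⟨P₂, C₂, h₂⟩ := h₂
  set P := max P₁ P₂
  obtain ⟨Γ, hΓ⟩ := S.exists_bondEnergy_bound P
  refine ⟨P, C₁ + C₂ + 4 * Γ + |z₁| + |z₂| + |E₁| + |E₂|, fun N => ?_⟩
  set N₁ := ⌊a * N⌋₊ with hN₁
  have hN : (0 : ℝ) ≤ N := Nat.cast_nonneg N
  have f1 : (N₁ : ℝ) ≤ a * N := Nat.floor_le (by positivity)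
  have f2 : a * N < N₁ + 1 := Nat.lt_floor_add_one _
  have hle : N₁ ≤ N := by
    have : (N₁ : ℝ) ≤ N := f1.trans (by nlinarith)
    exact_mod_cast this
  obtain ⟨N₂, hN₂⟩ := Nat.exists_eq_add_of_le hle
  have hcast : (N : ℝ) = N₁ + N₂ := by exact_mod_cast hN₂
  obtain ⟨p₁, hp₁, hs₁, hE₁⟩ := h₁ N₁
  obtain ⟨p₂, hp₂, hs₂, hE₂⟩ := h₂ N₂
  have hp₁' : ∀ k, |p₁ k| ≤ P := fun k => (hp₁ k).trans (le_max_left _ _)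
  have hp₂' : ∀ k, |p₂ k| ≤ P := fun k => (hp₂ k).trans (le_max_right _ _)
  obtain ⟨p, hp⟩ : ∃ p : ℕ → ℝ, p = fun k => if k ≤ N₁ then p₁ k else p₂ (k - N₁) := ⟨_, rfl⟩
  have c1 := abs_sum_concat_le (g := stressSlope S.ρ) (fun x y z hx hy hz => (hΓ x y z hx hy hz).1)
    hp₁' hp₂' N₁ N₂ hp
  have c2 := abs_sum_concat_le (g := S.bondEnergy) (fun x y z hx hy hz => (hΓ x y z hx hy hz).2)
    hp₁' hp₂' N₁ N₂ hp
  rw [← hN₂] at c1 c2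
  have hd : ∀ x y : ℝ, |N₁ * x + N₂ * y - N * (a * x + b * y)| ≤ |x| + |y| := by
    intro x y
    have e : N₁ * x + N₂ * y - N * (a * x + b * y) = (N₁ - a * N) * x - (N₁ - a * N) * y := by
      rw [show b = 1 - a by linarith, hcast]; ring
    rw [e]
    have h1 : |(N₁ : ℝ) - a * N| ≤ 1 := by rw [abs_le]; constructor <;> linarith
    refine (abs_sub _ _).trans ?_
    rw [abs_mul, abs_mul]
    nlinarith [abs_nonneg x, abs_nonneg y]
  have d1 := hd z₁ z₂
  have d2 := hd E₁ E₂
  have n1 := abs_nonneg z₁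
  have n2 := abs_nonneg z₂
  have n3 := abs_nonneg E₁
  have n4 := abs_nonneg E₂
  have hC₁ : 0 ≤ C₁ := (abs_nonneg _).trans hs₁
  have hC₂ : 0 ≤ C₂ := (abs_nonneg _).trans hs₂
  refine ⟨p, fun k => ?_, ?_, ?_⟩
  · rw [hp]; beta_reduce; split_ifs
    · exact hp₁' k
    · exact hp₂' _
  · rw [abs_le] at c1 hs₁ hs₂ d1 ⊢
    constructor <;> linarith [c1.1, c1.2, hs₁.1, hs₁.2, hs₂.1, hs₂.2, d1.1, d1.2]
  · rw [abs_le] at c2 d2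
    linarith [c2.2, d2.2]

variable (S) in
lemma attainable_const (z : ℝ) : S.Attainable z (S.f z + z ^ 2 / S.prob.α) := by
  have hα := S.prob.α_pos
  have hT : stressSlope S.ρ (z / S.prob.α) (z / S.prob.α) (z / S.prob.α) = z := by
    unfold stressSlope
    change S.prob.α * (z / S.prob.α) + _ = _
    field_simp
    ring
  refine ⟨|z / S.prob.α|, 0, fun N => ⟨fun _ => z / S.prob.α, fun _ => le_rfl, ?_, ?_⟩⟩
  · simp [hT]
  · simp only [bondEnergy, hT, Finset.sum_const, Finset.card_range, nsmul_eq_mul, add_zero]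
    apply le_of_eq
    ring

variable (S) in
lemma attainable_periodic {p : ℕ → ℝ} {n : ℕ} (hn : 0 < n) {P : ℝ} (hP : ∀ k, |p k| ≤ P)
    (hp : ∀ k, p (k + n) = p k) :
    S.Attainable
      ((∑ k ∈ Finset.range n, stressSlope S.ρ (p k) (p (k + 1)) (p (k + 2))) / n)
      ((∑ k ∈ Finset.range n, S.bondEnergy (p k) (p (k + 1)) (p (k + 2))) / n) := by
  have hp1 : ∀ k, p (k + n + 1) = p (k + 1) := fun k => by
    rw [show k + n + 1 = k + 1 + n by ring, hp]
  have hp2 : ∀ k, p (k + n + 2) = p (k + 2) := fun k => by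
    rw [show k + n + 2 = k + 2 + n by ring, hp]
  obtain ⟨C₁, h₁⟩ := exists_abs_sum_sub_le_of_periodic hn
    (φ := fun k => stressSlope S.ρ (p k) (p (k + 1)) (p (k + 2)))
    (fun k => by rw [hp, hp1, hp2])
  obtain ⟨C₂, h₂⟩ := exists_abs_sum_sub_le_of_periodic hn
    (φ := fun k => S.bondEnergy (p k) (p (k + 1)) (p (k + 2)))
    (fun k => by rw [hp, hp1, hp2])
  refine ⟨P, max C₁ C₂, fun N => ⟨p, hP, (h₁ N).trans (le_max_left _ _), ?_⟩⟩
  have := (abs_le.1 (h₂ N)).2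
  have := le_max_right C₁ C₂
  linarith

/-! ### The periodic configurations built on the optimal fields -/

variable (S) in
/-- The stress field that repeats the optimal field on intervals of length `n`. -/
def periodicStress (l : ℝ) (n k : ℕ) : ℝ := l / 2 - S.prob.profile l n (k % n)

variable (S) in
/-- Slopes of the periodic configuration. -/
def periodicSlope (l : ℝ) (n k : ℕ) : ℝ :=
  stressSlope S.ρ (S.periodicStress l n k) (S.periodicStress l n (k + 1))
    (S.periodicStress l n (k + 2))

variable (S) in
/-- Mean slope of the periodic configuration. -/
def meanSlope (l : ℝ) (n : ℕ) : ℝ := S.prob.α * (l / 2 - S.prob.total l n / n)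

variable {l : ℝ}

lemma periodicStress_add (n k : ℕ) :
    S.periodicStress l n (k + n) = S.periodicStress l n k := by
  simp [periodicStress]

lemma periodicSlope_add (n k : ℕ) : S.periodicSlope l n (k + n) = S.periodicSlope l n k := by
  unfold periodicSlope
  rw [show k + n + 1 = k + 1 + n by ring, show k + n + 2 = k + 2 + n by ring]
  simp only [periodicStress_add]

lemma periodicStress_mem (hl : 0 ≤ l) (n k : ℕ) :
    S.periodicStress l n k ∈ Set.Icc 0 (l / 2) := by
  have h1 := FieldProblem.profile_nonneg (D := S.prob) hl n (k % n)
  have h2 := FieldProblem.profile_le (D := S.prob) hl n (k % n)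
  unfold periodicStress
  exact ⟨by linarith, by linarith⟩

lemma abs_periodicStress_le (hl : 0 ≤ l) (n k : ℕ) : |S.periodicStress l n k| ≤ l / 2 := by
  have h := periodicStress_mem (S := S) hl n k
  rw [abs_of_nonneg h.1]
  exact h.2

lemma periodicStress_of_le (hl : 0 ≤ l) {n k : ℕ} (hk : k ≤ n) :
    S.periodicStress l n k = l / 2 - S.prob.profile l n k := by
  unfold periodicStress
  rcases hk.lt_or_eq with h | rfl
  · rw [Nat.mod_eq_of_lt h]
  · rw [Nat.mod_self, FieldProblem.profile_zero hl, FieldProblem.profile_of_le hl le_rfl]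

lemma periodicSlope_mod (n k : ℕ) : S.periodicSlope l n (k % n) = S.periodicSlope l n k := by
  have : Function.Periodic (S.periodicSlope l n) n := periodicSlope_add n
  exact this.map_mod_nat k

/-- Intact bonds of the periodic configuration. -/
lemma periodicSlope_intact (hl : 0 ≤ l) {n k : ℕ} (hk : k + 1 < n) :
    S.periodicSlope l n k ∈ Set.Icc 0 S.zs ∧
      S.f (S.periodicSlope l n k) = 2 * S.prob.profile l n (k + 1) * S.periodicSlope l n k
        - S.prob.ψ (2 * S.prob.profile l n (k + 1)) := by
  have h := FieldProblem.profile_subgrad (D := S.prob) hl hk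
  -- The slope in equilibrium with the stress is exactly the subgradient of `ψ` in the optimality
  -- condition; hence its range and equality in Young's inequality.
  have e : S.periodicSlope l n k
      = S.prob.α * (l / 2 - S.prob.profile l n (k + 1))
          + S.prob.β * (S.prob.profile l n k + S.prob.profile l n (k + 2)
            - 2 * S.prob.profile l n (k + 1)) := by
    unfold periodicSlope
    rw [periodicStress_of_le hl (by omega), periodicStress_of_le hl (by omega),
      periodicStress_of_le hl (by omega)]
    unfold stressSlope
    change S.prob.α * _ + S.prob.β * _ = _
    ring
  rw [← e] at h
  obtain ⟨h1, h2⟩ := subgradient_phaseConj S.conv S.zs_pos h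
  refine ⟨h1, ?_⟩
  rw [S.f_of_le h1.2]
  change _ = _ - phaseConj S.ft S.zs _
  linarith

/-- Broken bonds of the periodic configuration. -/
lemma periodicSlope_broken_nonneg (hl : 0 ≤ l) {n k : ℕ} (hk : n ∣ k + 1) :
    0 ≤ S.periodicSlope l n k := by
  unfold periodicSlope
  have h1 := periodicStress_mem (S := S) hl n k
  have h2 := periodicStress_mem (S := S) hl n (k + 2)
  have h3 : S.periodicStress l n (k + 1) = l / 2 := by
    unfold periodicStress
    rw [Nat.mod_eq_zero_of_dvd hk, FieldProblem.profile_zero hl, sub_zero]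
  rw [h3]
  unfold stressSlope
  have hα : 0 < compliance S.ρ := S.prob.α_pos
  have hβ : 0 < gradStiff S.ρ := S.prob.β_pos
  refine add_nonneg (by positivity) (mul_nonneg hβ.le ?_)
  linarith [h1.2, h2.2]

lemma sum_periodicSlope (hl : 0 ≤ l) {n : ℕ} (hn : 0 < n) :
    (∑ k ∈ Finset.range n, S.periodicSlope l n k) / n = S.meanSlope l n := by
  have hn' : (n : ℝ) ≠ 0 := by positivity
  have p0 : ∀ j, S.periodicStress l n (n + j) = S.periodicStress l n (0 + j) := fun j => by
    rw [add_comm n j, periodicStress_add, zero_add]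
  have s1 := sum_range_succ_eq_of_periodic (φ := S.periodicStress l n) (n := n) (p0 0)
  have s2 := sum_range_succ_eq_of_periodic (φ := fun k => S.periodicStress l n (k + 1)) (n := n)
    (p0 1)
  beta_reduce at s2
  have s3 : ∑ k ∈ Finset.range n, S.periodicStress l n k = n * (l / 2) - S.prob.total l n := by
    unfold FieldProblem.total
    rw [Finset.sum_congr rfl fun k hk => periodicStress_of_le hl (Finset.mem_range.1 hk).le,
      Finset.sum_sub_distrib]
    simp
  have e : ∑ k ∈ Finset.range n, S.periodicSlope l n k
      = S.prob.α * ∑ k ∈ Finset.range n, S.periodicStress l n (k + 1)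
        + S.prob.β * (2 * ∑ k ∈ Finset.range n, S.periodicStress l n (k + 1)
          - ∑ k ∈ Finset.range n, S.periodicStress l n k
          - ∑ k ∈ Finset.range n, S.periodicStress l n (k + 1 + 1)) := by
    rw [Finset.mul_sum, Finset.mul_sum, ← Finset.sum_sub_distrib, ← Finset.sum_sub_distrib,
      Finset.mul_sum, ← Finset.sum_add_distrib]
    rfl
  rw [e, s2, s1, s3]
  unfold meanSlope
  field_simp
  ring

/-- The energy of the periodic configuration over a period. -/
lemma sum_bondEnergy_periodic (hl : 0 ≤ l) (m : ℕ) :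
    ∑ k ∈ Finset.range (m + 1), S.bondEnergy (S.periodicStress l (m + 1) k)
        (S.periodicStress l (m + 1) (k + 1)) (S.periodicStress l (m + 1) (k + 2))
      = l * ∑ k ∈ Finset.range (m + 1), S.periodicSlope l (m + 1) k
        - S.prob.α * l ^ 2 / 4 * (m + 1) + S.prob.opt l (m + 1)
        + S.f (S.periodicSlope l (m + 1) m) := by
  set n := m + 1 with hn
  set p := S.periodicStress l n with hp
  set t := S.periodicSlope l n with ht
  set q := S.prob.profile l n with hq
  have q0 : q 0 = 0 := FieldProblem.profile_zero hl _
  have qn : q n = 0 := FieldProblem.profile_of_le hl le_rfl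
  have hpq : ∀ k ≤ n, p k = l / 2 - q k := fun k hk => periodicStress_of_le hl hk
  have hloc : ∀ k ∈ Finset.range n, S.bondEnergy (p k) (p (k + 1)) (p (k + 2))
      = l * t k - p (k + 1) * t k - S.prob.ψ (2 * q (k + 1)) + (if m = k then S.f (t m) else 0) := by
    intro k hk
    have hk := Finset.mem_range.1 hk
    have e : S.bondEnergy (p k) (p (k + 1)) (p (k + 2)) = S.f (t k) + p (k + 1) * t k := rfl
    rw [e]
    split_ifs with h
    · subst h
      rw [hpq _ le_rfl, qn, mul_zero, S.prob.ψ_zero]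
      ring
    · rw [(periodicSlope_intact hl (show k + 1 < n by omega)).2, hpq (k + 1) (by omega)]
      ring
  rw [Finset.sum_congr rfl hloc, Finset.sum_add_distrib, Finset.sum_sub_distrib,
    Finset.sum_sub_distrib, ← Finset.mul_sum, Finset.sum_ite_eq,
    if_pos (Finset.mem_range.2 (by omega))]
  -- Summation by parts, with end terms cancelling by periodicity.
  have hpt : ∑ k ∈ Finset.range n, p (k + 1) * t k
      = S.prob.α * ∑ k ∈ Finset.range n, p (k + 1) ^ 2
        + S.prob.β * ∑ k ∈ Finset.range n, (p (k + 1) - p k) ^ 2 := by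
    have htel := Finset.sum_range_sub (fun k => p k ^ 2 - p k * p (k + 1)) n
    have hper : ∀ j, p (n + j) = p j := fun j => by
      rw [add_comm]; exact periodicStress_add n j
    rw [show p n = p 0 from hper 0, show p (n + 1) = p 1 from hper 1, sub_self] at htel
    have : ∑ k ∈ Finset.range n, p (k + 1) * t k
        = S.prob.α * ∑ k ∈ Finset.range n, p (k + 1) ^ 2
          + S.prob.β * (∑ k ∈ Finset.range n, (p (k + 1) - p k) ^ 2
            + ∑ k ∈ Finset.range n, ((p (k + 1) ^ 2 - p (k + 1) * p (k + 1 + 1))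
              - (p k ^ 2 - p k * p (k + 1)))) := by
      rw [Finset.mul_sum, ← Finset.sum_add_distrib, Finset.mul_sum, ← Finset.sum_add_distrib]
      refine Finset.sum_congr rfl fun k _ => ?_
      change p (k + 1) * (S.prob.α * p (k + 1) + S.prob.β * (2 * p (k + 1) - p k - p (k + 1 + 1)))
        = _
      ring
    rw [this, htel]
    ring
  have hψ := sum_range_succ_eq_of_periodic (φ := fun k => S.prob.ψ (2 * q k)) (n := n)
    (by rw [q0, qn])
  have hp2 := sum_range_succ_eq_of_periodic (φ := fun k => p k ^ 2) (n := n)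
    (by rw [hpq n le_rfl, hpq 0 (Nat.zero_le _), q0, qn])
  beta_reduce at hψ hp2
  have hopt : S.prob.opt l n
      = S.prob.α * l ^ 2 / 4 * n - S.prob.α * ∑ k ∈ Finset.range n, p k ^ 2
        - ∑ k ∈ Finset.range n, S.prob.ψ (2 * q k)
        - S.prob.β * ∑ k ∈ Finset.range n, (p (k + 1) - p k) ^ 2 := by
    have : S.prob.α * l ^ 2 / 4 * n = ∑ k ∈ Finset.range n, S.prob.α * l ^ 2 / 4 := by
      rw [Finset.sum_const, Finset.card_range, nsmul_eq_mul]; ring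
    rw [this, Finset.mul_sum, Finset.mul_sum, ← Finset.sum_sub_distrib, ← Finset.sum_sub_distrib,
      ← Finset.sum_sub_distrib]
    unfold FieldProblem.opt FieldProblem.energy FieldProblem.density
    refine Finset.sum_congr rfl fun k hk => ?_
    have hk := Finset.mem_range.1 hk
    rw [hpq k (by omega), hpq (k + 1) (by omega)]
    ring
  have hcast : (n : ℝ) = m + 1 := by rw [hn]; push_cast; ring
  rw [hcast] at hopt
  rw [hpt, hψ, hp2]
  linarith

variable (S) in
-- The term `f` at the last bond is not replaced by `c₀`, since the slope there is not known to
-- reach `zs` for a general load.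
lemma attainable_meanSlope (hl : 0 ≤ l) (m : ℕ) :
    S.Attainable (S.meanSlope l (m + 1))
      (l * S.meanSlope l (m + 1) - S.prob.α * l ^ 2 / 4
        + (S.prob.opt l (m + 1) + S.f (S.periodicSlope l (m + 1) m)) / (m + 1)) := by
  have h := S.attainable_periodic (Nat.succ_pos m) (abs_periodicStress_le (S := S) hl (m + 1))
    (periodicStress_add (m + 1))
  rw [sum_bondEnergy_periodic hl] at h
  have e := sum_periodicSlope (S := S) hl (Nat.succ_pos m)
  rw [Nat.succ_eq_add_one] at e h
  have e' : (∑ k ∈ Finset.range (m + 1), stressSlope S.ρ (S.periodicStress l (m + 1) k)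
      (S.periodicStress l (m + 1) (k + 1)) (S.periodicStress l (m + 1) (k + 2)))
      = ∑ k ∈ Finset.range (m + 1), S.periodicSlope l (m + 1) k := rfl
  rw [e', e] at h
  convert h using 1
  rw [← e]
  push_cast
  field_simp
  ring

lemma f_le_c₀ (S : Setting) {x : ℝ} (hx : 0 ≤ x) : S.f x ≤ S.c₀ := by
  rcases lt_or_ge x S.zs with h | h
  · rw [S.f_of_le h.le]
    exact (ft_strictMono S.conv S.zero S.nonneg hx h).le
  · rw [S.f_of_ge h]

lemma f_lt_c₀ (S : Setting) {x : ℝ} (hx : 0 ≤ x) (h : x < S.zs) : S.f x < S.c₀ := by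
  rw [S.f_of_le h.le]
  exact ft_strictMono S.conv S.zero S.nonneg hx h

end Setting

namespace Setting

variable {S : Setting} {z l : ℝ}

/-! ### The unconstrained relaxation -/

variable (S) in
/-- The least mean energy attainable with mean slope `z`. -/
def U (z : ℝ) : ℝ := sInf {E | S.Attainable z E}

variable (S) in
lemma bddBelow_attainable (z : ℝ) : BddBelow {E | S.Attainable z E} :=
  ⟨0, fun _ h => h.nonneg⟩

variable (S) in
lemma nonempty_attainable (z : ℝ) : {E | S.Attainable z E}.Nonempty :=
  ⟨_, S.attainable_const z⟩

lemma Attainable.U_le {E : ℝ} (h : S.Attainable z E) : S.U z ≤ E :=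
  csInf_le (S.bddBelow_attainable z) h

variable (S) in
lemma U_nonneg (z : ℝ) : 0 ≤ S.U z :=
  le_csInf (S.nonempty_attainable z) fun _ h => h.nonneg

variable (S) in
lemma exists_attainable_lt {ε : ℝ} (hε : 0 < ε) (z : ℝ) :
    ∃ E < S.U z + ε, S.Attainable z E := by
  obtain ⟨E, hE, h⟩ := exists_lt_of_csInf_lt (S.nonempty_attainable z)
    (lt_add_of_pos_right (S.U z) hε)
  exact ⟨E, h, hE⟩

variable (S) in
lemma convexOn_U : ConvexOn ℝ Set.univ S.U := by
  refine ⟨convex_univ, fun x _ y _ a b ha hb hab => ?_⟩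
  refine le_of_forall_pos_le_add fun ε hε => ?_
  obtain ⟨E₁, hE₁, h₁⟩ := S.exists_attainable_lt hε x
  obtain ⟨E₂, hE₂, h₂⟩ := S.exists_attainable_lt hε y
  have h := (h₁.convex h₂ ha hb hab).U_le
  simp only [smul_eq_mul]
  have e : ε = a * ε + b * ε := by rw [← add_mul, hab, one_mul]
  nlinarith

/-- Lower bounds of the minimal energies bound the attainable energies. -/
lemma Attainable.le_of_lower_bound {E v C : ℝ} (h : S.Attainable z E)
    (hv : ∀ N : ℕ, 1 ≤ N → ∀ u ∈ admissible N z, N * v - C ≤ S.F N u) : v ≤ E := by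
  obtain ⟨C', hC'⟩ := h.exists_le
  refine le_of_forall_nat_mul (C := C + C') fun N hN => ?_
  obtain ⟨u, hu, hF⟩ := hC' N hN
  have := hv N hN u hu
  linarith

lemma le_U_of_lower_bound {v C : ℝ}
    (hv : ∀ N : ℕ, 1 ≤ N → ∀ u ∈ admissible N z, N * v - C ≤ S.F N u) : v ≤ S.U z :=
  le_csInf (S.nonempty_attainable z) fun _ h => h.le_of_lower_bound hv

variable (S) in
/-- Multipliers at positive mean slopes. -/
lemma exists_multiplier (hz : 0 < z) :
    ∃ l : ℝ, 0 ≤ l ∧ ∀ ℓ : ℕ, 1 ≤ ℓ →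
      (S.U z - l * z + S.prob.α * l ^ 2 / 4) * ℓ ≤ S.c₀ + S.prob.opt l ℓ := by
  obtain ⟨l, hl⟩ := exists_subgradient S.convexOn_U z
  have h0 : S.U 0 ≤ 0 := by
    have h := (S.attainable_const 0).U_le
    rw [S.f_of_le S.zs_pos.le, S.zero] at h
    simpa using h
  have hl0 : 0 ≤ l := by
    have h1 := hl 0
    have h2 := S.U_nonneg z
    have : 0 ≤ z * l := by linarith
    exact nonneg_of_mul_nonneg_right this hz
  refine ⟨l, hl0, fun ℓ hℓ => ?_⟩
  obtain ⟨m, rfl⟩ : ∃ m, ℓ = m + 1 := ⟨ℓ - 1, by omega⟩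
  -- In the subgradient inequality at this mean slope the terms linear in it cancel, leaving a bound
  -- for the block energy alone.
  have h1 := (S.attainable_meanSlope hl0 m).U_le
  have h2 := hl (S.meanSlope l (m + 1))
  have h3 := S.f_le_c₀ (periodicSlope_broken_nonneg (S := S) hl0 (dvd_refl (m + 1)))
  have hm : (0 : ℝ) < m + 1 := by positivity
  have h4 : S.U z - l * z + S.prob.α * l ^ 2 / 4
      ≤ (S.prob.opt l (m + 1) + S.f (S.periodicSlope l (m + 1) m)) / (m + 1) := by linarith
  rw [le_div_iff₀ hm] at h4
  push_cast
  linarith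

/-- Lower bound of the minimal energies from a linear minorant of the block energies. -/
lemma exists_lower_bound_of_linear (hl : 0 ≤ l) {e : ℝ}
    (he : ∀ ℓ : ℕ, 1 ≤ ℓ → e * ℓ ≤ S.c₀ + S.prob.opt l ℓ) (z : ℝ) :
    ∃ C : ℝ, ∀ N : ℕ, 1 ≤ N → ∀ u ∈ admissible N z,
      N * (l * z - S.prob.α * l ^ 2 / 4 + e) - C ≤ S.F N u := by
  obtain ⟨C, hC⟩ := S.F_lower_bound hl
  refine ⟨C + S.c₀ - e, fun N _ u hu => ?_⟩
  obtain ⟨Br, hBr⟩ := S.exists_isBrokenSet N u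
  have h := hC (-S.c₀) e (fun ℓ hℓ => by linarith [he ℓ hℓ]) N u Br hBr
  rw [hu.1, hu.2] at h
  linarith

variable (S) in
lemma exists_lower_bound_U (z : ℝ) :
    ∃ C : ℝ, ∀ N : ℕ, 1 ≤ N → ∀ u ∈ admissible N z, N * S.U z - C ≤ S.F N u := by
  rcases le_or_gt z 0 with hz | hz
  · obtain ⟨C, hC⟩ := S.F_lower_bound_of_nonpos hz
    refine ⟨C, fun N hN u hu => ?_⟩
    obtain ⟨Br, hBr⟩ := S.exists_isBrokenSet N u
    have h1 := hC N u Br hu.1 hu.2 hBr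
    have h2 := (S.attainable_const z).U_le
    rw [S.f_of_le (hz.trans S.zs_pos.le)] at h2
    have h3 := mul_le_mul_of_nonneg_left h2 (Nat.cast_nonneg (α := ℝ) N)
    have h4 : 0 ≤ S.c₀ * Br.card := mul_nonneg S.c₀_pos.le (Nat.cast_nonneg _)
    linarith
  · obtain ⟨l, hl, he⟩ := S.exists_multiplier hz
    obtain ⟨C, hC⟩ := exists_lower_bound_of_linear hl he z
    refine ⟨C, fun N hN u hu => ?_⟩
    have := hC N hN u hu
    linarith

variable (S) in
/-- The limit of the normalized minimum values. -/
theorem tendsto_meanMin (z : ℝ) :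
    Tendsto (fun N : ℕ => meanMin S.f (expKernel S.σ) N z) atTop (𝓝 (S.U z : EReal)) := by
  obtain ⟨C, hC⟩ := S.exists_lower_bound_U z
  have hdiv : ∀ a C : ℝ, Tendsto (fun N : ℕ => a + C / (N : ℝ)) atTop (𝓝 a) := fun a C => by
    simpa using tendsto_const_nhds.add (tendsto_const_div_atTop_nhds_zero_nat C)
  rw [tendsto_order]
  constructor
  · intro a ha
    obtain ⟨x, hax, hx⟩ := EReal.lt_iff_exists_real_btwn.1 ha
    have hx : x < S.U z := by exact_mod_cast hx
    filter_upwards [(hdiv (S.U z) (-C)).eventually (lt_mem_nhds hx), eventually_ge_atTop 1]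
      with N hN hN1
    refine hax.trans_le (le_iInf₂ fun u hu => ?_)
    have hpos : (0 : ℝ) < N := by exact_mod_cast hN1
    have h := hC N hN1 u hu
    refine EReal.coe_le_coe_iff.2 (hN.le.trans ?_)
    rw [le_div_iff₀ hpos, add_mul, div_mul_cancel₀ _ hpos.ne']
    change _ ≤ S.F N u
    linarith
  · intro b hb
    obtain ⟨x, hx, hxb⟩ := EReal.lt_iff_exists_real_btwn.1 hb
    have hx : S.U z < x := by exact_mod_cast hx
    obtain ⟨E, hE, hA⟩ := S.exists_attainable_lt (sub_pos.2 hx) z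
    obtain ⟨C', hC'⟩ := hA.exists_le
    have hE' : E < x := by linarith
    filter_upwards [(hdiv E C').eventually (gt_mem_nhds hE'), eventually_ge_atTop 1]
      with N hN hN1
    obtain ⟨u, hu, hF⟩ := hC' N hN1
    have hpos : (0 : ℝ) < N := by exact_mod_cast hN1
    refine lt_of_le_of_lt (iInf₂_le u hu) (lt_of_le_of_lt ?_ hxb)
    refine EReal.coe_le_coe_iff.2 (le_trans ?_ hN.le)
    rw [div_le_iff₀ hpos, add_mul, div_mul_cancel₀ _ hpos.ne']
    change S.F N u ≤ _
    linarith

variable (S) in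
lemma relaxation_eq (z : ℝ) : relaxation S.f (expKernel S.σ) z = (S.U z : EReal) :=
  (S.tendsto_meanMin z).liminf_eq

/-! ### The constrained relaxation -/

lemma coe_lt_ge {v : ℝ} {x : EReal} (h : ∀ w : ℝ, w < v → (w : EReal) ≤ x) : (v : EReal) ≤ x :=
  EReal.ge_of_forall_gt_iff_ge.1 fun w hw => h w (by exact_mod_cast hw)

lemma le_constrainedRelaxationRat {q : ℚ} {v C : ℝ}
    (h : ∀ N : ℕ, 1 ≤ N → (∃ n : ℕ, q * (N : ℚ) = n) →
      ∀ u ∈ admissible N z ∩ phaseConstraint S.zs N q, N * v - C ≤ S.F N u) :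
    (v : EReal) ≤ constrainedRelaxationRat S.f (expKernel S.σ) S.zs q z := by
  refine coe_lt_ge fun w hw => le_liminf_of_le (by isBoundedDefault) ?_
  have hlim : Tendsto (fun N : ℕ => v + (-C) / (N : ℝ)) atTop (𝓝 v) := by
    simpa using tendsto_const_nhds.add (tendsto_const_div_atTop_nhds_zero_nat (-C))
  rw [eventually_inf_principal]
  filter_upwards [hlim.eventually (lt_mem_nhds hw), eventually_ge_atTop 1] with N hN hN1 hq
  refine le_iInf₂ fun u hu => EReal.coe_le_coe_iff.2 (hN.le.trans ?_)
  have hpos : (0 : ℝ) < N := by exact_mod_cast hN1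
  have := h N hN1 hq u hu
  rw [le_div_iff₀ hpos, add_mul, div_mul_cancel₀ _ hpos.ne']
  change _ ≤ S.F N u
  linarith

lemma constrainedRelaxationRat_le {q : ℚ} {v C : ℝ} {n : ℕ} (hn : 1 ≤ n)
    (hq : ∀ j : ℕ, ∃ k : ℕ, q * ((n * j : ℕ) : ℚ) = k)
    (h : ∀ j : ℕ, 1 ≤ j →
      ∃ u ∈ admissible (n * j) z ∩ phaseConstraint S.zs (n * j) q,
        S.F (n * j) u ≤ (n * j : ℕ) * v + C) :
    constrainedRelaxationRat S.f (expKernel S.σ) S.zs q z ≤ (v : EReal) := by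
  refine EReal.le_of_forall_lt_iff_le.1 fun w hw => ?_
  have hw : v < w := by exact_mod_cast hw
  have hlim : Tendsto (fun N : ℕ => v + C / (N : ℝ)) atTop (𝓝 v) := by
    simpa using tendsto_const_nhds.add (tendsto_const_div_atTop_nhds_zero_nat C)
  obtain ⟨N₀, hN₀⟩ := eventually_atTop.1 (hlim.eventually (gt_mem_nhds hw))
  refine liminf_le_of_frequently_le' ?_
  rw [frequently_inf_principal, frequently_atTop]
  intro a
  set j := max (max a N₀) 1 with hj
  have hj1 : 1 ≤ j := le_max_right _ _
  have hjn : j ≤ n * j := Nat.le_mul_of_pos_left _ hn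
  have haj : max a N₀ ≤ j := le_max_left _ _
  refine ⟨n * j, ((le_max_left _ _).trans haj).trans hjn, hq j, ?_⟩
  obtain ⟨u, hu, hF⟩ := h j hj1
  refine (iInf₂_le u hu).trans (EReal.coe_le_coe_iff.2
    (le_trans ?_ (hN₀ (n * j) (((le_max_right _ _).trans haj).trans hjn)).le))
  have hpos : (0 : ℝ) < (n * j : ℕ) := by exact_mod_cast hj1.trans hjn
  rw [div_le_iff₀ hpos, add_mul, div_mul_cancel₀ _ hpos.ne']
  change S.F (n * j) u ≤ _
  linarith

lemma constrainedRelaxation_rat (q : ℚ) (f : ℝ → ℝ) (m : ℕ → ℝ) (zs z : ℝ) :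
    constrainedRelaxation f m zs q z = constrainedRelaxationRat f m zs q z := by
  have h : ∃ q' : ℚ, (q' : ℝ) = q := ⟨q, rfl⟩
  unfold constrainedRelaxation
  rw [dif_pos h]
  congr 1
  exact_mod_cast h.choose_spec

/-- Lower bounds extend by continuity from rational to real volume fractions. -/
lemma le_constrainedRelaxation {θ : ℝ} (h0 : 0 < θ) (h1 : θ < 1) {V : ℝ → ℝ} (hV : Continuous V)
    (h : ∀ q : ℚ, 0 < q → q < 1 →
      (V q : EReal) ≤ constrainedRelaxationRat S.f (expKernel S.σ) S.zs q z) :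
    (V θ : EReal) ≤ constrainedRelaxation S.f (expKernel S.σ) S.zs θ z := by
  by_cases hr : ∃ q : ℚ, (q : ℝ) = θ
  · obtain ⟨q, rfl⟩ := hr
    rw [constrainedRelaxation_rat]
    exact h q (by exact_mod_cast h0) (by exact_mod_cast h1)
  · unfold constrainedRelaxation
    rw [dif_neg hr]
    refine coe_lt_ge fun w hw => le_liminf_of_le (by isBoundedDefault) ?_
    have hev : ∀ᶠ x in 𝓝 θ, w < V x ∧ 0 < x ∧ x < 1 :=
      (hV.continuousAt.eventually (lt_mem_nhds hw)).and ((lt_mem_nhds h0).and (gt_mem_nhds h1))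
    filter_upwards [tendsto_comap.eventually hev] with q hq
    refine le_trans (EReal.coe_le_coe_iff.2 hq.1.le) (h q ?_ ?_)
    · exact_mod_cast hq.2.1
    · exact_mod_cast hq.2.2

/-- Constrained test functions have broken sets of the prescribed size. -/
lemma exists_isBrokenSet_card {N : ℕ} {q : ℚ} (hN : ∃ n : ℕ, q * (N : ℚ) = n) {u : ℕ → ℝ}
    (hu : u ∈ phaseConstraint S.zs N q) :
    ∃ Br, S.IsBrokenSet N u Br ∧ (Br.card : ℝ) = q * N := by
  obtain ⟨n, hn⟩ := hN
  have hn' : (q : ℝ) * N = n := by exact_mod_cast hn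
  obtain ⟨h1, h2⟩ := hu
  rw [hn'] at h1
  rw [sub_mul, hn', one_mul] at h2
  have hcard := Finset.card_filter_add_card_filter_not (s := Finset.range N)
    (fun i => u (i + 1) - u i < S.zs)
  simp only [not_lt, Finset.card_range] at hcard
  have hcard' : (((Finset.range N).filter fun i => u (i + 1) - u i < S.zs).card : ℝ)
      + ((Finset.range N).filter fun i => S.zs ≤ u (i + 1) - u i).card = N := by
    exact_mod_cast hcard
  -- Bonds with slope exactly `zs` may be counted in either phase, which allows the exact
  -- cardinality.
  obtain ⟨Br, hsub, hsup, hc⟩ := Finset.exists_subsuperset_card_eq (n := n)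
    (s := (Finset.range N).filter fun i => S.zs < u (i + 1) - u i)
    (t := (Finset.range N).filter fun i => S.zs ≤ u (i + 1) - u i)
    (fun i hi => by
      rw [Finset.mem_filter] at hi ⊢
      exact ⟨hi.1, hi.2.le⟩)
    (by exact_mod_cast h1)
    (by
      have : (n : ℝ) ≤ ((Finset.range N).filter fun i => S.zs ≤ u (i + 1) - u i).card := by
        linarith
      exact_mod_cast this)
  refine ⟨Br, ⟨hsup.trans (Finset.filter_subset _ _), fun k hk => ?_, fun k hk hkB => ?_⟩, ?_⟩
  · exact (Finset.mem_filter.1 (hsup hk)).2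
  · by_contra hlt
    exact hkB (hsub (Finset.mem_filter.2 ⟨Finset.mem_range.2 hk, not_le.1 hlt⟩))
  · rw [hc, hn']

lemma U_le_constrainedRelaxationRat (q : ℚ) (z : ℝ) :
    (S.U z : EReal) ≤ constrainedRelaxationRat S.f (expKernel S.σ) S.zs q z := by
  obtain ⟨C, hC⟩ := S.exists_lower_bound_U z
  exact le_constrainedRelaxationRat fun N hN _ u hu => hC N hN u hu.1

lemma constrained_lower_of_nonpos (hz : z ≤ 0) (q : ℚ) :
    ((S.ft z + z ^ 2 / S.prob.α + q * S.c₀ : ℝ) : EReal)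
      ≤ constrainedRelaxationRat S.f (expKernel S.σ) S.zs q z := by
  obtain ⟨C, hC⟩ := S.F_lower_bound_of_nonpos hz
  refine le_constrainedRelaxationRat (C := C) fun N _ hq u hu => ?_
  obtain ⟨Br, hBr, hc⟩ := exists_isBrokenSet_card hq hu.2
  have h := hC N u Br hu.1.1 hu.1.2 hBr
  rw [hc] at h
  linarith

/-- The affine minorant is the secant of `opt l` through `n` and `n + 1`, whose intercept is minus
the threshold. The broken bonds are then priced at `c₀ - threshold` each. -/
lemma constrained_lower (hl : 0 ≤ l) (n : ℕ) (q : ℚ) :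
    ((l * z - S.prob.α * l ^ 2 / 4 + (S.prob.opt l (n + 1) - S.prob.opt l n)
        + q * (S.c₀ - S.prob.threshold l n) : ℝ) : EReal)
      ≤ constrainedRelaxationRat S.f (expKernel S.σ) S.zs q z := by
  obtain ⟨C, hC⟩ := S.F_lower_bound hl
  refine le_constrainedRelaxationRat (C := C + S.prob.threshold l n
    - (S.prob.opt l (n + 1) - S.prob.opt l n)) fun N _ hq u hu => ?_
  obtain ⟨Br, hBr, hc⟩ := exists_isBrokenSet_card hq hu.2
  have h := hC (-S.prob.threshold l n) (S.prob.opt l (n + 1) - S.prob.opt l n) (fun ℓ _ => by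
    have := FieldProblem.opt_ge_secant (D := S.prob) hl n ℓ
    unfold FieldProblem.threshold
    linarith) N u Br hBr
  rw [hu.1.1, hu.1.2, hc] at h
  linarith

variable (S) in
lemma isLockingState_iff (θ : ℝ) :
    IsLockingState S.f (expKernel S.σ) S.zs θ ↔ θ ∈ Set.Icc (0 : ℝ) 1 ∧
      ∃ α β : ℝ, α < β ∧ ∀ z ∈ Set.Ioo α β,
        constrainedRelaxation S.f (expKernel S.σ) S.zs θ z = (S.U z : EReal) := by
  unfold IsLockingState
  refine and_congr_right fun _ => exists_congr fun α => exists_congr fun β =>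
    and_congr_right fun _ => forall_congr' fun z => imp_congr_right fun _ => ?_
  change constrainedTransform _ _ _ _ _ = transform _ _ _ ↔ _
  unfold constrainedTransform transform
  rw [relaxation_eq]
  constructor
  · intro h
    have h' := congrArg (· + ((kernelCoeff (expKernel S.σ) * z ^ 2 : ℝ) : EReal)) h
    simpa only [EReal.sub_add_cancel] using h'
  · intro h
    rw [h]

/-! ### Locking states -/

variable (S) in
/-- The unbroken state locks. -/
lemma isLockingState_zero : IsLockingState S.f (expKernel S.σ) S.zs 0 := by
  rw [isLockingState_iff]
  refine ⟨⟨le_rfl, zero_le_one⟩, -1, 0, by norm_num, fun z hz => ?_⟩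
  have hz0 : z < S.zs := hz.2.trans S.zs_pos
  have hα := S.prob.α_pos
  rw [show (0 : ℝ) = ((0 : ℚ) : ℝ) by norm_num, constrainedRelaxation_rat]
  refine le_antisymm ?_ (U_le_constrainedRelaxationRat 0 z)
  have hU : S.ft z + z ^ 2 / S.prob.α ≤ S.U z := by
    obtain ⟨C, hC⟩ := S.F_lower_bound_of_nonpos hz.2.le
    refine le_U_of_lower_bound (C := C) fun N _ u hu => ?_
    obtain ⟨Br, hBr⟩ := S.exists_isBrokenSet N u
    have h := hC N u Br hu.1 hu.2 hBr
    have : 0 ≤ S.c₀ * Br.card := mul_nonneg S.c₀_pos.le (Nat.cast_nonneg _)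
    linarith
  refine le_trans ?_ (EReal.coe_le_coe_iff.2 hU)
  obtain ⟨K, hK, hF⟩ := S.exists_F_le
  have hT : stressSlope S.ρ (z / S.prob.α) (z / S.prob.α) (z / S.prob.α) = z := by
    unfold stressSlope
    change S.prob.α * (z / S.prob.α) + _ = _
    field_simp
    ring
  refine constrainedRelaxationRat_le (n := 1) (C := K * |z / S.prob.α| ^ 2) le_rfl
    (fun j => ⟨0, by simp⟩) fun j _ => ?_
  set p : ℕ → ℝ := fun _ => z / S.prob.α with hp
  have hslope : ∀ k, (dispOf S.ρ p (k + 1) - dispOf S.ρ p 0) - (dispOf S.ρ p k - dispOf S.ρ p 0)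
      = z := fun k => by
    rw [sub_sub_sub_cancel_right, dispOf_succ_sub]; exact hT
  refine ⟨fun k => dispOf S.ρ p k - dispOf S.ρ p 0, ⟨⟨sub_self _, ?_⟩, ?_, ?_⟩, ?_⟩
  · beta_reduce
    rw [S.dispOf_sub_zero]
    simp [hp, hT]
  · simp only [hslope, hz0.not_gt]
    simp
  · simp only [hslope, hz0]
    simp
  · refine (hF |z / S.prob.α| p (fun _ => le_rfl) _).trans (le_of_eq ?_)
    simp only [bondEnergy, hp, hT, Finset.sum_const, Finset.card_range, nsmul_eq_mul]
    rw [S.f_of_le hz0.le]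
    ring

/-- Optimality of the period `n + 1` for loads between consecutive thresholds. -/
lemma linear_minorant_of_threshold (hl : 0 ≤ l) {n : ℕ}
    (h1 : S.prob.threshold l n < S.c₀) (h2 : S.c₀ < S.prob.threshold l (n + 1)) (ℓ : ℕ) :
    (S.c₀ + S.prob.opt l (n + 1)) / (n + 1) * ℓ ≤ S.c₀ + S.prob.opt l ℓ := by
  have hn : (0 : ℝ) < n + 1 := by positivity
  obtain ⟨e, he⟩ : ∃ e, e = (S.c₀ + S.prob.opt l (n + 1)) / (n + 1) := ⟨_, rfl⟩
  have he' : e * (n + 1) = S.c₀ + S.prob.opt l (n + 1) := by rw [he]; field_simp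
  rw [← he]
  unfold FieldProblem.threshold at h1 h2
  push_cast at h2
  have s1 := FieldProblem.opt_ge_secant (D := S.prob) hl n ℓ
  have s2 := FieldProblem.opt_ge_secant (D := S.prob) hl (n + 1) ℓ
  push_cast at s2
  set d₁ := S.prob.opt l (n + 1) - S.prob.opt l n with hd₁
  set d₂ := S.prob.opt l (n + 1 + 1) - S.prob.opt l (n + 1) with hd₂
  -- The two threshold inequalities say that `e` lies between the secant slopes before and after `n
  -- + 1`.
  have b1 : d₁ ≤ e := by
    have : 0 ≤ (n + 1) * (e - d₁) := by rw [hd₁]; linarith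
    linarith [nonneg_of_mul_nonneg_right this hn]
  have b2 : e ≤ d₂ := by
    have : 0 ≤ (n + 1) * (d₂ - e) := by rw [hd₂]; linarith
    linarith [nonneg_of_mul_nonneg_right this hn]
  rcases le_or_gt (n + 1) ℓ with h | h
  · have h' : ((n : ℝ) + 1) ≤ ℓ := by exact_mod_cast h
    nlinarith
  · have h' : (ℓ : ℝ) ≤ n + 1 := by exact_mod_cast h.le
    nlinarith

/-- At loads between consecutive thresholds the periodic configuration is optimal. -/
lemma constrained_eq_of_threshold (hl : 0 ≤ l) {n : ℕ}
    (h1 : S.prob.threshold l n < S.c₀) (h2 : S.c₀ < S.prob.threshold l (n + 1)) :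
    constrainedRelaxationRat S.f (expKernel S.σ) S.zs (1 / ((n : ℚ) + 1)) (S.meanSlope l (n + 1))
      = (S.U (S.meanSlope l (n + 1)) : EReal) := by
  have hn : (0 : ℝ) < n + 1 := by positivity
  set z := S.meanSlope l (n + 1) with hz
  set e := (S.c₀ + S.prob.opt l (n + 1)) / (n + 1) with he
  obtain ⟨C, hC⟩ := exists_lower_bound_of_linear hl
    (fun ℓ _ => linear_minorant_of_threshold hl h1 h2 ℓ) z
  rw [← he] at hC
  have hvU := le_U_of_lower_bound hC
  set t := S.periodicSlope l (n + 1) with ht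
  have hatt := S.attainable_meanSlope hl n
  have htn : 0 ≤ t n := periodicSlope_broken_nonneg hl (dvd_refl (n + 1))
  -- Were the slope below `zs`, this bond would cost less than `c₀` and the configuration would beat
  -- the lower bound.
  have htz : S.zs ≤ t n := by
    by_contra hlt
    have hf := S.f_lt_c₀ htn (not_le.1 hlt)
    have h3 := hatt.le_of_lower_bound hC
    have h4 : e ≤ (S.prob.opt l (n + 1) + S.f (t n)) / (n + 1) := by linarith
    rw [he, div_le_div_iff_of_pos_right hn] at h4
    linarith
  refine le_antisymm ?_ (U_le_constrainedRelaxationRat _ z)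
  refine le_trans ?_ (EReal.coe_le_coe_iff.2 hvU)
  obtain ⟨K, hK, hF⟩ := S.exists_F_le
  set p := S.periodicStress l (n + 1) with hp
  have hintact : ∀ k, ¬ (n + 1 ∣ k + 1) → t k ≤ S.zs := by
    intro k hk
    have hlt := Nat.mod_lt k (Nat.succ_pos n)
    have hne : k % (n + 1) + 1 < n + 1 := by
      have hlt' : k % (n + 1) + 1 ≤ n + 1 := hlt
      rcases hlt'.lt_or_eq with h | h
      · exact h
      · refine absurd ⟨k / (n + 1) + 1, ?_⟩ hk
        have := Nat.div_add_mod k (n + 1)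
        rw [mul_add, mul_one]
        omega
    have h := (periodicSlope_intact (S := S) hl hne).1.2
    rwa [periodicSlope_mod] at h
  have hbroken : ∀ k, n + 1 ∣ k + 1 → S.zs ≤ t k := by
    intro k hk
    have hmod : k % (n + 1) = n := by
      obtain ⟨c, hc⟩ := hk
      obtain ⟨d, rfl⟩ : ∃ d, c = d + 1 := ⟨c - 1, by
        rcases c with _ | c
        · omega
        · rfl⟩
      rw [show k = n + (n + 1) * d by rw [mul_add] at hc; omega, Nat.add_mul_mod_self_left]
      exact Nat.mod_eq_of_lt (Nat.lt_succ_self n)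
    have : t k = t n := by rw [ht, ← periodicSlope_mod (n + 1) k, hmod]
    rw [this]
    exact htz
  refine constrainedRelaxationRat_le (n := n + 1) (C := K * (l / 2) ^ 2) (by omega)
    (fun j => ⟨j, by push_cast; field_simp⟩) fun j _ => ?_
  have hslope : ∀ k, (dispOf S.ρ p (k + 1) - dispOf S.ρ p 0) - (dispOf S.ρ p k - dispOf S.ρ p 0)
      = t k := fun k => by
    rw [sub_sub_sub_cancel_right, dispOf_succ_sub]; rfl
  have hper : ∀ φ : ℕ → ℝ, (∀ k, φ (k + (n + 1)) = φ k) → ∀ j : ℕ,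
      ∑ k ∈ Finset.range ((n + 1) * j), φ k = j * ∑ k ∈ Finset.range (n + 1), φ k := by
    intro φ hφ j
    induction j with
    | zero => simp
    | succ j ih =>
      rw [mul_add, mul_one, Finset.sum_range_add, ih]
      have : ∀ k ∈ Finset.range (n + 1), φ ((n + 1) * j + k) = φ k := by
        intro k _
        rw [add_comm, mul_comm]
        exact (Function.Periodic.nat_mul (f := φ) (c := n + 1) hφ j) k
      rw [Finset.sum_congr rfl this]
      push_cast
      ring
  have hmult : ((Finset.range ((n + 1) * j)).filter fun k => n + 1 ∣ k + 1).card = j := by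
    rw [Nat.card_multiples, Nat.mul_div_cancel_left _ (Nat.succ_pos n)]
  have hmult' := Finset.card_filter_add_card_filter_not (s := Finset.range ((n + 1) * j))
    (fun k => n + 1 ∣ k + 1)
  rw [hmult, Finset.card_range] at hmult'
  refine ⟨fun k => dispOf S.ρ p k - dispOf S.ρ p 0, ⟨⟨sub_self _, ?_⟩, ?_, ?_⟩, ?_⟩
  · beta_reduce
    rw [S.dispOf_sub_zero]
    change ∑ k ∈ Finset.range ((n + 1) * j), t k = _
    rw [hper t (periodicSlope_add (n + 1)) j, hz, ← sum_periodicSlope hl (Nat.succ_pos n)]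
    push_cast
    field_simp
    rfl
  · simp only [hslope]
    have : ((Finset.range ((n + 1) * j)).filter fun k => S.zs < t k).card ≤ j := by
      refine (Finset.card_le_card
        (t := (Finset.range ((n + 1) * j)).filter fun k => n + 1 ∣ k + 1)
        fun k hk => ?_).trans hmult.le
      rw [Finset.mem_filter] at hk ⊢
      exact ⟨hk.1, by_contra fun hnd => absurd hk.2 (hintact k hnd).not_gt⟩
    have hj : (((1 / ((n : ℚ) + 1) : ℚ) : ℝ)) * (((n + 1) * j : ℕ) : ℝ) = j := by
      push_cast; field_simp
    rw [hj]
    exact_mod_cast this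
  · simp only [hslope]
    have : ((Finset.range ((n + 1) * j)).filter fun k => t k < S.zs).card
        ≤ ((Finset.range ((n + 1) * j)).filter fun k => ¬ (n + 1 ∣ k + 1)).card := by
      refine Finset.card_le_card fun k hk => ?_
      rw [Finset.mem_filter] at hk ⊢
      exact ⟨hk.1, fun hd => absurd hk.2 (hbroken k hd).not_gt⟩
    have hj : (1 - ((1 / ((n : ℚ) + 1) : ℚ) : ℝ)) * (((n + 1) * j : ℕ) : ℝ)
        = ((Finset.range ((n + 1) * j)).filter fun k => ¬ (n + 1 ∣ k + 1)).card := by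
      have h : (j : ℝ) + ((Finset.range ((n + 1) * j)).filter fun k => ¬ (n + 1 ∣ k + 1)).card
          = (((n + 1) * j : ℕ) : ℝ) := by exact_mod_cast hmult'
      have h' : (((1 / ((n : ℚ) + 1) : ℚ) : ℝ)) * (((n + 1) * j : ℕ) : ℝ) = j := by
        push_cast; field_simp
      rw [sub_mul, h']
      linarith
    rw [hj]
    exact_mod_cast this
  · refine (hF _ p (abs_periodicStress_le hl (n + 1)) _).trans ?_
    rw [hper (fun k => S.bondEnergy (p k) (p (k + 1)) (p (k + 2))) (fun k => by
        have hpp : ∀ k, p (k + (n + 1)) = p k := periodicStress_add (n + 1)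
        rw [show k + (n + 1) + 1 = k + 1 + (n + 1) by ring,
          show k + (n + 1) + 2 = k + 2 + (n + 1) by ring, hpp, hpp, hpp]) j,
      sum_bondEnergy_periodic hl]
    have hs : ∑ k ∈ Finset.range (n + 1), S.periodicSlope l (n + 1) k = (n + 1) * z := by
      rw [hz, ← sum_periodicSlope hl (Nat.succ_pos n)]
      push_cast
      field_simp
    have he' : e * (n + 1) = S.c₀ + S.prob.opt l (n + 1) := by rw [he]; field_simp
    change _ * (_ + S.f (t n)) + _ ≤ _
    rw [hs, S.f_of_ge htz]
    push_cast
    refine le_of_eq ?_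
    linear_combination (-(j : ℝ)) * he'

lemma continuousOn_meanSlope (n : ℕ) : ContinuousOn (fun l => S.meanSlope l n) (Set.Ici 0) := by
  have h : ContinuousOn (fun l => S.prob.total l n) (Set.Ici 0) := by
    refine (LipschitzOnWith.of_dist_le_mul (K := (n : NNReal)) fun x hx y hy => ?_).continuousOn
    rw [Real.dist_eq, Real.dist_eq]
    exact FieldProblem.abs_total_sub_le (Set.mem_Ici.1 hy) (Set.mem_Ici.1 hx) n
  unfold meanSlope
  fun_prop

lemma meanSlope_lt (hl : 0 ≤ l) {l' : ℝ} (hll : l < l') (m : ℕ) :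
    S.meanSlope l (m + 1) < S.meanSlope l' (m + 1) := by
  have h := (FieldProblem.total_sub_bounds (D := S.prob) hl hll.le m).2
  have hm : (0 : ℝ) < m + 1 := by positivity
  unfold meanSlope
  refine mul_lt_mul_of_pos_left ?_ S.prob.α_pos
  push_cast
  have e : ∀ x y : ℝ, x - y / (m + 1) = (x * (m + 1) - y) / (m + 1) := fun x y => by field_simp
  rw [e, e, div_lt_div_iff_of_pos_right hm]
  linarith

variable (S) in
lemma isLockingState_one_div (n : ℕ) :
    IsLockingState S.f (expKernel S.σ) S.zs (1 / ((n + 1 : ℕ) : ℝ)) := by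
  rw [isLockingState_iff]
  have hn : (0 : ℝ) ≤ n := Nat.cast_nonneg n
  refine ⟨⟨by positivity, ?_⟩, ?_⟩
  · push_cast
    rw [div_le_one (by positivity)]
    linarith
  obtain ⟨a, b, ha, hab, h⟩ := FieldProblem.exists_loads (D := S.prob) S.c₀_pos n
  set a' := (2 * a + b) / 3 with ha'
  set b' := (a + 2 * b) / 3 with hb'
  have hab' : a' < b' := by rw [ha', hb']; linarith
  have haa : a < a' := by rw [ha']; linarith
  have hbb : b' < b := by rw [hb']; linarith
  refine ⟨S.meanSlope a' (n + 1), S.meanSlope b' (n + 1),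
    meanSlope_lt (ha.trans haa).le hab' n, fun z hz => ?_⟩
  obtain ⟨l, hl, rfl⟩ := intermediate_value_Icc hab'.le
    ((continuousOn_meanSlope (S := S) (n + 1)).mono fun x hx =>
      Set.mem_Ici.2 ((ha.trans haa).le.trans hx.1)) ⟨hz.1.le, hz.2.le⟩
  obtain ⟨t1, t2⟩ := h l ⟨haa.trans_le hl.1, hl.2.trans_lt hbb⟩
  have hl0 : 0 ≤ l := ((ha.trans haa).trans_le hl.1).le
  rw [show 1 / ((n + 1 : ℕ) : ℝ) = ((1 / ((n : ℚ) + 1) : ℚ) : ℝ) by push_cast; ring,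
    constrainedRelaxation_rat]
  exact constrained_eq_of_threshold hl0 t1 t2

/-- At a positive mean slope where a volume fraction between `1 / (n + 2)` and `1 / (n + 1)` is
optimal, the load is the threshold load. -/
lemma threshold_eq_of_constrained_eq {θ : ℝ} {n : ℕ} (h1 : 0 < ((n : ℝ) + 2) * θ - 1)
    (h2 : 0 < 1 - ((n : ℝ) + 1) * θ) (hz : 0 < z)
    (hle : ∀ l : ℝ, 0 ≤ l → l * z - S.prob.α * l ^ 2 / 4
      + ((((n : ℝ) + 2) * θ - 1) * (S.c₀ + S.prob.opt l (n + 1))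
        + (1 - ((n : ℝ) + 1) * θ) * (S.c₀ + S.prob.opt l (n + 2))) ≤ S.U z) :
    ∃ l : ℝ, 0 < l ∧ S.prob.threshold l (n + 1) = S.c₀ ∧
      S.U z = l * z - S.prob.α * l ^ 2 / 4
        + ((((n : ℝ) + 2) * θ - 1) * (S.c₀ + S.prob.opt l (n + 1))
          + (1 - ((n : ℝ) + 1) * θ) * (S.c₀ + S.prob.opt l (n + 2))) := by
  obtain ⟨l, hl, he⟩ := S.exists_multiplier hz
  set e := S.U z - l * z + S.prob.α * l ^ 2 / 4 with hedef
  have e1 := he (n + 1) (by omega)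
  have e2 := he (n + 2) (by omega)
  have h3 := hle l hl
  push_cast at e1 e2
  set A := S.c₀ + S.prob.opt l (n + 1) with hA
  set B := S.c₀ + S.prob.opt l (n + 2) with hB
  -- `a` and `b` are the numbers per site of blocks of length `n + 1` and `n + 2` that fill the
  -- chain with `θ` broken bonds per site. Positive weights force equality for both lengths.
  set a := ((n : ℝ) + 2) * θ - 1 with ha
  set b := 1 - ((n : ℝ) + 1) * θ with hb
  have hab : a * (n + 1) + b * (n + 2) = 1 := by rw [ha, hb]; ring
  have h4 : a * (A - e * (n + 1)) + b * (B - e * (n + 2)) ≤ 0 := by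
    have : a * (A - e * (n + 1)) + b * (B - e * (n + 2)) = a * A + b * B - e := by
      linear_combination (-e) * hab
    rw [this, hedef]
    linarith
  have p1 : 0 ≤ a * (A - e * (n + 1)) := mul_nonneg h1.le (by linarith)
  have p2 : 0 ≤ b * (B - e * (n + 2)) := mul_nonneg h2.le (by linarith)
  have q1 : A = e * (n + 1) := by
    have : a * (A - e * (n + 1)) = 0 := by linarith
    rcases mul_eq_zero.1 this with h | h
    · exact absurd h h1.ne'
    · linarith
  have q2 : B = e * (n + 2) := by
    have : b * (B - e * (n + 2)) = 0 := by linarith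
    rcases mul_eq_zero.1 this with h | h
    · exact absurd h h2.ne'
    · linarith
  have hτ : S.prob.threshold l (n + 1) = S.c₀ := by
    unfold FieldProblem.threshold
    rw [show S.prob.opt l (n + 1 + 1) = B - S.c₀ by rw [hB]; ring,
      show S.prob.opt l (n + 1) = A - S.c₀ by rw [hA]; ring, q1, q2]
    push_cast
    ring
  refine ⟨l, lt_of_le_of_ne hl ?_, hτ, ?_⟩
  · rintro rfl
    have o : ∀ m, S.prob.opt 0 m = 0 := fun m => by
      refine le_antisymm ?_ (FieldProblem.opt_nonneg le_rfl m)
      simpa using FieldProblem.opt_le (D := S.prob) le_rfl m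
    unfold FieldProblem.threshold at hτ
    rw [o, o] at hτ
    have := S.c₀_pos
    simp at hτ
    linarith
  · rw [← hA, ← hB, q1, q2, hedef]
    linear_combination (-(S.U z - l * z + S.prob.α * l ^ 2 / 4)) * hab

lemma not_isLockingState_of_lt {θ : ℝ} {n : ℕ} (h1 : 0 < ((n : ℝ) + 2) * θ - 1)
    (h2 : 0 < 1 - ((n : ℝ) + 1) * θ) : ¬ IsLockingState S.f (expKernel S.σ) S.zs θ := by
  rw [isLockingState_iff]
  rintro ⟨-, α, β, hαβ, heq⟩
  have hn : (0 : ℝ) ≤ n := Nat.cast_nonneg n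
  have hθ0 : 0 < θ := by
    by_contra h
    nlinarith
  have hθ1 : θ < 1 := by nlinarith
  rcases lt_or_ge α 0 with hα | hα
  · obtain ⟨z, hz1, hz2⟩ := exists_between (show α < min β 0 from lt_min hαβ hα)
    have hz0 : z ≤ 0 := (hz2.trans_le (min_le_right _ _)).le
    have h := le_constrainedRelaxation (S := S) (z := z) hθ0 hθ1
      (V := fun q => S.ft z + z ^ 2 / S.prob.α + q * S.c₀) (by fun_prop)
      fun q _ _ => constrained_lower_of_nonpos hz0 q
    rw [heq z ⟨hz1, hz2.trans_le (min_le_left _ _)⟩, EReal.coe_le_coe_iff] at h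
    have hU := (S.attainable_const z).U_le
    rw [S.f_of_le (hz0.trans S.zs_pos.le)] at hU
    have := mul_pos hθ0 S.c₀_pos
    linarith
  · have hle : ∀ z ∈ Set.Ioo α β, ∀ l : ℝ, 0 ≤ l → l * z - S.prob.α * l ^ 2 / 4
      + ((((n : ℝ) + 2) * θ - 1) * (S.c₀ + S.prob.opt l (n + 1))
        + (1 - ((n : ℝ) + 1) * θ) * (S.c₀ + S.prob.opt l (n + 2))) ≤ S.U z := by
      intro z hz l hl
      have h := le_constrainedRelaxation (S := S) (z := z) hθ0 hθ1
        (V := fun q => l * z - S.prob.α * l ^ 2 / 4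
          + (S.prob.opt l (n + 1 + 1) - S.prob.opt l (n + 1))
          + q * (S.c₀ - S.prob.threshold l (n + 1))) (by fun_prop)
        fun q _ _ => constrained_lower hl (n + 1) q
      rw [heq z hz, EReal.coe_le_coe_iff] at h
      refine le_trans (le_of_eq ?_) h
      unfold FieldProblem.threshold
      push_cast
      ring
    set x := (2 * α + β) / 3 with hx
    set y := (α + 2 * β) / 3 with hy
    have hxy : x < y := by rw [hx, hy]; linarith
    have hxm : x ∈ Set.Ioo α β := ⟨by rw [hx]; linarith, by rw [hx]; linarith⟩
    have hym : y ∈ Set.Ioo α β := ⟨by rw [hy]; linarith, by rw [hy]; linarith⟩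
    obtain ⟨l, hl, hτ, hU⟩ := threshold_eq_of_constrained_eq h1 h2 (hα.trans_lt hxm.1) (hle x hxm)
    obtain ⟨l', hl', hτ', hU'⟩ :=
      threshold_eq_of_constrained_eq h1 h2 (hα.trans_lt hym.1) (hle y hym)
    obtain rfl : l = l' := (FieldProblem.threshold_strictMonoOn (D := S.prob) n).injOn
      (Set.mem_Ioi.2 hl) (Set.mem_Ioi.2 hl') (hτ.trans hτ'.symm)
    have hpα := S.prob.α_pos
    -- Test the load `l + h` at `y` and `l - h` at `x`. As `opt` is convex in the load, adding the
    -- bounds gives `h (y - x) ≤ α h² / 2`, impossible because `α h ≤ y - x`; `h ≤ l` keeps the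
    -- loads nonnegative.
    set h := min l ((y - x) / S.prob.α) with hh
    have hh0 : 0 < h := lt_min hl (div_pos (sub_pos.2 hxy) hpα)
    have hhl : h ≤ l := min_le_left _ _
    have hhd : S.prob.α * h ≤ y - x := by
      have := min_le_right l ((y - x) / S.prob.α)
      rw [← hh, le_div_iff₀ hpα] at this
      linarith
    have i1 := hle y hym (l + h) (by linarith)
    have i2 := hle x hxm (l - h) (by linarith)
    have conv : ∀ m, 2 * S.prob.opt l m ≤ S.prob.opt (l + h) m + S.prob.opt (l - h) m := by
      intro m
      have c1 := FieldProblem.opt_load' (D := S.prob) hl.le (l' := l + h) (by linarith) m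
      have c2 := FieldProblem.opt_load' (D := S.prob) hl.le (l' := l - h) (by linarith) m
      have e : S.prob.α * (l - h - l) * S.prob.total l m
          = -(S.prob.α * (l + h - l) * S.prob.total l m) := by ring
      linarith
    have c1 := mul_le_mul_of_nonneg_left (conv (n + 1)) h1.le
    have c2 := mul_le_mul_of_nonneg_left (conv (n + 2)) h2.le
    rw [hU] at i2
    rw [hU'] at i1
    have : h * (y - x) ≤ S.prob.α * h ^ 2 / 2 := by linarith
    have := mul_pos hh0 (sub_pos.2 hxy)
    nlinarith

variable (S) in
/-- Characterization of the locking states. -/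
theorem setOf_isLockingState :
    {θ : ℝ | IsLockingState S.f (expKernel S.σ) S.zs θ}
      = {θ : ℝ | ∃ N : ℕ, 1 ≤ N ∧ θ = 1 / (N : ℝ)} ∪ {0} := by
  ext θ
  constructor
  · intro hθ
    by_contra hne
    rw [Set.mem_union, not_or] at hne
    obtain ⟨hne1, hne0⟩ := hne
    obtain ⟨h0, h1⟩ := hθ.1
    have hpos : 0 < θ := lt_of_le_of_ne h0 (Ne.symm hne0)
    set k := ⌊1 / θ⌋₊ with hk
    have hk1 : 1 ≤ k := by
      rw [hk, Nat.one_le_floor_iff, le_div_iff₀ hpos]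
      linarith
    have f1 : (k : ℝ) ≤ 1 / θ := Nat.floor_le (by positivity)
    have f2 : 1 / θ < k + 1 := Nat.lt_floor_add_one _
    have f3 : (k : ℝ) ≠ 1 / θ := fun h => hne1 ⟨k, hk1, by rw [h]; simp⟩
    have f4 : (k : ℝ) < 1 / θ := lt_of_le_of_ne f1 f3
    rw [lt_div_iff₀ hpos] at f4
    rw [div_lt_iff₀ hpos] at f2
    obtain ⟨n, hn⟩ : ∃ n, k = n + 1 := ⟨k - 1, by omega⟩
    rw [hn] at f2 f4
    push_cast at f2 f4
    exact not_isLockingState_of_lt (S := S) (n := n) (by linarith) (by linarith) hθ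
  · rintro (⟨N, hN, rfl⟩ | rfl)
    · obtain ⟨n, rfl⟩ : ∃ n, N = n + 1 := ⟨N - 1, by omega⟩
      exact S.isLockingState_one_div n
    · exact S.isLockingState_zero

end Setting

end

end KernelRelaxation

theorem mainTheorem3 (ft : ℝ → ℝ) (zs σ : ℝ)
    (hzs : 0 < zs) (hσ : 0 < σ)
    (hft_nonneg : ∀ x : ℝ, 0 ≤ ft x)
    (hft_conv : StrictConvexOn ℝ Set.univ ft)
    (hft_zero : ft 0 = 0) :
    (∀ z : ℝ, ∃ q : ℝ,
      Tendsto
        (fun N : ℕ => KernelRelaxation.meanMin (KernelRelaxation.truncated ft zs)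
          (KernelRelaxation.expKernel σ) N z)
        atTop (𝓝 (q : EReal))) ∧
    {θ : ℝ | KernelRelaxation.IsLockingState (KernelRelaxation.truncated ft zs)
        (KernelRelaxation.expKernel σ) zs θ}
      = {θ : ℝ | ∃ N : ℕ, 1 ≤ N ∧ θ = 1 / (N : ℝ)} ∪ {0} := by
  let S : KernelRelaxation.Setting := ⟨ft, zs, σ, hzs, hσ, hft_nonneg, hft_conv, hft_zero⟩
  exact ⟨fun z => ⟨S.U z, S.tendsto_meanMin z⟩, S.setOf_isLockingState⟩
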